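/- **Proposition (small affine pushouts).** Let $k$ be a field and $X_k$ a proper irreducible scheme over $k$ which satisfies Serre's condition $S_2$; fix an integer $r$. For a noetherian $k$-scheme $T$ put $X_T = X_k\times_{\mathrm{Spec}(k)} T$ and let $\Phi(T)$ be the collection of all closed subsets $Z\subset X_T$ such that every point $z\in Z$ has codimension $\geq 3$ in its fibre over $T$. Let $F(T)$ be the groupoid whose objects are the pairs $(E,U)$, where $U\subset X_T$ is open with $X_T\setminus U\in\Phi(T)$ and $E$ is a vector bundle of rank $r$ on $U$; a morphism $(E_1,U_1)\to(E_2,U_2)$ is given by an isomorphism $E_1|_W\simeq E_2|_W$ for some open $W\subset U_1\cap U_2$ with $X_T\setminus W\in\Phi(T)$, two such isomorphisms being identified if they agree on a smaller open subset with complement in $\Phi(T)$. A morphism $T'\to T$ induces a pullback functor $F(T)\to F(T')$. For $T=\mathrm{Spec}(A)$ write $F(A)$ for $F(T)$. Given a $k$-algebra homomorphism $C\to A$ and $a\in F(A)$, let $F_a(C)$ be the groupoid of extensions of $a$ over $\mathrm{Spec}(C)$: its objects are pairs $(b,\ b|_{\mathrm{Spec}(A)}\simeq a)$ with $b\in F(C)$,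 and its morphisms are the morphisms in $F(C)$ compatible with the isomorphisms to $a$. Let $A_0$ be a noetherian $k$-algebra and $A$ a noetherian $k$-algebra with a surjection $A\to A_0$ of $k$-algebras with nilpotent kernel. Let $A'\to A$ be a surjection of $k$-algebras such that the kernel of the composition $A'\to A\to A_0$ is nilpotent, and such that $M=\ker(A'\to A)$ is a finite $A_0$-module, that is, $M$ is a finitely generated ideal with $\ker(A'\to A_0)\cdot M=0$. Let $B$ be a noetherian $k$-algebra and $B\to A$ a homomorphism of $k$-algebras such that the composition $B\to A\to A_0$ is surjective. Put $B'=A'\times_A B$. Then for every $a\in F(A)$ the natural functor $$F_a(B')\longrightarrow F_a(A')\times F_a(B)$$ is an equivalence of groupoids. -/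

import Mathlib

open CategoryTheory Limits AlgebraicGeometry

universe u

noncomputable section

namespace RelBundle

/-! ### Pullback of sheaves of modules along morphisms of schemes -/

/-- The pullback `g^* M` of a sheaf of modules. -/
abbrev pull {Y X : Scheme.{u}} (g : Y ⟶ X) (M : X.Modules) : Y.Modules :=
  (Scheme.Modules.pullback g).obj M

/-- The canonical isomorphism `g^* (f^* M) ≅ h^* M` when `h = g ≫ f`. -/
def pullComp {Z Y X : Scheme.{u}} (g : Z ⟶ Y) (f : Y ⟶ X) (h : Z ⟶ X) (w : g ≫ f = h)
    (M : X.Modules) : pull g (pull f M) ≅ pull h M :=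
  (Scheme.Modules.pullbackComp g f).app M ≪≫ eqToIso (by rw [w])

theorem pullComp_naturality {Z Y X : Scheme.{u}} (g : Z ⟶ Y) (f : Y ⟶ X) (h : Z ⟶ X)
    (w : g ≫ f = h) {M N : X.Modules} (φ : M ⟶ N) :
    (Scheme.Modules.pullback g).map ((Scheme.Modules.pullback f).map φ) ≫
      (pullComp g f h w N).hom =
    (pullComp g f h w M).hom ≫ (Scheme.Modules.pullback h).map φ := by
  subst w
  have := (Scheme.Modules.pullbackComp g f).hom.naturality φ
  simpa [pullComp] using this

theorem pullComp_assoc {Z Y X T : Scheme.{u}} (a : Z ⟶ Y) (b : Y ⟶ X) (c : X ⟶ T)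
    (ab : Z ⟶ X) (bc : Y ⟶ T) (abc : Z ⟶ T) (hab : a ≫ b = ab) (hbc : b ≫ c = bc)
    (h₁ : a ≫ bc = abc) (h₂ : ab ≫ c = abc) (M : T.Modules) :
    (Scheme.Modules.pullback a).map (pullComp b c bc hbc M).hom ≫ (pullComp a bc abc h₁ M).hom =
      (pullComp a b ab hab (pull c M)).hom ≫ (pullComp ab c abc h₂ M).hom := by
  subst hab hbc h₂
  have := congr_arg (fun t => t.app M) (Scheme.Modules.pseudofunctor_associativity a b c)
  simp only [NatTrans.comp_app, Functor.whiskerRight_app, Functor.associator_hom_app,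
    Category.id_comp, Functor.whiskerLeft_app, eqToHom_app] at this
  simp only [pullComp, Iso.trans_hom, Iso.app_hom, eqToIso.hom, eqToHom_refl, Category.comp_id]
  have h1 := congr_arg (fun t => (Scheme.Modules.pullback a).map
    ((Scheme.Modules.pullbackComp b c).hom.app M) ≫
    (Scheme.Modules.pullbackComp a (b ≫ c)).hom.app M ≫ t) this
  simp only [Iso.hom_inv_id_app_assoc] at h1
  rw [← h1, ← Functor.map_comp_assoc]
  simp

theorem pullComp_id_left {Y X : Scheme.{u}} (f : Y ⟶ X) (w : 𝟙 Y ≫ f = f) (M : X.Modules) :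
    (pullComp (𝟙 Y) f f w M).hom = (Scheme.Modules.pullbackId Y).hom.app (pull f M) := by
  have := congr_arg (fun t => t.app M) (Scheme.Modules.pseudofunctor_right_unitality f)
  simp only [NatTrans.comp_app, Functor.rightUnitor_hom_app,
    Functor.whiskerLeft_app, eqToHom_app] at this
  simp only [pullComp, Iso.trans_hom, Iso.app_hom, eqToIso.hom]
  rw [← this]
  simp

/-- The restriction of an isomorphism `φ : u₁^* E₁ ≅ u₂^* E₂` over `W` along `k : W' ⟶ W`. -/
def res {W W' U₁ U₂ : Scheme.{u}} {u₁ : W ⟶ U₁} {u₂ : W ⟶ U₂} {E₁ : U₁.Modules} {E₂ : U₂.Modules}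
    (φ : pull u₁ E₁ ≅ pull u₂ E₂) (k : W' ⟶ W) (v₁ : W' ⟶ U₁) (v₂ : W' ⟶ U₂)
    (h₁ : k ≫ u₁ = v₁) (h₂ : k ≫ u₂ = v₂) : pull v₁ E₁ ≅ pull v₂ E₂ :=
  (pullComp k u₁ v₁ h₁ E₁).symm ≪≫ (Scheme.Modules.pullback k).mapIso φ ≪≫ pullComp k u₂ v₂ h₂ E₂

section res

variable {W W' W'' U₁ U₂ U₃ : Scheme.{u}} {u₁ : W ⟶ U₁} {u₂ : W ⟶ U₂} {u₃ : W ⟶ U₃}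
  {E₁ : U₁.Modules} {E₂ : U₂.Modules} {E₃ : U₃.Modules}

theorem res_refl (k : W' ⟶ W) (v₁ : W' ⟶ U₁) (h₁ h₁' : k ≫ u₁ = v₁) :
    res (Iso.refl (pull u₁ E₁)) k v₁ v₁ h₁ h₁' = Iso.refl _ := by
  ext1; simp [res]

theorem res_symm (φ : pull u₁ E₁ ≅ pull u₂ E₂) (k : W' ⟶ W) (v₁ : W' ⟶ U₁) (v₂ : W' ⟶ U₂)
    (h₁ : k ≫ u₁ = v₁) (h₂ : k ≫ u₂ = v₂) :
    res φ.symm k v₂ v₁ h₂ h₁ = (res φ k v₁ v₂ h₁ h₂).symm := by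
  ext1; simp [res]

theorem res_trans (φ : pull u₁ E₁ ≅ pull u₂ E₂) (ψ : pull u₂ E₂ ≅ pull u₃ E₃) (k : W' ⟶ W)
    (v₁ : W' ⟶ U₁) (v₂ : W' ⟶ U₂) (v₃ : W' ⟶ U₃)
    (h₁ : k ≫ u₁ = v₁) (h₂ : k ≫ u₂ = v₂) (h₃ : k ≫ u₃ = v₃) :
    res (φ ≪≫ ψ) k v₁ v₃ h₁ h₃ = res φ k v₁ v₂ h₁ h₂ ≪≫ res ψ k v₂ v₃ h₂ h₃ := by
  ext1; simp [res]

theorem res_id (φ : pull u₁ E₁ ≅ pull u₂ E₂) (h₁ : 𝟙 W ≫ u₁ = u₁) (h₂ : 𝟙 W ≫ u₂ = u₂) :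
    res φ (𝟙 W) u₁ u₂ h₁ h₂ = φ := by
  ext1
  simp only [res, Iso.trans_hom, Iso.symm_hom, Functor.mapIso_hom, Iso.inv_comp_eq,
    pullComp_id_left]
  exact (Scheme.Modules.pullbackId W).hom.naturality φ.hom

theorem res_res (φ : pull u₁ E₁ ≅ pull u₂ E₂) (k : W' ⟶ W) (v₁ : W' ⟶ U₁) (v₂ : W' ⟶ U₂)
    (h₁ : k ≫ u₁ = v₁) (h₂ : k ≫ u₂ = v₂) (l : W'' ⟶ W') (w₁ : W'' ⟶ U₁) (w₂ : W'' ⟶ U₂)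
    (t₁ : l ≫ v₁ = w₁) (t₂ : l ≫ v₂ = w₂) (lk : W'' ⟶ W) (hlk : l ≫ k = lk)
    (s₁ : lk ≫ u₁ = w₁) (s₂ : lk ≫ u₂ = w₂) :
    res (res φ k v₁ v₂ h₁ h₂) l w₁ w₂ t₁ t₂ = res φ lk w₁ w₂ s₁ s₂ := by
  ext1
  simp only [res, Iso.trans_hom, Iso.symm_hom, Functor.mapIso_hom, Functor.map_comp,
    Category.assoc, Iso.inv_comp_eq]
  rw [pullComp_assoc l k u₂ lk v₂ w₂ hlk h₂ t₂ s₂, ← cancel_epi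
    ((Scheme.Modules.pullback l).map (pullComp k u₁ v₁ h₁ E₁).hom),
    reassoc_of% (pullComp_assoc l k u₁ lk v₁ w₁ hlk h₁ t₁ s₁ E₁), ← Functor.map_comp_assoc,
    Iso.hom_inv_id]
  simp only [CategoryTheory.Functor.map_id, Category.id_comp, Iso.hom_inv_id_assoc]
  have := reassoc_of% (pullComp_naturality l k lk hlk φ.hom)
  exact this _

end res

/-- The base change of an isomorphism `φ : u₁^* E₁ ≅ u₂^* E₂` over `W` along `k : W' ⟶ W`, seen
as an isomorphism between restrictions of the pullbacks `g₁^* E₁` and `g₂^* E₂`. -/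
def baseChangeIso {W W' U₁ U₂ U₁' U₂' : Scheme.{u}} {u₁ : W ⟶ U₁} {u₂ : W ⟶ U₂}
    {E₁ : U₁.Modules} {E₂ : U₂.Modules} (φ : pull u₁ E₁ ≅ pull u₂ E₂) (k : W' ⟶ W)
    (g₁ : U₁' ⟶ U₁) (g₂ : U₂' ⟶ U₂) (v₁ : W' ⟶ U₁') (v₂ : W' ⟶ U₂')
    (h₁ : v₁ ≫ g₁ = k ≫ u₁) (h₂ : v₂ ≫ g₂ = k ≫ u₂) :
    pull v₁ (pull g₁ E₁) ≅ pull v₂ (pull g₂ E₂) :=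
  pullComp v₁ g₁ (k ≫ u₁) h₁ E₁ ≪≫ res φ k (k ≫ u₁) (k ≫ u₂) rfl rfl ≪≫
    (pullComp v₂ g₂ (k ≫ u₂) h₂ E₂).symm

section baseChange

variable {W W' W'' U₁ U₂ U₃ U₁' U₂' U₃' : Scheme.{u}} {u₁ : W ⟶ U₁} {u₂ : W ⟶ U₂} {u₃ : W ⟶ U₃}
  {E₁ : U₁.Modules} {E₂ : U₂.Modules} {E₃ : U₃.Modules}

theorem res_eq_of (φ : pull u₁ E₁ ≅ pull u₂ E₂) (k : W' ⟶ W) (v₁ : W' ⟶ U₁) (v₂ : W' ⟶ U₂)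
    (h₁ : k ≫ u₁ = v₁) (h₂ : k ≫ u₂ = v₂) (ψ : pull v₁ E₁ ≅ pull v₂ E₂)
    (h : (pullComp k u₁ v₁ h₁ E₁).hom ≫ ψ.hom =
      (Scheme.Modules.pullback k).map φ.hom ≫ (pullComp k u₂ v₂ h₂ E₂).hom) :
    res φ k v₁ v₂ h₁ h₂ = ψ := by
  ext1
  simp only [res, Iso.trans_hom, Iso.symm_hom, Functor.mapIso_hom, Iso.inv_comp_eq]
  exact h.symm

/-- Restricting a base change. -/
theorem res_baseChangeIso (φ : pull u₁ E₁ ≅ pull u₂ E₂) (k : W' ⟶ W)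
    (g₁ : U₁' ⟶ U₁) (g₂ : U₂' ⟶ U₂) (v₁ : W' ⟶ U₁') (v₂ : W' ⟶ U₂')
    (h₁ : v₁ ≫ g₁ = k ≫ u₁) (h₂ : v₂ ≫ g₂ = k ≫ u₂) (l : W'' ⟶ W') (w₁ : W'' ⟶ U₁')
    (w₂ : W'' ⟶ U₂') (t₁ : l ≫ v₁ = w₁) (t₂ : l ≫ v₂ = w₂) (lk : W'' ⟶ W) (hlk : l ≫ k = lk)
    (s₁ : w₁ ≫ g₁ = lk ≫ u₁) (s₂ : w₂ ≫ g₂ = lk ≫ u₂) :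
    res (baseChangeIso φ k g₁ g₂ v₁ v₂ h₁ h₂) l w₁ w₂ t₁ t₂ =
      baseChangeIso φ lk g₁ g₂ w₁ w₂ s₁ s₂ := by
  subst hlk
  have e₁ : l ≫ k ≫ u₁ = (l ≫ k) ≫ u₁ := (Category.assoc _ _ _).symm
  have e₂ : l ≫ k ≫ u₂ = (l ≫ k) ≫ u₂ := (Category.assoc _ _ _).symm
  apply res_eq_of
  have key := res_res φ k (k ≫ u₁) (k ≫ u₂) rfl rfl l ((l ≫ k) ≫ u₁) ((l ≫ k) ≫ u₂) e₁ e₂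
    (l ≫ k) rfl rfl rfl
  simp only [baseChangeIso, Iso.trans_hom, ← key, Iso.symm_hom, Functor.map_comp, Category.assoc]
  have A₁ := pullComp_assoc l v₁ g₁ w₁ (k ≫ u₁) ((l ≫ k) ≫ u₁) t₁ h₁ e₁ s₁ E₁
  have A₂ := pullComp_assoc l v₂ g₂ w₂ (k ≫ u₂) ((l ≫ k) ≫ u₂) t₂ h₂ e₂ s₂ E₂
  rw [← reassoc_of% A₁]
  have B : (Scheme.Modules.pullback l).map (pullComp v₂ g₂ (k ≫ u₂) h₂ E₂).inv ≫
      (pullComp l v₂ w₂ t₂ (pull g₂ E₂)).hom =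
      (pullComp l (k ≫ u₂) ((l ≫ k) ≫ u₂) e₂ E₂).hom ≫
        (pullComp w₂ g₂ ((l ≫ k) ≫ u₂) s₂ E₂).inv := by
    rw [Iso.eq_comp_inv]
    refine (Category.assoc _ _ _).trans ?_
    rw [← A₂, ← Functor.map_comp_assoc, Iso.inv_hom_id]
    simp
  rw [B]
  conv_lhs => rw [res]
  simp

theorem baseChangeIso_res (φ : pull u₁ E₁ ≅ pull u₂ E₂) (j : W' ⟶ W) (v₁ : W' ⟶ U₁) (v₂ : W' ⟶ U₂)
    (h₁ : j ≫ u₁ = v₁) (h₂ : j ≫ u₂ = v₂) (k : W'' ⟶ W') (g₁ : U₁' ⟶ U₁) (g₂ : U₂' ⟶ U₂)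
    (w₁ : W'' ⟶ U₁') (w₂ : W'' ⟶ U₂') (t₁ : w₁ ≫ g₁ = k ≫ v₁) (t₂ : w₂ ≫ g₂ = k ≫ v₂)
    (kj : W'' ⟶ W) (hkj : k ≫ j = kj) (s₁ : w₁ ≫ g₁ = kj ≫ u₁) (s₂ : w₂ ≫ g₂ = kj ≫ u₂) :
    baseChangeIso (res φ j v₁ v₂ h₁ h₂) k g₁ g₂ w₁ w₂ t₁ t₂ =
      baseChangeIso φ kj g₁ g₂ w₁ w₂ s₁ s₂ := by
  subst hkj h₁ h₂
  have e₁ : k ≫ j ≫ u₁ = (k ≫ j) ≫ u₁ := (Category.assoc _ _ _).symm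
  have e₂ : k ≫ j ≫ u₂ = (k ≫ j) ≫ u₂ := (Category.assoc _ _ _).symm
  have key := res_res φ j (j ≫ u₁) (j ≫ u₂) rfl rfl k (k ≫ j ≫ u₁) (k ≫ j ≫ u₂) rfl rfl
    (k ≫ j) rfl e₁.symm e₂.symm
  simp only [baseChangeIso, key]
  congr! 2

theorem baseChangeIso_refl (k : W' ⟶ W) (g₁ : U₁' ⟶ U₁) (v₁ : W' ⟶ U₁')
    (h₁ h₁' : v₁ ≫ g₁ = k ≫ u₁) :
    baseChangeIso (Iso.refl (pull u₁ E₁)) k g₁ g₁ v₁ v₁ h₁ h₁' = Iso.refl _ := by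
  ext1; simp [baseChangeIso, res_refl]

theorem baseChangeIso_trans (φ : pull u₁ E₁ ≅ pull u₂ E₂) (ψ : pull u₂ E₂ ≅ pull u₃ E₃)
    (k : W' ⟶ W) (g₁ : U₁' ⟶ U₁) (g₂ : U₂' ⟶ U₂) (g₃ : U₃' ⟶ U₃) (v₁ : W' ⟶ U₁') (v₂ : W' ⟶ U₂')
    (v₃ : W' ⟶ U₃') (h₁ : v₁ ≫ g₁ = k ≫ u₁) (h₂ : v₂ ≫ g₂ = k ≫ u₂) (h₃ : v₃ ≫ g₃ = k ≫ u₃) :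
    baseChangeIso (φ ≪≫ ψ) k g₁ g₃ v₁ v₃ h₁ h₃ =
      baseChangeIso φ k g₁ g₂ v₁ v₂ h₁ h₂ ≪≫ baseChangeIso ψ k g₂ g₃ v₂ v₃ h₂ h₃ := by
  ext1
  simp [baseChangeIso, res_trans φ ψ k _ (k ≫ u₂) _ rfl rfl rfl]

/-- The canonical isomorphism `w^* (g'^* (g^* E)) ≅ x^* (h^* E)` when `w ≫ g' ≫ g = x ≫ h`. -/
def compareIso {V U U' U'' U₀ : Scheme.{u}} (E : U.Modules) (g : U' ⟶ U) (g' : U'' ⟶ U')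
    (w : V ⟶ U'') (h : U₀ ⟶ U) (x : V ⟶ U₀) (e : (w ≫ g') ≫ g = x ≫ h) :
    pull w (pull g' (pull g E)) ≅ pull x (pull h E) :=
  pullComp w g' (w ≫ g') rfl (pull g E) ≪≫ pullComp (w ≫ g') g (x ≫ h) e E ≪≫
    (pullComp x h (x ≫ h) rfl E).symm

theorem compareIso_eq {V U U' U'' U₀ : Scheme.{u}} (E : U.Modules) (g : U' ⟶ U) (g' : U'' ⟶ U')
    (w : V ⟶ U'') (h : U₀ ⟶ U) (x : V ⟶ U₀) (e : (w ≫ g') ≫ g = x ≫ h) (y : V ⟶ U') (t : V ⟶ U)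
    (hy : w ≫ g' = y) (hyt : y ≫ g = t) (hxt : x ≫ h = t) :
    compareIso E g g' w h x e =
      pullComp w g' y hy (pull g E) ≪≫ pullComp y g t hyt E ≪≫ (pullComp x h t hxt E).symm := by
  subst hy hxt
  rfl

theorem baseChangeIso_eq (φ : pull u₁ E₁ ≅ pull u₂ E₂) (k : W' ⟶ W)
    (g₁ : U₁' ⟶ U₁) (g₂ : U₂' ⟶ U₂) (v₁ : W' ⟶ U₁') (v₂ : W' ⟶ U₂')
    (h₁ : v₁ ≫ g₁ = k ≫ u₁) (h₂ : v₂ ≫ g₂ = k ≫ u₂) (t₁ : W' ⟶ U₁) (t₂ : W' ⟶ U₂)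
    (e₁ : k ≫ u₁ = t₁) (e₂ : k ≫ u₂ = t₂) :
    baseChangeIso φ k g₁ g₂ v₁ v₂ h₁ h₂ =
      pullComp v₁ g₁ t₁ (h₁.trans e₁) E₁ ≪≫ res φ k t₁ t₂ e₁ e₂ ≪≫
        (pullComp v₂ g₂ t₂ (h₂.trans e₂) E₂).symm := by
  subst e₁ e₂
  rfl

/-- Restricting a comparison isomorphism. -/
theorem res_compareIso {V V' U U' U'' U₀ : Scheme.{u}} (E : U.Modules) (g : U' ⟶ U)
    (g' : U'' ⟶ U') (w : V ⟶ U'') (h : U₀ ⟶ U) (x : V ⟶ U₀) (e : (w ≫ g') ≫ g = x ≫ h)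
    (l : V' ⟶ V) (lw : V' ⟶ U'') (lx : V' ⟶ U₀) (hw : l ≫ w = lw) (hx : l ≫ x = lx)
    (e' : (lw ≫ g') ≫ g = lx ≫ h) :
    res (compareIso E g g' w h x e) l lw lx hw hx = compareIso E g g' lw h lx e' := by
  have hy : lw ≫ g' = l ≫ w ≫ g' := by rw [← hw, Category.assoc]
  have hyt : (l ≫ w ≫ g') ≫ g = l ≫ x ≫ h := by rw [← e, Category.assoc]
  have hxt : lx ≫ h = l ≫ x ≫ h := by rw [← hx, Category.assoc]
  rw [compareIso_eq E g g' lw h lx e' (l ≫ w ≫ g') (l ≫ x ≫ h) hy hyt hxt]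
  apply res_eq_of
  have A₁ := pullComp_assoc l w g' lw (w ≫ g') (l ≫ w ≫ g') hw rfl rfl hy (pull g E)
  have A₂ := pullComp_assoc l (w ≫ g') g (l ≫ w ≫ g') (x ≫ h) (l ≫ x ≫ h) rfl e rfl hyt E
  have A₃ := pullComp_assoc l x h lx (x ≫ h) (l ≫ x ≫ h) hx rfl rfl hxt E
  simp only [compareIso, Iso.trans_hom, Iso.symm_hom, Functor.map_comp, Category.assoc]
  rw [← reassoc_of% A₁, ← reassoc_of% A₂]
  congr 2
  rw [Iso.comp_inv_eq]
  refine Eq.trans ?_ (Category.assoc _ _ _).symm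
  rw [← A₃, ← Functor.map_comp_assoc, Iso.inv_hom_id]
  simp

/-- The comparison isomorphisms are compatible with base change. -/
theorem baseChangeIso_compareIso {U₁'' U₂'' V₁ V₂ : Scheme.{u}} (φ : pull u₁ E₁ ≅ pull u₂ E₂)
    (k : W' ⟶ W)
    (g₁ : U₁' ⟶ U₁) (g₂ : U₂' ⟶ U₂) (v₁ : W' ⟶ U₁') (v₂ : W' ⟶ U₂')
    (h₁ : v₁ ≫ g₁ = k ≫ u₁) (h₂ : v₂ ≫ g₂ = k ≫ u₂) (k' : W'' ⟶ W')
    (g₁' : U₁'' ⟶ U₁') (g₂' : U₂'' ⟶ U₂') (w₁ : W'' ⟶ U₁'') (w₂ : W'' ⟶ U₂'')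
    (t₁ : w₁ ≫ g₁' = k' ≫ v₁) (t₂ : w₂ ≫ g₂' = k' ≫ v₂)
    (c₁ : V₁ ⟶ U₁) (c₂ : V₂ ⟶ U₂) (x₁ : W'' ⟶ V₁) (x₂ : W'' ⟶ V₂) (kk : W'' ⟶ W)
    (hkk : k' ≫ k = kk)
    (e₁ : (w₁ ≫ g₁') ≫ g₁ = x₁ ≫ c₁) (e₂ : (w₂ ≫ g₂') ≫ g₂ = x₂ ≫ c₂)
    (s₁ : x₁ ≫ c₁ = kk ≫ u₁) (s₂ : x₂ ≫ c₂ = kk ≫ u₂) :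
    baseChangeIso (baseChangeIso φ k g₁ g₂ v₁ v₂ h₁ h₂) k' g₁' g₂' w₁ w₂ t₁ t₂ ≪≫
        compareIso E₂ g₂ g₂' w₂ c₂ x₂ e₂ =
      compareIso E₁ g₁ g₁' w₁ c₁ x₁ e₁ ≪≫ baseChangeIso φ kk c₁ c₂ x₁ x₂ s₁ s₂ := by
  have a₁ : (k' ≫ v₁) ≫ g₁ = kk ≫ u₁ := by rw [← t₁, e₁, s₁]
  have a₂ : (k' ≫ v₂) ≫ g₂ = kk ≫ u₂ := by rw [← t₂, e₂, s₂]
  rw [compareIso_eq E₂ g₂ g₂' w₂ c₂ x₂ e₂ (k' ≫ v₂) (kk ≫ u₂) t₂ a₂ s₂,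
    compareIso_eq E₁ g₁ g₁' w₁ c₁ x₁ e₁ (k' ≫ v₁) (kk ≫ u₁) t₁ a₁ s₁]
  have key := res_baseChangeIso φ k g₁ g₂ v₁ v₂ h₁ h₂ k' (k' ≫ v₁) (k' ≫ v₂) rfl rfl kk hkk a₁ a₂
  conv_lhs => rw [baseChangeIso, key]
  ext1
  simp [baseChangeIso]

end baseChange

/-! ### The groupoid `F(T)` -/

variable {X S : Scheme.{u}} (f : X ⟶ S)

/-- The base change `X_T = X ×_S T`. -/
abbrev XT (T : Over S) : Scheme.{u} := pullback f T.hom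

/-- The projection `X_T ⟶ T`. -/
abbrev proj (T : Over S) : XT f T ⟶ T.left := pullback.snd f T.hom

/-- `Phi f T` is the collection of all closed subsets `Z` of `X_T` such that every point `z` of
`Z` has codimension at least `3` in its (scheme-theoretic) fibre over `T`. The codimension of a
point is the maximal length of a chain of generalizations of it, i.e. its `Order.coheight`. -/
def Phi (T : Over S) : Set (Set (XT f T)) :=
  {Z | IsClosed Z ∧ ∀ z ∈ Z, 3 ≤ Order.coheight ((proj f T).asFiber z)}

/-- A sheaf of modules is locally free of rank `r`, i.e. a vector bundle of rank `r`. -/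
def IsLocallyFreeOfRank {Y : Scheme.{u}} (M : Y.Modules) (r : ℕ) : Prop :=
  ∀ y : Y, ∃ V : Y.Opens, y ∈ V ∧
    Nonempty (pull V.ι M ≅
      (SheafOfModules.free (ULift.{u} (Fin r)) : SheafOfModules V.toScheme.ringCatSheaf))

/-- The objects of `F(T)`: vector bundles `E` of rank `r` on an open subscheme `U` of `X_T` whose
complement is in `Phi f T`. -/
structure Bun (r : ℕ) (T : Over S) where
  U : (XT f T).Opens
  compl_mem : (U : Set (XT f T))ᶜ ∈ Phi f T
  E : U.toScheme.Modules
  locallyFree : IsLocallyFreeOfRank E r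

variable {f}

theorem univ_compl_mem (T : Over S) : ((⊤ : (XT f T).Opens) : Set (XT f T))ᶜ ∈ Phi f T := by
  simp [Phi]

theorem inf_compl_mem {T : Over S} {U V : (XT f T).Opens} (hU : (U : Set (XT f T))ᶜ ∈ Phi f T)
    (hV : (V : Set (XT f T))ᶜ ∈ Phi f T) :
    ((U ⊓ V : (XT f T).Opens) : Set (XT f T))ᶜ ∈ Phi f T := by
  refine ⟨(U ⊓ V).isOpen.isClosed_compl, fun z hz => ?_⟩
  by_cases h : z ∈ U
  · exact hV.2 z fun h' => hz ⟨h, h'⟩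
  · exact hU.2 z h

namespace Bun

variable {r : ℕ} {T : Over S}

/-- An isomorphism between the restrictions of two vector bundles to an open subset `W` whose
complement is in `Phi f T`. -/
structure PartialIso (P Q : Bun f r T) where
  W : (XT f T).Opens
  compl_mem : (W : Set (XT f T))ᶜ ∈ Phi f T
  le₁ : W ≤ P.U
  le₂ : W ≤ Q.U
  iso : pull ((XT f T).homOfLE le₁) P.E ≅ pull ((XT f T).homOfLE le₂) Q.E

namespace PartialIso

variable {P Q R : Bun f r T}

/-- The restriction of a partial isomorphism to a smaller open subset. -/
def restr (φ : PartialIso P Q) (V : (XT f T).Opens) (h : V ≤ φ.W) :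
    pull ((XT f T).homOfLE (h.trans φ.le₁)) P.E ≅ pull ((XT f T).homOfLE (h.trans φ.le₂)) Q.E :=
  res φ.iso ((XT f T).homOfLE h) _ _ (by simp) (by simp)

/-- Two partial isomorphisms are identified when they agree on a smaller open subset whose
complement is in `Phi f T`. -/
def Rel (φ ψ : PartialIso P Q) : Prop :=
  ∃ (V : (XT f T).Opens) (_ : (V : Set (XT f T))ᶜ ∈ Phi f T) (h₁ : V ≤ φ.W) (h₂ : V ≤ ψ.W),
    φ.restr V h₁ = ψ.restr V h₂

theorem restr_restr (φ : PartialIso P Q) {V V' : (XT f T).Opens} (h : V ≤ φ.W) (h' : V' ≤ V) :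
    res (φ.restr V h) ((XT f T).homOfLE h') ((XT f T).homOfLE ((h'.trans h).trans φ.le₁))
      ((XT f T).homOfLE ((h'.trans h).trans φ.le₂)) (by simp) (by simp) =
      φ.restr V' (h'.trans h) :=
  res_res _ _ _ _ _ _ _ _ _ _ _ _ (by simp) _ _

theorem restr_eq_of_le {φ ψ : PartialIso P Q} {V V' : (XT f T).Opens} (h₁ : V ≤ φ.W)
    (h₂ : V ≤ ψ.W) (h : φ.restr V h₁ = ψ.restr V h₂) (h' : V' ≤ V) :
    φ.restr V' (h'.trans h₁) = ψ.restr V' (h'.trans h₂) := by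
  rw [← restr_restr φ h₁ h', ← restr_restr ψ h₂ h', h]

theorem rel_equivalence : Equivalence (Rel (P := P) (Q := Q)) where
  refl φ := ⟨φ.W, φ.compl_mem, le_rfl, le_rfl, rfl⟩
  symm := fun ⟨V, hV, h₁, h₂, h⟩ => ⟨V, hV, h₂, h₁, h.symm⟩
  trans := fun ⟨V, hV, h₁, h₂, h⟩ ⟨V', hV', h₁', h₂', h'⟩ =>
    ⟨V ⊓ V', inf_compl_mem hV hV', inf_le_left.trans h₁, inf_le_right.trans h₂',
      (restr_eq_of_le h₁ h₂ h inf_le_left).trans (restr_eq_of_le h₁' h₂' h' inf_le_right)⟩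

instance setoid (P Q : Bun f r T) : Setoid (PartialIso P Q) := ⟨Rel, rel_equivalence⟩

/-- The identity isomorphism. -/
def refl (P : Bun f r T) : PartialIso P P := ⟨P.U, P.compl_mem, le_rfl, le_rfl, Iso.refl _⟩

/-- The inverse of a partial isomorphism. -/
def symm (φ : PartialIso P Q) : PartialIso Q P := ⟨φ.W, φ.compl_mem, φ.le₂, φ.le₁, φ.iso.symm⟩

/-- The composition of two partial isomorphisms, defined over the intersection. -/
def trans (φ : PartialIso P Q) (ψ : PartialIso Q R) : PartialIso P R where
  W := φ.W ⊓ ψ.W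
  compl_mem := inf_compl_mem φ.compl_mem ψ.compl_mem
  le₁ := inf_le_left.trans φ.le₁
  le₂ := inf_le_right.trans ψ.le₂
  iso := φ.restr _ inf_le_left ≪≫ ψ.restr _ inf_le_right

theorem trans_le_left (φ : PartialIso P Q) (ψ : PartialIso Q R) : (φ.trans ψ).W ≤ φ.W :=
  inf_le_left

theorem trans_le_right (φ : PartialIso P Q) (ψ : PartialIso Q R) : (φ.trans ψ).W ≤ ψ.W :=
  inf_le_right

theorem le_trans_W (φ : PartialIso P Q) (ψ : PartialIso Q R) {V : (XT f T).Opens} (h : V ≤ φ.W)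
    (h' : V ≤ ψ.W) : V ≤ (φ.trans ψ).W :=
  le_inf h h'

theorem refl_restr (P : Bun f r T) (V : (XT f T).Opens) (h : V ≤ (refl P).W) :
    (refl P).restr V h = Iso.refl _ :=
  res_refl _ _ _ _

theorem symm_restr (φ : PartialIso P Q) (V : (XT f T).Opens) (h : V ≤ φ.symm.W)
    (h' : V ≤ φ.W) : φ.symm.restr V h = (φ.restr V h').symm :=
  res_symm _ _ _ _ _ _

theorem trans_restr (φ : PartialIso P Q) (ψ : PartialIso Q R) (V : (XT f T).Opens)
    (h : V ≤ (φ.trans ψ).W) (h₁ : V ≤ φ.W) (h₂ : V ≤ ψ.W) :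
    (φ.trans ψ).restr V h = φ.restr V h₁ ≪≫ ψ.restr V h₂ := by
  rw [← restr_restr φ (trans_le_left φ ψ) h, ← restr_restr ψ (trans_le_right φ ψ) h]
  exact res_trans _ _ _ _ _ _ _ _ _

theorem trans_rel {φ φ' : PartialIso P Q} (h : Rel φ φ') {ψ ψ' : PartialIso Q R}
    (h' : Rel ψ ψ') : Rel (φ.trans ψ) (φ'.trans ψ') := by
  obtain ⟨V, hV, h₁, h₂, e⟩ := h
  obtain ⟨V', hV', h₁', h₂', e'⟩ := h'
  have l : V ⊓ V' ≤ V := inf_le_left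
  have l' : V ⊓ V' ≤ V' := inf_le_right
  refine ⟨V ⊓ V', inf_compl_mem hV hV', le_trans_W _ _ (l.trans h₁) (l'.trans h₁'),
    le_trans_W _ _ (l.trans h₂) (l'.trans h₂'), ?_⟩
  rw [trans_restr φ ψ _ _ (l.trans h₁) (l'.trans h₁'),
    trans_restr φ' ψ' _ _ (l.trans h₂) (l'.trans h₂'), restr_eq_of_le h₁ h₂ e l,
    restr_eq_of_le h₁' h₂' e' l']

theorem symm_rel {φ φ' : PartialIso P Q} (h : Rel φ φ') : Rel φ.symm φ'.symm := by
  obtain ⟨V, hV, h₁, h₂, e⟩ := h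
  exact ⟨V, hV, h₁, h₂, by rw [symm_restr φ V h₁ h₁, symm_restr φ' V h₂ h₂, e]⟩

theorem refl_trans_rel (φ : PartialIso P Q) : Rel ((refl P).trans φ) φ := by
  refine ⟨_, ((refl P).trans φ).compl_mem, le_rfl, trans_le_right _ _, ?_⟩
  rw [trans_restr _ _ _ _ (trans_le_left _ _) (trans_le_right _ _), refl_restr]
  exact Iso.refl_trans _

theorem trans_refl_rel (φ : PartialIso P Q) : Rel (φ.trans (refl Q)) φ := by
  refine ⟨_, (φ.trans (refl Q)).compl_mem, le_rfl, trans_le_left _ _, ?_⟩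
  rw [trans_restr _ _ _ _ (trans_le_left _ _) (trans_le_right _ _), refl_restr]
  exact Iso.trans_refl _

theorem assoc_rel {R' : Bun f r T} (φ : PartialIso P Q) (ψ : PartialIso Q R)
    (χ : PartialIso R R') : Rel ((φ.trans ψ).trans χ) (φ.trans (ψ.trans χ)) := by
  have h₁₂ := trans_le_left (φ.trans ψ) χ
  have h₃ := trans_le_right (φ.trans ψ) χ
  have h₁ := h₁₂.trans (trans_le_left φ ψ)
  have h₂ := h₁₂.trans (trans_le_right φ ψ)
  have h₂₃ := le_trans_W ψ χ h₂ h₃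
  refine ⟨_, ((φ.trans ψ).trans χ).compl_mem, le_rfl, le_trans_W _ _ h₁ h₂₃, ?_⟩
  rw [trans_restr _ _ _ _ h₁₂ h₃, trans_restr _ _ _ _ h₁ h₂, trans_restr _ _ _ _ h₁ h₂₃,
    trans_restr _ _ _ _ h₂ h₃]
  exact Iso.trans_assoc _ _ _

theorem symm_trans_rel (φ : PartialIso P Q) : Rel (φ.symm.trans φ) (refl Q) := by
  refine ⟨φ.W, φ.compl_mem, le_trans_W φ.symm φ le_rfl le_rfl, φ.le₂, ?_⟩
  refine (trans_restr φ.symm φ φ.W _ le_rfl le_rfl).trans ?_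
  refine Eq.trans ?_ (refl_restr Q φ.W φ.le₂).symm
  rw [symm_restr φ φ.W le_rfl le_rfl]
  exact Iso.symm_self_id _

theorem trans_symm_rel (φ : PartialIso P Q) : Rel (φ.trans φ.symm) (refl P) := by
  refine ⟨φ.W, φ.compl_mem, le_trans_W φ φ.symm le_rfl le_rfl, φ.le₁, ?_⟩
  refine (trans_restr φ φ.symm φ.W _ le_rfl le_rfl).trans ?_
  refine Eq.trans ?_ (refl_restr P φ.W φ.le₁).symm
  rw [symm_restr φ φ.W le_rfl le_rfl]
  exact Iso.self_symm_id _

end PartialIso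

open PartialIso in
/-- `F(T)` is a groupoid: a morphism is an isomorphism of bundles over some open subset with
complement in `Phi f T`, two of these being identified when they agree on a smaller such subset. -/
instance groupoid : Groupoid (Bun f r T) where
  Hom P Q := Quotient (PartialIso.setoid P Q)
  id P := Quotient.mk _ (PartialIso.refl P)
  comp := Quotient.map₂ PartialIso.trans fun _ _ h _ _ h' => trans_rel h h'
  inv := Quotient.map PartialIso.symm fun _ _ h => symm_rel h
  id_comp := by
    rintro P Q ⟨φ⟩
    exact Quotient.sound (refl_trans_rel φ)
  comp_id := by
    rintro P Q ⟨φ⟩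
    exact Quotient.sound (trans_refl_rel φ)
  assoc := by
    rintro P Q R R' ⟨φ⟩ ⟨ψ⟩ ⟨χ⟩
    exact Quotient.sound (assoc_rel φ ψ χ)
  inv_comp := by
    rintro P Q ⟨φ⟩
    exact Quotient.sound (symm_trans_rel φ)
  comp_inv := by
    rintro P Q ⟨φ⟩
    exact Quotient.sound (trans_symm_rel φ)

/-- The morphism of `F(T)` given by a partial isomorphism. -/
def germ {P Q : Bun f r T} (φ : PartialIso P Q) : P ⟶ Q := Quotient.mk (PartialIso.setoid P Q) φ

theorem germ_eq {P Q : Bun f r T} {φ ψ : PartialIso P Q} (h : PartialIso.Rel φ ψ) :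
    germ φ = germ ψ := Quotient.sound h

end Bun

/-! ### Pullback along morphisms `T' ⟶ T` -/

/-- The morphism `X_{T'} ⟶ X_T` induced by `α : T' ⟶ T`. -/
def baseMap (f : X ⟶ S) {T' T : Over S} (α : T' ⟶ T) : XT f T' ⟶ XT f T :=
  pullback.lift (pullback.fst f T'.hom) (proj f T' ≫ α.left) (by
    rw [pullback.condition, Category.assoc, Over.w])

theorem baseMap_comp {T'' T' T : Over S} (α : T'' ⟶ T') (β : T' ⟶ T) :
    baseMap f (α ≫ β) = baseMap f α ≫ baseMap f β := by
  apply pullback.hom_ext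
  · simp only [baseMap, pullback.lift_fst, Category.assoc]
  · simp only [baseMap, pullback.lift_snd, pullback.lift_snd_assoc, Category.assoc, Over.comp_left]

theorem isPullback_baseMap {T' T : Over S} (α : T' ⟶ T) :
    IsPullback (baseMap f α) (proj f T') (proj f T) α.left := by
  have h₁ : IsPullback (pullback.fst f T.hom) (proj f T) f T.hom := IsPullback.of_hasPullback _ _
  have h₂ : IsPullback (pullback.fst f T'.hom) (proj f T') f T'.hom := IsPullback.of_hasPullback _ _
  refine IsPullback.of_right (t := h₁) ?_ ?_
  · have e : T'.hom = α.left ≫ T.hom := (Over.w α).symm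
    rw [baseMap, pullback.lift_fst, ← e]
    exact h₂
  · simp only [baseMap, pullback.lift_snd]

theorem coheight_le_of_generalizingMap {Y Z : Scheme.{u}} (m : Y ⟶ Z) (hm : GeneralizingMap m)
    (y : Y) : Order.coheight (m y) ≤ Order.coheight y := by
  have key : ∀ (p : LTSeries Z) (y : Y), m y = p.head →
      (p.length : ℕ∞) ≤ Order.coheight y := by
    intro p
    induction p using RelSeries.inductionOn with
    | singleton x => intro y _; simp
    | cons p x hx ih =>
      intro y hy
      obtain ⟨y', hy', h⟩ : ∃ y', y' ⤳ y ∧ m y' = p.head := by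
        have h1 : p.head ⤳ m y := by
          have := (show x < p.head from hx).le
          rw [hy, RelSeries.head_cons]; exact this
        obtain ⟨y', h1, h2⟩ := hm h1
        exact ⟨y', h1, h2⟩
      have hlt : y < y' := by
        refine lt_of_le_not_ge hy' fun h' => ?_
        have h2 : y ⤳ y' := h'
        have h3 : m y ⤳ m y' := h2.map m.continuous
        rw [hy, h, RelSeries.head_cons] at h3
        exact (show x < p.head from hx).not_ge h3
      have := ih y' h
      calc ((p.cons x hx).length : ℕ∞) = p.length + 1 := by simp
        _ ≤ Order.coheight y' + 1 := by gcongr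
        _ ≤ _ := Order.coheight_add_one_le hlt
  exact Order.coheight_le fun p hp => key p y hp.symm

theorem coheight_asFiber {Y Z : Scheme.{u}} (g : Y ⟶ Z) (y : Y) (z : Z) (w : g.fiber z)
    (h : g.fiberι z w = y) : Order.coheight (g.asFiber y) = Order.coheight w := by
  have hz : g y = z := by
    have : g.fiberι z w ∈ g ⁻¹' {z} := g.range_fiberι z ▸ Set.mem_range_self w
    rw [h] at this
    exact this
  subst hz
  congr 1
  apply (g.fiberι (g y)).isEmbedding.injective
  rw [h, Scheme.Hom.fiberι_asFiber]

/-- Codimension in the fibre does not drop under base change. -/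
theorem coheight_asFiber_baseMap_le {T' T : Over S} (α : T' ⟶ T) (x : XT f T') :
    Order.coheight ((proj f T).asFiber (baseMap f α x)) ≤
      Order.coheight ((proj f T').asFiber x) := by
  have h := isPullback_fiberToSpecResidueField_of_isPullback (isPullback_baseMap (f := f) α)
    (proj f T' x)
  set m := pullback.map (proj f T') (T'.left.fromSpecResidueField (proj f T' x)) (proj f T)
    (T.left.fromSpecResidueField (α.left (proj f T' x))) (baseMap f α)
    (Spec.map (α.left.residueFieldMap (proj f T' x))) α.left
    (isPullback_baseMap (f := f) α).w.symm (by simp) with hm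
  have : Flat (Spec.map (α.left.residueFieldMap (proj f T' x))) := by
    rw [Flat.SpecMap_iff]
    algebraize [(α.left.residueFieldMap (proj f T' x)).hom]
    exact inferInstanceAs (Module.Flat (T.left.residueField _) (T'.left.residueField _))
  have hflat : Flat m := MorphismProperty.of_isPullback (P := @Flat) h.flip this
  have key := coheight_le_of_generalizingMap m (Flat.generalizingMap m) ((proj f T').asFiber x)
  refine (coheight_asFiber (proj f T) (baseMap f α x) _ (m ((proj f T').asFiber x)) ?_).trans_le key
  have hc : m ≫ (proj f T).fiberι (α.left (proj f T' x)) =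
      (proj f T').fiberι (proj f T' x) ≫ baseMap f α := pullback.lift_fst _ _ _
  have h2 : (m ≫ (proj f T).fiberι (α.left (proj f T' x))) ((proj f T').asFiber x) =
      ((proj f T').fiberι (proj f T' x) ≫ baseMap f α) ((proj f T').asFiber x) :=
    congrArg (fun t : (proj f T').fiber (proj f T' x) ⟶ XT f T => t ((proj f T').asFiber x)) hc
  refine h2.trans ?_
  rw [Scheme.Hom.comp_apply, Scheme.Hom.fiberι_asFiber]

theorem preimage_compl_mem {T' T : Over S} (α : T' ⟶ T) {U : (XT f T).Opens}
    (hU : (U : Set (XT f T))ᶜ ∈ Phi f T) :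
    ((baseMap f α ⁻¹ᵁ U : (XT f T').Opens) : Set (XT f T'))ᶜ ∈ Phi f T' :=
  ⟨(baseMap f α ⁻¹ᵁ U).isOpen.isClosed_compl, fun z hz =>
    (hU.2 (baseMap f α z) hz).trans (coheight_asFiber_baseMap_le α z)⟩

theorem IsLocallyFreeOfRank.pull {Y Z : Scheme.{u}} (g : Y ⟶ Z) {M : Z.Modules} {r : ℕ}
    (hM : IsLocallyFreeOfRank M r) : IsLocallyFreeOfRank (pull g M) r := by
  intro y
  obtain ⟨V, hV, ⟨e⟩⟩ := hM (g y)
  refine ⟨g ⁻¹ᵁ V, hV, ⟨pullComp _ _ _ rfl M ≪≫ (pullComp (g ∣_ V) V.ι _ (by simp) M).symm ≪≫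
    (Scheme.Modules.pullback (g ∣_ V)).mapIso e ≪≫ ?_⟩⟩
  have : (TopologicalSpace.Opens.map (g ∣_ V).base).Final := by
    apply Functor.final_of_exists_of_isFiltered
    · exact fun d => ⟨⊤, ⟨homOfLE le_top⟩⟩
    · exact fun {d c} s s' => ⟨c, 𝟙 _, Subsingleton.elim _ _⟩
  have : (SheafOfModules.pushforward.{u} (g ∣_ V).toRingCatSheafHom).IsRightAdjoint :=
    inferInstanceAs (Scheme.Modules.pushforward (g ∣_ V)).IsRightAdjoint
  exact SheafOfModules.pullbackObjFreeIso (g ∣_ V).toRingCatSheafHom (ULift.{u} (Fin r))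

theorem homOfLE_morphismRestrict_ι {Y Z : Scheme.{u}} (g : Y ⟶ Z) {V : Y.Opens} {U : Z.Opens}
    (h : V ≤ g ⁻¹ᵁ U) : (Y.homOfLE h ≫ g ∣_ U) ≫ U.ι = V.ι ≫ g := by
  simp

theorem homOfLE_morphismRestrict_comp {Y Z : Scheme.{u}} (g : Y ⟶ Z) {V U : Z.Opens}
    (h : V ≤ U) {V' : Y.Opens} (h' : V' ≤ g ⁻¹ᵁ V) (h'' : V' ≤ g ⁻¹ᵁ U) :
    Y.homOfLE h'' ≫ g ∣_ U = (Y.homOfLE h' ≫ g ∣_ V) ≫ Z.homOfLE h := by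
  rw [← cancel_mono U.ι]
  simp

theorem preimage_le_of_comp_eq {Z Y X : Scheme.{u}} {a : Z ⟶ Y} {b : Y ⟶ X} {c : Z ⟶ X}
    (h : a ≫ b = c) (U : X.Opens) : c ⁻¹ᵁ U ≤ a ⁻¹ᵁ b ⁻¹ᵁ U := by
  subst h; exact le_rfl

theorem homOfLE_morphismRestrict_of_comp_eq {Z Y X : Scheme.{u}} {a : Z ⟶ Y} {b : Y ⟶ X}
    {c : Z ⟶ X} (h : a ≫ b = c) (U : X.Opens) {V : Z.Opens} (h₁ : V ≤ a ⁻¹ᵁ b ⁻¹ᵁ U)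
    (h₂ : V ≤ c ⁻¹ᵁ U) :
    (Z.homOfLE h₁ ≫ a ∣_ (b ⁻¹ᵁ U)) ≫ b ∣_ U = Z.homOfLE h₂ ≫ c ∣_ U := by
  rw [← cancel_mono U.ι]
  simp [← h]

namespace Bun

variable {r : ℕ} {T T' T'' : Over S}

/-- The pullback of `(E, U)` along `α : T' ⟶ T`. -/
def pullObj (α : T' ⟶ T) (P : Bun f r T) : Bun f r T' where
  U := baseMap f α ⁻¹ᵁ P.U
  compl_mem := preimage_compl_mem α P.compl_mem
  E := pull (baseMap f α ∣_ P.U) P.E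
  locallyFree := P.locallyFree.pull _

namespace PartialIso

variable {P Q R : Bun f r T}

/-- The pullback of a partial isomorphism along `α : T' ⟶ T`. -/
def pullback (α : T' ⟶ T) (φ : PartialIso P Q) : PartialIso (pullObj α P) (pullObj α Q) where
  W := baseMap f α ⁻¹ᵁ φ.W
  compl_mem := preimage_compl_mem α φ.compl_mem
  le₁ := (baseMap f α).preimage_mono φ.le₁
  le₂ := (baseMap f α).preimage_mono φ.le₂
  iso := baseChangeIso φ.iso (baseMap f α ∣_ φ.W) (baseMap f α ∣_ P.U) (baseMap f α ∣_ Q.U) _ _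
    (morphismRestrict_homOfLE _ _ _ _).symm (morphismRestrict_homOfLE _ _ _ _).symm

theorem pullback_mono (α : T' ⟶ T) (φ : PartialIso P Q) {V : (XT f T).Opens} (h : V ≤ φ.W) :
    baseMap f α ⁻¹ᵁ V ≤ (φ.pullback α).W :=
  (baseMap f α).preimage_mono h

theorem pullback_restr' (α : T' ⟶ T) (φ : PartialIso P Q) (V : (XT f T').Opens)
    (h : V ≤ (φ.pullback α).W) (h' : V ≤ baseMap f α ⁻¹ᵁ φ.W) :
    (φ.pullback α).restr V h =
      baseChangeIso φ.iso ((XT f T').homOfLE h' ≫ baseMap f α ∣_ φ.W)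
        (baseMap f α ∣_ P.U) (baseMap f α ∣_ Q.U)
        ((XT f T').homOfLE (h'.trans ((baseMap f α).preimage_mono φ.le₁)))
        ((XT f T').homOfLE (h'.trans ((baseMap f α).preimage_mono φ.le₂)))
        (homOfLE_morphismRestrict_comp _ _ _ _) (homOfLE_morphismRestrict_comp _ _ _ _) := by
  have A := res_baseChangeIso φ.iso (baseMap f α ∣_ φ.W) (baseMap f α ∣_ P.U) (baseMap f α ∣_ Q.U)
    ((XT f T').homOfLE ((baseMap f α).preimage_mono φ.le₁))
    ((XT f T').homOfLE ((baseMap f α).preimage_mono φ.le₂))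
    (morphismRestrict_homOfLE _ _ _ _).symm (morphismRestrict_homOfLE _ _ _ _).symm
    ((XT f T').homOfLE h')
    ((XT f T').homOfLE (h'.trans ((baseMap f α).preimage_mono φ.le₁)))
    ((XT f T').homOfLE (h'.trans ((baseMap f α).preimage_mono φ.le₂)))
    (Scheme.homOfLE_homOfLE _ _ _) (Scheme.homOfLE_homOfLE _ _ _)
    ((XT f T').homOfLE h' ≫ baseMap f α ∣_ φ.W) rfl
    (homOfLE_morphismRestrict_comp _ _ _ _) (homOfLE_morphismRestrict_comp _ _ _ _)
  unfold restr PartialIso.pullback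
  dsimp only
  exact A

theorem pullback_restr (α : T' ⟶ T) (φ : PartialIso P Q) (V : (XT f T).Opens) (h : V ≤ φ.W)
    (h' : baseMap f α ⁻¹ᵁ V ≤ (φ.pullback α).W) :
    (φ.pullback α).restr (baseMap f α ⁻¹ᵁ V) h' =
      baseChangeIso (φ.restr V h) (baseMap f α ∣_ V) (baseMap f α ∣_ P.U) (baseMap f α ∣_ Q.U)
        ((XT f T').homOfLE ((baseMap f α).preimage_mono (h.trans φ.le₁)))
        ((XT f T').homOfLE ((baseMap f α).preimage_mono (h.trans φ.le₂)))
        (morphismRestrict_homOfLE _ _ _ _).symm (morphismRestrict_homOfLE _ _ _ _).symm := by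
  have hV := (baseMap f α).preimage_mono h
  have A := pullback_restr' α φ _ h' hV
  have B := baseChangeIso_res φ.iso ((XT f T).homOfLE h) _ _ (Scheme.homOfLE_homOfLE _ _ _)
    (Scheme.homOfLE_homOfLE _ _ _) (baseMap f α ∣_ V) (baseMap f α ∣_ P.U) (baseMap f α ∣_ Q.U)
    ((XT f T').homOfLE ((baseMap f α).preimage_mono (h.trans φ.le₁)))
    ((XT f T').homOfLE ((baseMap f α).preimage_mono (h.trans φ.le₂)))
    (morphismRestrict_homOfLE _ _ _ _).symm (morphismRestrict_homOfLE _ _ _ _).symm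
    ((XT f T').homOfLE hV ≫ baseMap f α ∣_ φ.W) (morphismRestrict_homOfLE _ _ _ _)
    (homOfLE_morphismRestrict_comp _ _ _ _) (homOfLE_morphismRestrict_comp _ _ _ _)
  exact A.trans B.symm

theorem pullback_rel (α : T' ⟶ T) {φ ψ : PartialIso P Q} (h : Rel φ ψ) :
    Rel (φ.pullback α) (ψ.pullback α) := by
  obtain ⟨V, hV, h₁, h₂, e⟩ := h
  refine ⟨baseMap f α ⁻¹ᵁ V, preimage_compl_mem α hV, pullback_mono α φ h₁,
    pullback_mono α ψ h₂, ?_⟩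
  rw [pullback_restr α φ V h₁, pullback_restr α ψ V h₂, e]

theorem pullback_refl_rel (α : T' ⟶ T) (P : Bun f r T) :
    Rel ((refl P).pullback α) (refl (pullObj α P)) := by
  refine ⟨_, ((refl P).pullback α).compl_mem, le_rfl, le_rfl, ?_⟩
  refine (pullback_restr α (refl P) (refl P).W le_rfl le_rfl).trans ?_
  refine Eq.trans ?_ (refl_restr (pullObj α P) _ le_rfl).symm
  rw [refl_restr]
  exact baseChangeIso_refl _ _ _ _ _

theorem pullback_trans_rel (α : T' ⟶ T) (φ : PartialIso P Q) (ψ : PartialIso Q R) :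
    Rel ((φ.trans ψ).pullback α) ((φ.pullback α).trans (ψ.pullback α)) := by
  have h₁ := trans_le_left φ ψ
  have h₂ := trans_le_right φ ψ
  refine ⟨_, ((φ.trans ψ).pullback α).compl_mem, le_rfl, le_trans_W (φ.pullback α) (ψ.pullback α)
    (pullback_mono α φ h₁) (pullback_mono α ψ h₂), ?_⟩
  refine (pullback_restr α (φ.trans ψ) (φ.trans ψ).W le_rfl le_rfl).trans ?_
  refine Eq.trans ?_ (trans_restr (φ.pullback α) (ψ.pullback α) _ _
    (pullback_mono α φ h₁) (pullback_mono α ψ h₂)).symm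
  rw [trans_restr φ ψ _ _ h₁ h₂]
  refine Eq.trans ?_ (congrArg₂ Iso.trans (pullback_restr α φ _ h₁ (pullback_mono α φ h₁))
    (pullback_restr α ψ _ h₂ (pullback_mono α ψ h₂))).symm
  exact baseChangeIso_trans (φ.restr _ h₁) (ψ.restr _ h₂) (baseMap f α ∣_ (φ.trans ψ).W)
    (baseMap f α ∣_ P.U) (baseMap f α ∣_ Q.U) (baseMap f α ∣_ R.U) _ _ _ _ _ _

/-- The canonical (partial) isomorphism between `α^* (β^* P)` and `γ^* P` for `γ = α ≫ β`. -/
def comp (α : T'' ⟶ T') (β : T' ⟶ T) (γ : T'' ⟶ T) (h : α ≫ β = γ) (P : Bun f r T) :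
    PartialIso (pullObj α (pullObj β P)) (pullObj γ P) where
  W := (pullObj γ P).U
  compl_mem := (pullObj γ P).compl_mem
  le₁ := preimage_le_of_comp_eq (by rw [← h, baseMap_comp]) P.U
  le₂ := le_rfl
  iso := compareIso P.E (baseMap f β ∣_ P.U) (baseMap f α ∣_ (pullObj β P).U) _
    (baseMap f γ ∣_ P.U) _
    (homOfLE_morphismRestrict_of_comp_eq (by rw [← h, baseMap_comp]) P.U _ _)

theorem comp_restr (α : T'' ⟶ T') (β : T' ⟶ T) (γ : T'' ⟶ T) (h : α ≫ β = γ) (P : Bun f r T)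
    (V : (XT f T'').Opens) (hV : V ≤ (comp α β γ h P).W) :
    (comp α β γ h P).restr V hV =
      compareIso P.E (baseMap f β ∣_ P.U) (baseMap f α ∣_ (pullObj β P).U)
        ((XT f T'').homOfLE (hV.trans (comp α β γ h P).le₁)) (baseMap f γ ∣_ P.U)
        ((XT f T'').homOfLE (hV.trans (comp α β γ h P).le₂))
        (homOfLE_morphismRestrict_of_comp_eq (by rw [← h, baseMap_comp]) P.U _ _) :=
  res_compareIso _ _ _ _ _ _ _ _ _ _ _ _ _

theorem comp_naturality (α : T'' ⟶ T') (β : T' ⟶ T) (γ : T'' ⟶ T) (h : α ≫ β = γ)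
    (φ : PartialIso P Q) :
    Rel (((φ.pullback β).pullback α).trans (comp α β γ h Q))
      ((comp α β γ h P).trans (φ.pullback γ)) := by
  have hc : baseMap f α ≫ baseMap f β = baseMap f γ := by rw [← h, baseMap_comp]
  have l₁ : (φ.pullback γ).W ≤ ((φ.pullback β).pullback α).W := preimage_le_of_comp_eq hc φ.W
  have l₂ : (φ.pullback γ).W ≤ (comp α β γ h Q).W := (φ.pullback γ).le₂
  have l₃ : (φ.pullback γ).W ≤ (comp α β γ h P).W := (φ.pullback γ).le₁
  refine ⟨(φ.pullback γ).W, (φ.pullback γ).compl_mem, le_trans_W _ _ l₁ l₂,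
    le_trans_W _ _ l₃ le_rfl, ?_⟩
  have h₁ : (φ.pullback γ).W ≤ baseMap f α ⁻¹ᵁ (φ.pullback β).W := l₁
  have h₂ : (φ.pullback γ).W ≤ baseMap f γ ⁻¹ᵁ φ.W := le_rfl
  rw [trans_restr _ _ _ _ l₁ l₂, trans_restr _ _ _ _ l₃ le_rfl, comp_restr, comp_restr,
    pullback_restr' α (φ.pullback β) _ l₁ h₁, pullback_restr' γ φ _ le_rfl h₂]
  have e := homOfLE_morphismRestrict_of_comp_eq hc φ.W h₁ h₂
  exact baseChangeIso_compareIso φ.iso (baseMap f β ∣_ φ.W) (baseMap f β ∣_ P.U)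
    (baseMap f β ∣_ Q.U) _ _ (morphismRestrict_homOfLE _ _ _ _).symm
    (morphismRestrict_homOfLE _ _ _ _).symm
    ((XT f T'').homOfLE h₁ ≫ baseMap f α ∣_ (φ.pullback β).W) (baseMap f α ∣_ (pullObj β P).U)
    (baseMap f α ∣_ (pullObj β Q).U) _ _ _ _ (baseMap f γ ∣_ P.U) (baseMap f γ ∣_ Q.U) _ _
    ((XT f T'').homOfLE h₂ ≫ baseMap f γ ∣_ φ.W) e _ _ _ _

end PartialIso

open PartialIso in
/-- The pullback functor `α^* : F(T) ⥤ F(T')` of a morphism `α : T' ⟶ T`. -/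
def pullbackFunctor (f : X ⟶ S) (r : ℕ) {T' T : Over S} (α : T' ⟶ T) : Bun f r T ⥤ Bun f r T' where
  obj P := pullObj α P
  map := Quotient.map (PartialIso.pullback α) fun _ _ h => pullback_rel α h
  map_id P := Quotient.sound (pullback_refl_rel α P)
  map_comp := by
    rintro P Q R ⟨φ⟩ ⟨ψ⟩
    exact Quotient.sound (pullback_trans_rel α φ ψ)

open PartialIso in
/-- The canonical isomorphism `α^* ∘ β^* ≅ γ^*` for `γ = α ≫ β`. -/
def pullbackFunctorComp (f : X ⟶ S) (r : ℕ) {T'' T' T : Over S} (α : T'' ⟶ T') (β : T' ⟶ T)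
    (γ : T'' ⟶ T) (h : α ≫ β = γ) :
    pullbackFunctor f r β ⋙ pullbackFunctor f r α ≅ pullbackFunctor f r γ :=
  NatIso.ofComponents (fun P => Groupoid.isoEquivHom _ _ |>.symm (germ (comp α β γ h P))) (by
    rintro P Q ⟨φ⟩
    exact Quotient.sound (comp_naturality α β γ h φ))

/-- For an object `a` of `F(T₀)` and `γ : T₀ ⟶ T`, the groupoid of extensions of `a` over `T`: its
objects are the objects `b` of `F(T)` with an isomorphism `γ^* b ≅ a`, its morphisms are the
morphisms of `F(T)` which are compatible with these isomorphisms. -/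
abbrev Extension {T₀ T : Over S} (γ : T₀ ⟶ T) (a : Bun f r T₀) :=
  CostructuredArrow (pullbackFunctor f r γ) a

/-- For `γ = α ≫ β`, the pullback of extensions of `a` along `β`, i.e. the functor
`(b, γ^* b ≅ a) ↦ (β^* b, α^* (β^* b) ≅ γ^* b ≅ a)`. -/
def Extension.restrict {T₀ T₁ T : Over S} (α : T₀ ⟶ T₁) (β : T₁ ⟶ T) (γ : T₀ ⟶ T) (h : α ≫ β = γ)
    (a : Bun f r T₀) : Extension γ a ⥤ Extension α a :=
  (CostructuredArrow.mapNatIso (pullbackFunctorComp f r α β γ h)).inverse ⋙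
    CostructuredArrow.pre (pullbackFunctor f r β) (pullbackFunctor f r α) a

end Bun

/-! ### Affine schemes over a field -/

variable (k : Type u) [Field k]

/-- `Spec A` as a scheme over `Spec k`. -/
abbrev SpecOver (A : Type u) [CommRing A] [Algebra k A] : Over (Spec (CommRingCat.of k)) :=
  Over.mk (Spec.map (CommRingCat.ofHom (algebraMap k A)))

variable {k}

/-- The morphism `Spec B ⟶ Spec A` of a homomorphism `A →ₐ[k] B`. -/
def SpecOver.map {A B : Type u} [CommRing A] [Algebra k A] [CommRing B] [Algebra k B]
    (φ : A →ₐ[k] B) : SpecOver k B ⟶ SpecOver k A :=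
  Over.homMk (Spec.map (CommRingCat.ofHom φ.toRingHom)) (by
    simp only [Over.mk_hom]
    rw [← Spec.map_comp, ← CommRingCat.ofHom_comp]
    congr 2
    exact φ.comp_algebraMap)

theorem SpecOver.map_comp {A B C : Type u} [CommRing A] [Algebra k A] [CommRing B] [Algebra k B]
    [CommRing C] [Algebra k C] (φ : A →ₐ[k] B) (ψ : B →ₐ[k] C) (χ : A →ₐ[k] C)
    (h : ψ.comp φ = χ) : SpecOver.map ψ ≫ SpecOver.map φ = SpecOver.map χ := by
  subst h
  ext1
  simp only [SpecOver.map, Over.comp_left, Over.homMk_left]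
  rw [← Spec.map_comp, ← CommRingCat.ofHom_comp]
  rfl

section FiberProduct

variable {A A' B : Type u} [CommRing A] [Algebra k A] [CommRing A'] [Algebra k A'] [CommRing B]
  [Algebra k B] (p : A' →ₐ[k] A) (q : B →ₐ[k] A)

/-- The fibre product `A' ×_A B`: pairs in `A' × B` with the same image in `A`. -/
abbrev FiberProduct : Subalgebra k (A' × B) :=
  AlgHom.equalizer (p.comp (AlgHom.fst k A' B)) (q.comp (AlgHom.snd k A' B))

/-- The projection `A' ×_A B → A'`. -/
def FiberProduct.fst : FiberProduct p q →ₐ[k] A' := (AlgHom.fst k A' B).comp (Subalgebra.val _)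

/-- The projection `A' ×_A B → B`. -/
def FiberProduct.snd : FiberProduct p q →ₐ[k] B := (AlgHom.snd k A' B).comp (Subalgebra.val _)

theorem FiberProduct.condition :
    p.comp (FiberProduct.fst p q) = q.comp (FiberProduct.snd p q) :=
  AlgHom.ext fun x => x.2

/-- The homomorphism `A' ×_A B → A`. -/
def FiberProduct.toBase : FiberProduct p q →ₐ[k] A := p.comp (FiberProduct.fst p q)

/-- The natural functor `F_a(A' ×_A B) ⥤ F_a(A') × F_a(B)`. -/
def gluingFunctor {X : Scheme.{u}} (f : X ⟶ Spec (CommRingCat.of k)) (r : ℕ)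
    (a : Bun f r (SpecOver k A)) :
    Bun.Extension (SpecOver.map (FiberProduct.toBase p q)) a ⥤
      Bun.Extension (SpecOver.map p) a × Bun.Extension (SpecOver.map q) a :=
  Functor.prod'
    (Bun.Extension.restrict (SpecOver.map p) (SpecOver.map (FiberProduct.fst p q)) _
      (SpecOver.map_comp _ _ _ rfl) a)
    (Bun.Extension.restrict (SpecOver.map q) (SpecOver.map (FiberProduct.snd p q)) _
      (SpecOver.map_comp _ _ _ (FiberProduct.condition p q).symm) a)

end FiberProduct

/-! ### Serre's conditions -/

/-- Serre's condition `S_n`: at every point `x` the depth of the local ring at `x` is at least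
`min n (dim 𝒪_x)`, the depth being the maximal length of a regular sequence in the maximal ideal. -/
def SerreCondition (X : Scheme.{u}) (n : ℕ) : Prop :=
  ∀ x : X, ∃ rs : List (X.presheaf.stalk x),
    RingTheory.Sequence.IsRegular (X.presheaf.stalk x) rs ∧
    (∀ s ∈ rs, s ∈ IsLocalRing.maximalIdeal (X.presheaf.stalk x)) ∧
    min (n : WithBot ℕ∞) (ringKrullDim (X.presheaf.stalk x)) ≤ (rs.length : WithBot ℕ∞)

end RelBundle

end

/-! This is Milnor patching of vector bundles, carried out on the open subschemes $W$ of $X_{B'}$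
whose complement lies in `Phi`. Let $U$, $U'$, $V$ be the preimages of $W$ over $A$, $A'$, $B$.
Since $A'\to A$ is surjective with nilpotent kernel, $B'\to B$ is surjective and its kernel consists
of nilpotents; hence $U\to U'$ and $V\to W$ are surjective closed immersions. The homomorphism $B\to
A$ need not be surjective, so $U'\to W$ need not be a closed immersion. It is affine, however, and
topologically a closed embedding: $B'\to A_0$ is surjective and $A'\to A_0$ has nilpotent kernel, so
$U'$ has the underlying space of a closed subscheme of $W$. Finally $X_{B'}$ is flat over $B'$, so
the exact sequence $0\to B'\to A'\times B\to A$ stays exact after base change, and functions on $W$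
are compatible pairs of functions on $U'$ and $V$. These facts make up `PatchSquare` and are proved
in `PatchSquare.of_isPullback`.

For a bundle $E$ on $W$ it follows, by working in a local basis, that $E$ is the fibre product of
the direct images of its pullbacks to $U'$ and $V$ over that of its pullback to $U$
(`isPullback_of_locallyHasBasis`). So morphisms of bundles patch uniquely. Conversely, given bundles
$P$ on $U'$ and $Q$ on $V$ with an isomorphism over $U$, the fibre product of direct images is a
bundle (`PatchSquare.exists_glue`). Indeed, bases of $P$ and $Q$ near a point differ over $U$ by an
invertible matrix; it lifts to $U'$, and the lift is invertible because $U\to U'$ is surjective.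
Correcting the basis of $P$ by the lift gives bases that agree over $U$, hence a basis of the fibre
product (`exists_compatible_bases`).

Objects and morphisms of $F$ live on varying open subsets, so a single $W$ is needed whose preimages
lie inside prescribed opens over $A'$, $B$ and $A$ (`exists_preimages_le`). The closed complements
are pushed forward to $X_{B'}$ along the closed immersions of $X_{A_0}$ and $X_B$. Fibrewise
codimension survives because a closed immersion of the base does not change residue fields.

The remaining work is coherence: relating iterated pullbacks of sheaves to composite ones, so that
agreement of germs in $F(A)$ becomes the hypothesis of the patching statements. In $F_a$ that
agreement is automatic, both sides being identified with $a$. -/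

noncomputable section

namespace RelBundle

/-! ### Sections of sheaves of modules -/

section Sections

variable {X Y Z : Scheme.{u}}

/-- Restriction of sections of a sheaf of modules. -/
def secRes (M : X.Modules) {U V : X.Opens} (h : V ≤ U) : Γ(M, U) →+ Γ(M, V) :=
  (M.presheaf.map (homOfLE h).op).hom

/-- Restriction of functions. -/
def funRes (X : Scheme.{u}) {U V : X.Opens} (h : V ≤ U) : Γ(X, U) →+* Γ(X, V) :=
  (X.presheaf.map (homOfLE h).op).hom

@[simp]
theorem secRes_self (M : X.Modules) {U : X.Opens} (h : U ≤ U) (s : Γ(M, U)) :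
    secRes M h s = s := by
  change (M.presheaf.map (𝟙 _)) s = s
  rw [CategoryTheory.Functor.map_id]; rfl

@[simp]
theorem secRes_secRes (M : X.Modules) {U V W : X.Opens} (h : V ≤ U) (h' : W ≤ V) (s : Γ(M, U)) :
    secRes M h' (secRes M h s) = secRes M (h'.trans h) s :=
  (congr($(M.presheaf.map_comp (homOfLE h).op (homOfLE h').op) s)).symm

@[simp]
theorem funRes_self {U : X.Opens} (h : U ≤ U) (s : Γ(X, U)) : funRes X h s = s := by
  change (X.presheaf.map (𝟙 _)) s = s
  rw [CategoryTheory.Functor.map_id]; rfl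

@[simp]
theorem funRes_funRes {U V W : X.Opens} (h : V ≤ U) (h' : W ≤ V) (s : Γ(X, U)) :
    funRes X h' (funRes X h s) = funRes X (h'.trans h) s :=
  (congr($(X.presheaf.map_comp (homOfLE h).op (homOfLE h').op) s)).symm

theorem secRes_smul (M : X.Modules) {U V : X.Opens} (h : V ≤ U) (r : Γ(X, U)) (s : Γ(M, U)) :
    secRes M h (r • s) = funRes X h r • secRes M h s :=
  Scheme.Modules.map_smul M (homOfLE h) r s

theorem app_secRes {M N : X.Modules} (φ : M ⟶ N) {U V : X.Opens} (h : V ≤ U) (s : Γ(M, U)) :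
    φ.app V (secRes M h s) = secRes N h (φ.app U s) :=
  congr($(φ.mapPresheaf.naturality (homOfLE h).op) s)

theorem smul_pushforward (g : Y ⟶ X) (M : Y.Modules) (U : X.Opens) (r : Γ(X, U))
    (s : Γ((Scheme.Modules.pushforward g).obj M, U)) :
    r • s = (g.app U r • (show Γ(M, g ⁻¹ᵁ U) from s) : Γ(M, g ⁻¹ᵁ U)) := rfl

/-- The pullback of a section along a morphism of schemes. -/
def pullSec (g : Y ⟶ X) (M : X.Modules) {N : X.Opens} {V : Y.Opens} (h : V ≤ g ⁻¹ᵁ N) :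
    Γ(M, N) →+ Γ(pull g M, V) :=
  (secRes (pull g M) h).comp
    (((Scheme.Modules.pullbackPushforwardAdjunction g).unit.app M).app N).hom

/-- The pullback of a function, restricted to a smaller open subset. -/
def pullFun (g : Y ⟶ X) {N : X.Opens} {V : Y.Opens} (h : V ≤ g ⁻¹ᵁ N) : Γ(X, N) →+* Γ(Y, V) :=
  (funRes Y h).comp (g.app N).hom

theorem pullFun_eq_appLE (g : Y ⟶ X) {N : X.Opens} {V : Y.Opens} (h : V ≤ g ⁻¹ᵁ N) :
    pullFun g h = (g.appLE N V h).hom := rfl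

@[simp]
theorem secRes_pullSec (g : Y ⟶ X) (M : X.Modules) {N : X.Opens} {V V' : Y.Opens}
    (h : V ≤ g ⁻¹ᵁ N) (h' : V' ≤ V) (s : Γ(M, N)) :
    secRes _ h' (pullSec g M h s) = pullSec g M (h'.trans h) s :=
  secRes_secRes _ _ _ _

@[simp]
theorem pullSec_secRes (g : Y ⟶ X) (M : X.Modules) {N N' : X.Opens} {V : Y.Opens}
    (h : V ≤ g ⁻¹ᵁ N') (h' : N' ≤ N) (s : Γ(M, N)) :
    pullSec g M h (secRes M h' s) = pullSec g M (h.trans (g.preimage_mono h')) s := by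
  have := app_secRes ((Scheme.Modules.pullbackPushforwardAdjunction g).unit.app M) h' s
  refine (congrArg (secRes (pull g M) h) this).trans ?_
  exact secRes_secRes (pull g M) _ _ _

theorem pullFun_pullFun (g : Z ⟶ Y) (f : Y ⟶ X) (h : Z ⟶ X) (w : g ≫ f = h) {N : X.Opens}
    {V : Y.Opens} {V' : Z.Opens} (h₁ : V ≤ f ⁻¹ᵁ N) (h₂ : V' ≤ g ⁻¹ᵁ V) (h₃ : V' ≤ h ⁻¹ᵁ N)
    (s : Γ(X, N)) : pullFun g h₂ (pullFun f h₁ s) = pullFun h h₃ s := by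
  subst w
  simp only [pullFun_eq_appLE]
  exact congr($(Scheme.Hom.appLE_comp_appLE g f N V V' h₁ h₂) s)

theorem pullSec_smul (g : Y ⟶ X) (M : X.Modules) {N : X.Opens} {V : Y.Opens} (h : V ≤ g ⁻¹ᵁ N)
    (r : Γ(X, N)) (s : Γ(M, N)) :
    pullSec g M h (r • s) = pullFun g h r • pullSec g M h s := by
  have := Scheme.Modules.Hom.app_smul
    ((Scheme.Modules.pullbackPushforwardAdjunction g).unit.app M) r s
  refine (congrArg (secRes (pull g M) h) this).trans ?_
  exact secRes_smul (pull g M) _ _ _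

theorem map_pullSec (g : Y ⟶ X) {M M' : X.Modules} (φ : M ⟶ M') {N : X.Opens} {V : Y.Opens}
    (h : V ≤ g ⁻¹ᵁ N) (s : Γ(M, N)) :
    ((Scheme.Modules.pullback g).map φ).app V (pullSec g M h s) = pullSec g M' h (φ.app N s) := by
  refine (app_secRes _ h _).trans ?_
  have := congr_arg (fun t => t.app N)
    ((Scheme.Modules.pullbackPushforwardAdjunction g).unit.naturality φ)
  exact congrArg (secRes (pull g M') h) congr($this s).symm

theorem pullSec_rfl (g : Y ⟶ X) (M : X.Modules) {N : X.Opens} (s : Γ(M, N)) :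
    pullSec g M (le_refl (g ⁻¹ᵁ N)) s =
      (show Γ(pull g M, g ⁻¹ᵁ N) from
        ((Scheme.Modules.pullbackPushforwardAdjunction g).unit.app M).app N s) :=
  secRes_self (pull g M) _ _

/-- Transposition across the adjunction reduces the claim to sections of `M`, so pulled-back
sections test equality although they do not exhaust the sections of the pullback. -/
theorem pull_hom_ext {g : Y ⟶ X} {M : X.Modules} {K : Y.Modules} {φ ψ : pull g M ⟶ K}
    (h : ∀ (N : X.Opens) (s : Γ(M, N)),
      φ.app _ (pullSec g M (le_refl (g ⁻¹ᵁ N)) s) = ψ.app _ (pullSec g M le_rfl s)) : φ = ψ := by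
  apply ((Scheme.Modules.pullbackPushforwardAdjunction g).homEquiv M K).injective
  ext N s
  have := h N s
  rw [pullSec_rfl] at this
  rw [Adjunction.homEquiv_unit, Adjunction.homEquiv_unit]
  exact this

/-- The morphism `pull g M ⟶ K` adjoint to `φ : M ⟶ g_* K`. -/
def pullLift {g : Y ⟶ X} {M : X.Modules} {K : Y.Modules}
    (φ : M ⟶ (Scheme.Modules.pushforward g).obj K) : pull g M ⟶ K :=
  ((Scheme.Modules.pullbackPushforwardAdjunction g).homEquiv M K).symm φ

theorem pullLift_pullSec {g : Y ⟶ X} {M : X.Modules} {K : Y.Modules}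
    (φ : M ⟶ (Scheme.Modules.pushforward g).obj K) {N : X.Opens} {V : Y.Opens}
    (h : V ≤ g ⁻¹ᵁ N) (s : Γ(M, N)) :
    (pullLift φ).app V (pullSec g M h s) =
      secRes K h (show Γ(K, g ⁻¹ᵁ N) from φ.app N s) := by
  have h1 : (Scheme.Modules.pullbackPushforwardAdjunction g).homEquiv M K (pullLift φ) = φ :=
    Equiv.apply_symm_apply _ _
  rw [Adjunction.homEquiv_unit] at h1
  refine (app_secRes _ h _).trans ?_
  have := congr_arg (fun t => t.app N) h1
  exact congrArg (secRes K h) congr($this s)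

/-- The comparison of pullbacks is conjugate to the comparison of direct images, so it matches the
units of the two adjunctions; restriction gives smaller opens. This allows coherence questions to be
checked on sections. -/
theorem pullComp_pullSec (g : Z ⟶ Y) (f : Y ⟶ X) (h : Z ⟶ X) (w : g ≫ f = h) (M : X.Modules)
    {N : X.Opens} {V : Y.Opens} {V' : Z.Opens} (h₁ : V ≤ f ⁻¹ᵁ N) (h₂ : V' ≤ g ⁻¹ᵁ V)
    (h₃ : V' ≤ h ⁻¹ᵁ N) (s : Γ(M, N)) :
    (pullComp g f h w M).hom.app V' (pullSec g _ h₂ (pullSec f M h₁ s)) = pullSec h M h₃ s := by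
  subst w
  have e : (pullComp g f (g ≫ f) rfl M).hom = (Scheme.Modules.pullbackComp g f).hom.app M := by
    simp [pullComp]
  have h3 := unit_conjugateEquiv
    ((Scheme.Modules.pullbackPushforwardAdjunction f).comp
      (Scheme.Modules.pullbackPushforwardAdjunction g))
    (Scheme.Modules.pullbackPushforwardAdjunction (g ≫ f))
    (Scheme.Modules.pullbackComp g f).inv M
  rw [Scheme.Modules.conjugateEquiv_pullbackComp_inv] at h3
  have h4 := congr_arg (fun t => t.app N) h3
  have h5 := congr($h4 s)
  have key : (pullComp g f (g ≫ f) rfl M).inv.app (g ⁻¹ᵁ f ⁻¹ᵁ N)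
      (pullSec (g ≫ f) M (le_refl _) s) =
      pullSec g _ (le_refl (g ⁻¹ᵁ f ⁻¹ᵁ N)) (pullSec f M (le_refl _) s) := by
    rw [pullSec_rfl, pullSec_rfl, pullSec_rfl]
    have e' : (pullComp g f (g ≫ f) rfl M).inv = (Scheme.Modules.pullbackComp g f).inv.app M := by
      simp [pullComp]
    rw [e']
    exact h5.symm
  have key2 : (pullComp g f (g ≫ f) rfl M).hom.app (g ⁻¹ᵁ f ⁻¹ᵁ N)
      (pullSec g _ (le_refl (g ⁻¹ᵁ f ⁻¹ᵁ N)) (pullSec f M (le_refl _) s)) =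
      (pullSec (g ≫ f) M (le_refl _) s) := by
    rw [← key]
    have := congr_arg (fun t : pull (g ≫ f) M ⟶ _ => t.app (g ⁻¹ᵁ f ⁻¹ᵁ N))
      (pullComp g f (g ≫ f) rfl M).inv_hom_id
    exact congr($this _)
  have h6 := congrArg (secRes _ h₃) key2
  have h₃' : V' ≤ g ⁻¹ᵁ f ⁻¹ᵁ N := h₃
  have h7 := app_secRes (pullComp g f (g ≫ f) rfl M).hom h₃'
    (pullSec g _ (le_refl (g ⁻¹ᵁ f ⁻¹ᵁ N)) (pullSec f M (le_refl _) s))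
  have h8 := h7.trans h6
  rw [secRes_pullSec, secRes_pullSec] at h8
  rw [← h8, ← secRes_pullSec f M le_rfl h₁, pullSec_secRes]

theorem iso_app_bijective {M N : X.Modules} (e : M ≅ N) (U : X.Opens) :
    Function.Bijective (e.hom.app U) := by
  refine ⟨Function.LeftInverse.injective (g := e.inv.app U) fun x => ?_,
    Function.RightInverse.surjective (g := e.inv.app U) fun x => ?_⟩
  · exact congr($(congr_arg (fun t : M ⟶ M => t.app U) e.hom_inv_id) x)
  · exact congr($(congr_arg (fun t : N ⟶ N => t.app U) e.inv_hom_id) x)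

theorem isIso_of_basis {M N : X.Modules} (φ : M ⟶ N) (B : Set X.Opens)
    (hB : TopologicalSpace.Opens.IsBasis B) (h : ∀ U ∈ B, Function.Bijective (φ.app U)) :
    IsIso φ := by
  let F : TopCat.Sheaf Ab X := ⟨M.presheaf, M.isSheaf⟩
  let G : TopCat.Sheaf Ab X := ⟨N.presheaf, N.isSheaf⟩
  let ψ : F ⟶ G := ⟨φ.mapPresheaf⟩
  have : IsIso ψ := by
    refine (TopCat.Sheaf.isIso_iff_isIso_basis (B := fun U : B => (U : X.Opens))
      (by simpa using hB)) fun U => ?_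
    exact (ConcreteCategory.isIso_iff_bijective _).2 (h U U.2)
  have h2 : IsIso φ.mapPresheaf :=
    inferInstanceAs (IsIso ((TopCat.Sheaf.forget Ab X).map ψ))
  exact (isIso_iff_of_reflects_iso φ (Scheme.Modules.toPresheaf X)).1 h2

end Sections

/-! ### Bases of sections and free sheaves -/

section Basis

variable {X Y Z : Scheme.{u}} {ι : Type u} [Fintype ι]

/-- A finite family of sections of `M` over `N` which is a basis of `M` over each open subset
of `N`. -/
def IsBasisOn (M : X.Modules) {N : X.Opens} (s : ι → Γ(M, N)) : Prop :=
  ∀ (N' : X.Opens) (h : N' ≤ N),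
    Function.Bijective fun c : ι → Γ(X, N') => ∑ i, c i • secRes M h (s i)

theorem IsBasisOn.res {M : X.Modules} {N N' : X.Opens} {s : ι → Γ(M, N)} (hs : IsBasisOn M s)
    (h : N' ≤ N) : IsBasisOn M fun i => secRes M h (s i) := by
  intro N'' h'
  simpa using hs N'' (h'.trans h)

theorem app_sum_smul {M M' : X.Modules} (φ : M ⟶ M') {N : X.Opens} (c : ι → Γ(X, N))
    (s : ι → Γ(M, N)) : φ.app N (∑ i, c i • s i) = ∑ i, c i • φ.app N (s i) := by
  rw [map_sum]
  exact Finset.sum_congr rfl fun i _ => Scheme.Modules.Hom.app_smul φ _ _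

/-- In the coordinates given by `s` and its image, `φ` is the identity. -/
theorem IsBasisOn.app_bijective {M M' : X.Modules} (φ : M ⟶ M') {N : X.Opens} {s : ι → Γ(M, N)}
    (hs : IsBasisOn M s) (hs' : IsBasisOn M' fun i => φ.app N (s i)) {N' : X.Opens} (h : N' ≤ N) :
    Function.Bijective (φ.app N') := by
  have h1 := hs N' h
  have h2 := hs' N' h
  have e : (fun c : ι → Γ(X, N') => ∑ i, c i • secRes M' h (φ.app N (s i))) =
      (φ.app N') ∘ fun c : ι → Γ(X, N') => ∑ i, c i • secRes M h (s i) := by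
    ext c
    simp [app_secRes]
  rw [e] at h2
  exact (Function.Bijective.of_comp_iff _ h1).1 h2

theorem isBasisOn_app_iff {M M' : X.Modules} (φ : M ⟶ M') {N : X.Opens} {s : ι → Γ(M, N)}
    (h : ∀ N' ≤ N, Function.Bijective (φ.app N')) :
    IsBasisOn M' (fun i => φ.app N (s i)) ↔ IsBasisOn M s := by
  refine forall₂_congr fun N' h' => ?_
  have e : (fun c : ι → Γ(X, N') => ∑ i, c i • secRes M' h' (φ.app N (s i))) =
      (φ.app N') ∘ fun c : ι → Γ(X, N') => ∑ i, c i • secRes M h' (s i) := by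
    ext c
    simp [app_secRes]
  rw [e]
  exact Function.Bijective.of_comp_iff' (h N' h') _

theorem isBasisOn_iso_iff {M M' : X.Modules} (e : M ≅ M') {N : X.Opens} {s : ι → Γ(M, N)} :
    IsBasisOn M' (fun i => e.hom.app N (s i)) ↔ IsBasisOn M s :=
  isBasisOn_app_iff _ fun _ _ => iso_app_bijective e _

variable (X) in
/-- The structure sheaf as a sheaf of modules. -/
def unitMod : X.Modules := SheafOfModules.unit X.ringCatSheaf

variable (X ι) in
/-- The free sheaf of modules. -/
def freeMod : X.Modules := (SheafOfModules.free ι : SheafOfModules X.ringCatSheaf)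

/-- The section `1` of the structure sheaf. -/
def oneSec (N : X.Opens) : Γ(unitMod X, N) := (1 : Γ(X, N))

variable (X) in
/-- The inclusion of a summand of the free sheaf. -/
def inclFree (i : ι) : unitMod X ⟶ freeMod X ι :=
  (SheafOfModules.ιFree i : SheafOfModules.unit X.ringCatSheaf ⟶ SheafOfModules.free ι)

theorem secRes_oneSec {N N' : X.Opens} (h : N' ≤ N) :
    secRes (unitMod X) h (oneSec N) = oneSec N' :=
  map_one (funRes X h)

/-- Sections of the structure sheaf are functions. -/
def unitEquiv (N : X.Opens) : Γ(unitMod X, N) ≃+ Γ(X, N) := AddEquiv.refl Γ(X, N)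

theorem unitEquiv_smul_oneSec {N : X.Opens} (r : Γ(X, N)) : unitEquiv N (r • oneSec N) = r :=
  mul_one r

theorem unitEquiv_self_smul_oneSec {N : X.Opens} (x : Γ(unitMod X, N)) :
    unitEquiv N x • oneSec N = x :=
  mul_one (unitEquiv N x)

/-- The tautological sections of the free sheaf. -/
def freeSec (N : X.Opens) (i : ι) : Γ(freeMod X ι, N) := (inclFree X i).app N (oneSec N)

omit [Fintype ι] in
theorem secRes_freeSec {N N' : X.Opens} (h : N' ≤ N) (i : ι) :
    secRes (freeMod X ι) h (freeSec N i) = freeSec N' i := by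
  rw [freeSec, ← app_secRes, secRes_oneSec]; rfl

omit [Fintype ι] in
theorem freeMod_hom_ext {M : X.Modules} {φ ψ : freeMod X ι ⟶ M}
    (h : ∀ i, inclFree X i ≫ φ = inclFree X i ≫ ψ) : φ = ψ :=
  Cofan.IsColimit.hom_ext (SheafOfModules.isColimitFreeCofan (R := X.ringCatSheaf) ι) _ _ h

omit [Fintype ι] in
open Classical in
theorem exists_projFree (i : ι) : ∃ π : freeMod X ι ⟶ unitMod X,
    ∀ j, inclFree X j ≫ π = if j = i then 𝟙 (unitMod X) else 0 :=
  ⟨Cofan.IsColimit.desc (SheafOfModules.isColimitFreeCofan (R := X.ringCatSheaf) ι)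
    fun j => (if j = i then 𝟙 (unitMod X) else 0 : unitMod X ⟶ unitMod X),
    fun j => Cofan.IsColimit.fac (SheafOfModules.isColimitFreeCofan (R := X.ringCatSheaf) ι)
      (fun j => (if j = i then 𝟙 (unitMod X) else 0 : unitMod X ⟶ unitMod X)) j⟩

/-- The projection to a summand of the free sheaf. -/
def projFree (i : ι) : freeMod X ι ⟶ unitMod X := (exists_projFree i).choose

open Classical in
omit [Fintype ι] in
theorem inclFree_projFree (i j : ι) :
    inclFree X j ≫ projFree i = if j = i then 𝟙 (unitMod X) else 0 :=
  (exists_projFree i).choose_spec j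

theorem hom_sum_app {M M' : X.Modules} (φ : ι → (M ⟶ M')) (N : X.Opens) (x : Γ(M, N)) :
    (∑ i, φ i : M ⟶ M').app N x = ∑ i, (φ i).app N x := by
  classical
  have : ∀ t : Finset ι, (∑ i ∈ t, φ i : M ⟶ M').app N x = ∑ i ∈ t, (φ i).app N x := by
    intro t
    induction t using Finset.induction_on with
    | empty => rfl
    | insert a t ha ih => rw [Finset.sum_insert ha, Finset.sum_insert ha, ← ih]; rfl
  exact this _

theorem sum_projFree_inclFree : ∑ i, projFree i ≫ inclFree X i = 𝟙 (freeMod X ι) := by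
  classical
  refine freeMod_hom_ext fun j => ?_
  rw [Preadditive.comp_sum, Category.comp_id, Finset.sum_eq_single j]
  · rw [← Category.assoc, inclFree_projFree, if_pos rfl, Category.id_comp]
  · intro i _ hi
    rw [← Category.assoc, inclFree_projFree, if_neg (Ne.symm hi), zero_comp]
  · simp

/-- The projections form a dual basis: they read off coefficients, which gives uniqueness, and the
identity is the sum of the projections followed by the inclusions, which gives existence. -/
theorem isBasisOn_freeSec (N : X.Opens) : IsBasisOn (freeMod X ι) (freeSec N) := by
  classical
  intro N' h
  have hproj (i j : ι) : (projFree i).app N' (freeSec N' j) =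
      if j = i then oneSec N' else 0 := by
    have := congr_arg (fun t : unitMod X ⟶ unitMod X => t.app N') (inclFree_projFree i j)
    have h2 := congr($this (oneSec N'))
    refine h2.trans ?_
    split_ifs <;> rfl
  simp only [secRes_freeSec]
  constructor
  · intro c d hcd
    ext i
    have key (c : ι → Γ(X, N')) :
        (projFree i).app N' (∑ i, c i • freeSec N' i) = c i • oneSec N' := by
      rw [app_sum_smul, Finset.sum_eq_single i]
      · rw [hproj, if_pos rfl]
      · intro j _ hj
        rw [hproj, if_neg hj, smul_zero]
      · simp
    have := congrArg ((projFree i).app N') hcd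
    rw [← unitEquiv_smul_oneSec (c i), ← unitEquiv_smul_oneSec (d i), ← key c, ← key d]
    exact congrArg _ this
  · intro x
    refine ⟨fun i => unitEquiv N' ((projFree i).app N' x), ?_⟩
    have := congr_arg (fun t : freeMod X ι ⟶ freeMod X ι => t.app N') sum_projFree_inclFree
    have h2 := congr($this x)
    rw [hom_sum_app] at h2
    refine Eq.trans (Finset.sum_congr rfl fun i _ => ?_) h2
    refine (Scheme.Modules.Hom.app_smul (inclFree X i) _ _).symm.trans ?_
    exact congrArg ((inclFree X i).app N') (unitEquiv_self_smul_oneSec _)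

/-- The morphism from the free sheaf given by global sections. -/
def freeDesc (M : X.Modules) (s : ι → Γ(M, ⊤)) : freeMod X ι ⟶ M :=
  (SheafOfModules.freeHomEquiv (R := X.ringCatSheaf) M).symm fun i =>
    { val := fun _ => secRes M le_top (s i)
      property := fun f => secRes_secRes M _ f.unop.le (s i) }

omit [Fintype ι] in
theorem freeDesc_freeSec (M : X.Modules) (s : ι → Γ(M, ⊤)) (N : X.Opens) (i : ι) :
    (freeDesc M s).app N (freeSec N i) = secRes M le_top (s i) := by
  have h := congrFun (Equiv.apply_symm_apply
    (SheafOfModules.freeHomEquiv (R := X.ringCatSheaf) (I := ι) M) fun i =>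
    { val := fun _ => secRes M le_top (s i)
      property := fun f => secRes_secRes M _ f.unop.le (s i) }) i
  exact congr_arg (fun t : SheafOfModules.sections (R := X.ringCatSheaf) M =>
    t.val (Opposite.op N)) h

theorem IsBasisOn.nonempty_iso {M : X.Modules} {s : ι → Γ(M, ⊤)} (hs : IsBasisOn M s) :
    Nonempty (M ≅ freeMod X ι) := by
  have : IsIso (freeDesc M s) := by
    rw [Scheme.Modules.Hom.isIso_iff_isIso_app]
    intro U
    refine (ConcreteCategory.isIso_iff_bijective _).2
      (IsBasisOn.app_bijective (freeDesc M s) (isBasisOn_freeSec ⊤) ?_ le_top)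
    simpa only [freeDesc_freeSec, secRes_self] using hs
  exact ⟨(asIso (freeDesc M s)).symm⟩

/-- The morphism `𝒪_X ⟶ g_* 𝒪_Y` of sheaves of modules. -/
def unitToPush (g : Y ⟶ X) : unitMod X ⟶ (Scheme.Modules.pushforward g).obj (unitMod Y) :=
  SheafOfModules.unitToPushforwardObjUnit g.toRingCatSheafHom

-- The canonical isomorphism between the pullback of a free sheaf and a free sheaf respects the
-- summands, and on each summand it sends the pulled-back section `1` to `1`. Only these two
-- properties are needed to see that the tautological basis pulls back to a basis.
omit [Fintype ι] in
theorem pullbackUnit_oneSec (g : Y ⟶ X) : ∃ φ : pull g (unitMod X) ⟶ unitMod Y,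
    (∀ (N : X.Opens) (V : Y.Opens) (h : V ≤ g ⁻¹ᵁ N),
      φ.app V (pullSec g _ h (oneSec N)) = oneSec V) ∧
    Nonempty ((e : pull g (freeMod X ι) ≅ freeMod Y ι) ×'
      ∀ i, (Scheme.Modules.pullback g).map (inclFree X i) ≫ e.hom = φ ≫ inclFree Y i) := by
  -- Finality holds because every open of `Y` is contained in the preimage of `⊤`.
  have : (TopologicalSpace.Opens.map g.base).Final := by
    apply Functor.final_of_exists_of_isFiltered
    · exact fun d => ⟨⊤, ⟨homOfLE le_top⟩⟩
    · exact fun {d c} s s' => ⟨c, 𝟙 _, Subsingleton.elim _ _⟩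
  have : (SheafOfModules.pushforward.{u} g.toRingCatSheafHom).IsRightAdjoint :=
    inferInstanceAs (Scheme.Modules.pushforward g).IsRightAdjoint
  refine ⟨pullLift (unitToPush g),
    fun N V h => ?_, ⟨SheafOfModules.pullbackObjFreeIso g.toRingCatSheafHom ι, fun i => ?_⟩⟩
  · rw [pullLift_pullSec]
    exact (pullFun g h).map_one
  · exact SheafOfModules.pullback_map_ιFree_comp_pullbackObjFreeIso_hom g.toRingCatSheafHom i

theorem isBasisOn_pullSec_freeSec (g : Y ⟶ X) {N : X.Opens} {V : Y.Opens} (h : V ≤ g ⁻¹ᵁ N) :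
    IsBasisOn (pull g (freeMod X ι)) fun i => pullSec g _ h (freeSec N i) := by
  obtain ⟨φ, h1, ⟨e, he⟩⟩ := pullbackUnit_oneSec (ι := ι) g
  rw [← isBasisOn_iso_iff e]
  convert isBasisOn_freeSec (ι := ι) V using 2 with i
  rw [freeSec, ← map_pullSec]
  have := congr_arg (fun t : pull g (unitMod X) ⟶ freeMod Y ι => t.app V) (he i)
  have h2 := congr($this (pullSec g _ h (oneSec N)))
  refine h2.trans ?_
  exact congrArg ((inclFree Y i).app V) (h1 N V h)

/-- A global basis is an isomorphism with a free sheaf, and functors preserve isomorphisms. Bases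
over smaller opens are reduced to this case in `IsBasisOn.pullSec`. -/
theorem IsBasisOn.pullSec_top (g : Y ⟶ X) {M : X.Modules} {s : ι → Γ(M, ⊤)}
    (hs : IsBasisOn M s) {V : Y.Opens} (h : V ≤ g ⁻¹ᵁ ⊤) :
    IsBasisOn (pull g M) fun i => pullSec g M h (s i) := by
  have : IsIso (freeDesc M s) := by
    rw [Scheme.Modules.Hom.isIso_iff_isIso_app]
    intro U
    refine (ConcreteCategory.isIso_iff_bijective _).2
      (IsBasisOn.app_bijective (freeDesc M s) (isBasisOn_freeSec ⊤) ?_ le_top)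
    simpa only [freeDesc_freeSec, secRes_self] using hs
  have h2 := (isBasisOn_iso_iff ((Scheme.Modules.pullback g).mapIso (asIso (freeDesc M s)))).2
    (isBasisOn_pullSec_freeSec (ι := ι) g h)
  simpa only [Functor.mapIso_hom, asIso_hom, map_pullSec, freeDesc_freeSec, secRes_self] using h2

end Basis

/-! ### Open immersions, and bases under arbitrary pullback -/

section OpenImmersion

variable {X Y Z : Scheme.{u}} {ι : Type u} [Fintype ι]

/-- The restriction of a section along an open immersion. -/
def restrictSec (j : Y ⟶ X) [IsOpenImmersion j] (M : X.Modules) {N : X.Opens} (s : Γ(M, N)) :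
    Γ(M.restrict j, j ⁻¹ᵁ N) :=
  secRes M (j.image_preimage_le N) s

theorem restrictIso_restrictSec (j : Y ⟶ X) [IsOpenImmersion j] (M : X.Modules) {N : X.Opens}
    (s : Γ(M, N)) :
    ((Scheme.Modules.restrictFunctorIsoPullback j).app M).hom.app (j ⁻¹ᵁ N) (restrictSec j M s) =
      pullSec j M (le_refl (j ⁻¹ᵁ N)) s := by
  have h := Adjunction.unit_leftAdjointUniq_hom_app (Scheme.Modules.restrictAdjunction j)
    (Scheme.Modules.pullbackPushforwardAdjunction j) M
  have h2 := congr_arg (fun t => t.app N) h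
  rw [pullSec_rfl]
  exact congr($h2 s)

/-- Opens of `Y` correspond to opens of `X` inside the range of `j`, and the sections of the
restriction are those of `M` over the image. The two coordinate maps therefore agree up to the
isomorphism `j.appIso` on coefficients. -/
theorem isBasisOn_restrictSec_iff (j : Y ⟶ X) [IsOpenImmersion j] (M : X.Modules) {N : X.Opens}
    (hN : N ≤ j.opensRange) (s : ι → Γ(M, N)) :
    IsBasisOn (M.restrict j) (fun i => restrictSec j M (s i)) ↔ IsBasisOn M s := by
  have key (U : Y.Opens) (h : U ≤ j ⁻¹ᵁ N) (h' : j ''ᵁ U ≤ N) :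
      Function.Bijective (fun c : ι → Γ(Y, U) =>
        ∑ i, c i • secRes (M.restrict j) h (restrictSec j M (s i))) ↔
      Function.Bijective (fun c : ι → Γ(X, j ''ᵁ U) => ∑ i, c i • secRes M h' (s i)) := by
    have hb : Function.Bijective fun c : ι → Γ(Y, U) => fun i => (j.appIso U).inv (c i) := by
      have : Function.Bijective (j.appIso U).inv :=
        (ConcreteCategory.isIso_iff_bijective _).1 inferInstance
      exact Function.Bijective.piMap fun _ => this
    rw [← Function.Bijective.of_comp_iff _ hb]
    refine iff_of_eq (congrArg _ (funext fun c => Finset.sum_congr rfl fun i _ => ?_))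
    have e : secRes (M.restrict j) h (restrictSec j M (s i)) =
        (show Γ(M.restrict j, U) from secRes M h' (s i)) :=
      secRes_secRes M (j.image_preimage_le N) (Scheme.Hom.image_mono j h) (s i)
    rw [e]
    rfl
  constructor
  · intro hs N' h
    obtain ⟨U, rfl⟩ : ∃ U : Y.Opens, N' = j ''ᵁ U := by
      refine ⟨j ⁻¹ᵁ N', ?_⟩
      rw [j.image_preimage_eq_opensRange_inf, inf_eq_right.2 (h.trans hN)]
    have hU : U ≤ j ⁻¹ᵁ N := by
      rw [← j.preimage_image_eq U]; exact j.preimage_mono h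
    exact (key U hU h).1 (hs U hU)
  · intro hs U h
    have h' : j ''ᵁ U ≤ N := (Scheme.Hom.image_mono j h).trans (j.image_preimage_le N)
    exact (key U h h').2 (hs _ h')

theorem isBasisOn_pullSec_iff (j : Y ⟶ X) [IsOpenImmersion j] (M : X.Modules) {N : X.Opens}
    (hN : N ≤ j.opensRange) (s : ι → Γ(M, N)) :
    IsBasisOn (pull j M) (fun i => pullSec j M (le_refl (j ⁻¹ᵁ N)) (s i)) ↔ IsBasisOn M s := by
  rw [← isBasisOn_restrictSec_iff j M hN,
    ← isBasisOn_iso_iff ((Scheme.Modules.restrictFunctorIsoPullback j).app M)]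
  simp only [restrictIso_restrictSec]

theorem pullSec_bijective (j : Y ⟶ X) [IsOpenImmersion j] (M : X.Modules) {N : X.Opens}
    (hN : N ≤ j.opensRange) : Function.Bijective (pullSec j M (le_refl (j ⁻¹ᵁ N))) := by
  have h1 := iso_app_bijective ((Scheme.Modules.restrictFunctorIsoPullback j).app M) (j ⁻¹ᵁ N)
  have h2 : Function.Bijective (restrictSec j M (N := N)) := by
    have e : j ''ᵁ j ⁻¹ᵁ N = N := by
      rw [j.image_preimage_eq_opensRange_inf, inf_eq_right.2 hN]
    have : IsIso (homOfLE (j.image_preimage_le N)) := by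
      rw [show homOfLE (j.image_preimage_le N) = eqToHom e from Subsingleton.elim _ _]
      infer_instance
    exact (ConcreteCategory.isIso_iff_bijective
      (M.presheaf.map (homOfLE (j.image_preimage_le N)).op)).1 inferInstance
  have e : (pullSec j M (le_refl (j ⁻¹ᵁ N)) : Γ(M, N) → _) =
      ((Scheme.Modules.restrictFunctorIsoPullback j).app M).hom.app (j ⁻¹ᵁ N) ∘
        restrictSec j M := by
    ext s; exact (restrictIso_restrictSec j M s).symm
  rw [e]
  exact h1.comp h2

/-- The pullback of a basis is a basis. -/
theorem IsBasisOn.pullSec (g : Y ⟶ X) {M : X.Modules} {N : X.Opens} {s : ι → Γ(M, N)}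
    (hs : IsBasisOn M s) {V : Y.Opens} (h : V ≤ g ⁻¹ᵁ N) :
    IsBasisOn (pull g M) fun i => pullSec g M h (s i) := by
  -- Over the open subscheme `N` the basis becomes global, so `IsBasisOn.pullSec_top` applies to `g
  -- ∣_ N`. The conclusion returns to `Y` through the open immersion of `g ⁻¹ᵁ N`.
  have h1 := (isBasisOn_pullSec_iff N.ι M (by simp) s).2 hs
  have eN : N.ι ⁻¹ᵁ N = ⊤ := by simp
  have h2 : IsBasisOn (pull N.ι M) fun i => RelBundle.pullSec N.ι M eN.ge (s i) := by
    simpa using h1.res (eN.ge)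
  have h3 := h2.pullSec_top (g ∣_ N) (V := ⊤) le_top
  have w : (g ∣_ N) ≫ N.ι = (g ⁻¹ᵁ N).ι ≫ g := by simp
  have h4 := (isBasisOn_iso_iff (pullComp (g ∣_ N) N.ι _ w M ≪≫
    (pullComp (g ⁻¹ᵁ N).ι g _ rfl M).symm)).2 h3
  have eV : (g ⁻¹ᵁ N).ι ⁻¹ᵁ (g ⁻¹ᵁ N) = ⊤ := by simp
  have h5 : IsBasisOn (pull (g ⁻¹ᵁ N).ι (pull g M)) fun i =>
      RelBundle.pullSec (g ⁻¹ᵁ N).ι (pull g M) eV.ge (RelBundle.pullSec g M le_rfl (s i)) := by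
    convert h4 using 2 with i
    have a := pullComp_pullSec (g ∣_ N) N.ι _ w M eN.ge (le_top : ⊤ ≤ (g ∣_ N) ⁻¹ᵁ ⊤)
      (show ⊤ ≤ (g ⁻¹ᵁ N).ι ⁻¹ᵁ (g ⁻¹ᵁ N) from eV.ge) (s i)
    have b := pullComp_pullSec (g ⁻¹ᵁ N).ι g _ rfl M (le_refl (g ⁻¹ᵁ N)) eV.ge
      eV.ge (s i)
    have c := congr_arg (fun t : pull (g ⁻¹ᵁ N).ι (pull g M) ⟶ pull (g ⁻¹ᵁ N).ι (pull g M) =>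
      t.app ⊤) (pullComp (g ⁻¹ᵁ N).ι g _ rfl M).hom_inv_id
    have d := congr($c (RelBundle.pullSec (g ⁻¹ᵁ N).ι (pull g M) eV.ge
      (RelBundle.pullSec g M le_rfl (s i))))
    refine d.symm.trans (congrArg ((pullComp (g ⁻¹ᵁ N).ι g _ rfl M).inv.app ⊤) ?_)
    exact b.trans a.symm
  have h6 : IsBasisOn (pull g M) fun i => RelBundle.pullSec g M (le_refl (g ⁻¹ᵁ N)) (s i) := by
    refine (isBasisOn_pullSec_iff (g ⁻¹ᵁ N).ι (pull g M) (by simp) _).1 ?_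
    simpa using h5.res (le_top : (g ⁻¹ᵁ N).ι ⁻¹ᵁ (g ⁻¹ᵁ N) ≤ ⊤)
  simpa using h6.res h

/-- A sheaf of modules which has a basis of a given cardinality near each point. -/
def LocallyHasBasis (ι : Type u) [Fintype ι] (M : X.Modules) : Prop :=
  ∀ x : X, ∃ (N : X.Opens) (s : ι → Γ(M, N)), x ∈ N ∧ IsBasisOn M s

/-- Families of sections replace trivialisations over open subschemes: they can be restricted,
pulled back and multiplied by matrices without coherence isomorphisms. -/
theorem isLocallyFreeOfRank_iff (M : X.Modules) (r : ℕ) :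
    IsLocallyFreeOfRank M r ↔ LocallyHasBasis (ULift.{u} (Fin r)) M := by
  refine forall_congr' fun x => ⟨?_, ?_⟩
  · rintro ⟨V, hx, ⟨e⟩⟩
    have eV : V.ι ⁻¹ᵁ V = ⊤ := by simp
    have hb := (isBasisOn_iso_iff (M := freeMod V (ULift.{u} (Fin r))) (M' := pull V.ι M)
      e.symm).2 (isBasisOn_freeSec (ι := ULift.{u} (Fin r)) (V.ι ⁻¹ᵁ V))
    choose s hs using fun i => (pullSec_bijective V.ι M (N := V) (by simp)).2
      ((show freeMod V (ULift.{u} (Fin r)) ⟶ pull V.ι M from e.inv).app (V.ι ⁻¹ᵁ V)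
        (freeSec (V.ι ⁻¹ᵁ V) i))
    refine ⟨V, s, hx, (isBasisOn_pullSec_iff V.ι M (by simp) s).1 ?_⟩
    simp only [hs]
    exact hb
  · rintro ⟨V, s, hx, hs⟩
    have eV : V.ι ⁻¹ᵁ V = ⊤ := by simp
    have h2 := hs.pullSec V.ι (V := ⊤) eV.ge
    exact ⟨V, hx, h2.nonempty_iso⟩

theorem LocallyHasBasis.pull (g : Y ⟶ X) {M : X.Modules} (h : LocallyHasBasis ι M) :
    LocallyHasBasis ι (pull g M) := fun y =>
  let ⟨N, _, hx, hs⟩ := h (g y)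
  ⟨g ⁻¹ᵁ N, _, hx, hs.pullSec g le_rfl⟩

/-- A morphism is an isomorphism if it locally sends a basis to a basis. -/
theorem isIso_of_isBasisOn {M M' : X.Modules} (φ : M ⟶ M')
    (h : ∀ x : X, ∃ (N : X.Opens) (s : ι → Γ(M, N)), x ∈ N ∧ IsBasisOn M s ∧
      IsBasisOn M' fun i => φ.app N (s i)) : IsIso φ := by
  refine isIso_of_basis φ {U | ∃ (N : X.Opens) (s : ι → Γ(M, N)), U ≤ N ∧ IsBasisOn M s ∧
    IsBasisOn M' fun i => φ.app N (s i)} ?_ ?_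
  · rw [TopologicalSpace.Opens.isBasis_iff_nbhd]
    intro U x hx
    obtain ⟨N, s, hxN, h1, h2⟩ := h x
    exact ⟨U ⊓ N, ⟨N, s, inf_le_right, h1, h2⟩, ⟨hx, hxN⟩, inf_le_left⟩
  · rintro U ⟨N, s, hU, h1, h2⟩
    exact h1.app_bijective φ h2 hU

end OpenImmersion

/-! ### Morphisms into direct images, on sections -/

section PushSec

variable {X Y Z : Scheme.{u}} {ι : Type u} [Fintype ι]

/-- The action on sections of a morphism to a direct image. -/
def pushSec {g : Y ⟶ X} {M : X.Modules} {P : Y.Modules}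
    (φ : M ⟶ (Scheme.Modules.pushforward g).obj P) (N : X.Opens) : Γ(M, N) →+ Γ(P, g ⁻¹ᵁ N) :=
  (φ.app N).hom

theorem pushSec_smul {g : Y ⟶ X} {M : X.Modules} {P : Y.Modules}
    (φ : M ⟶ (Scheme.Modules.pushforward g).obj P) {N : X.Opens} (r : Γ(X, N)) (s : Γ(M, N)) :
    pushSec φ N (r • s) = pullFun g (le_refl (g ⁻¹ᵁ N)) r • pushSec φ N s := by
  refine (Scheme.Modules.Hom.app_smul φ r s).trans ?_
  refine (smul_pushforward g P N r _).trans ?_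
  congr 1
  exact (funRes_self _ _).symm

theorem pushSec_secRes {g : Y ⟶ X} {M : X.Modules} {P : Y.Modules}
    (φ : M ⟶ (Scheme.Modules.pushforward g).obj P) {N N' : X.Opens} (h : N' ≤ N) (s : Γ(M, N)) :
    pushSec φ N' (secRes M h s) = secRes P (g.preimage_mono h) (pushSec φ N s) :=
  app_secRes φ h s

theorem pushSec_sum_smul {g : Y ⟶ X} {M : X.Modules} {P : Y.Modules}
    (φ : M ⟶ (Scheme.Modules.pushforward g).obj P) {N N' : X.Opens} (h : N' ≤ N)
    (c : ι → Γ(X, N')) (s : ι → Γ(M, N)) :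
    pushSec φ N' (∑ i, c i • secRes M h (s i)) =
      ∑ i, pullFun g (le_refl (g ⁻¹ᵁ N')) (c i) •
        secRes P (g.preimage_mono h) (pushSec φ N (s i)) := by
  rw [map_sum]
  exact Finset.sum_congr rfl fun i _ => by rw [pushSec_smul, pushSec_secRes]

theorem pullSec_sum_smul (g : Y ⟶ X) {M : X.Modules} {N : X.Opens} {V : Y.Opens} (h : V ≤ g ⁻¹ᵁ N)
    (c : ι → Γ(X, N)) (s : ι → Γ(M, N)) :
    pullSec g M h (∑ i, c i • s i) = ∑ i, pullFun g h (c i) • pullSec g M h (s i) := by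
  rw [map_sum]
  exact Finset.sum_congr rfl fun i _ => pullSec_smul _ _ _ _ _

theorem pullLift_pullSec' {g : Y ⟶ X} {M : X.Modules} {K : Y.Modules}
    (φ : M ⟶ (Scheme.Modules.pushforward g).obj K) {N : X.Opens} {V : Y.Opens}
    (h : V ≤ g ⁻¹ᵁ N) (s : Γ(M, N)) :
    (pullLift φ).app V (pullSec g M h s) = secRes K h (pushSec φ N s) :=
  pullLift_pullSec φ h s

/-- The morphism `M ⟶ g_* K` adjoint to `φ : g^* M ⟶ K`. -/
def pushLift {g : Y ⟶ X} {M : X.Modules} {K : Y.Modules} (φ : pull g M ⟶ K) :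
    M ⟶ (Scheme.Modules.pushforward g).obj K :=
  (Scheme.Modules.pullbackPushforwardAdjunction g).homEquiv M K φ

@[simp]
theorem pullLift_pushLift {g : Y ⟶ X} {M : X.Modules} {K : Y.Modules} (φ : pull g M ⟶ K) :
    pullLift (pushLift φ) = φ :=
  Equiv.symm_apply_apply _ _

theorem pushLift_injective {g : Y ⟶ X} {M : X.Modules} {K : Y.Modules} :
    Function.Injective (pushLift : (pull g M ⟶ K) → _) :=
  Equiv.injective _

theorem pushSec_pushLift {g : Y ⟶ X} {M : X.Modules} {K : Y.Modules} (φ : pull g M ⟶ K)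
    {N : X.Opens} (s : Γ(M, N)) :
    pushSec (pushLift φ) N s = φ.app _ (pullSec g M (le_refl (g ⁻¹ᵁ N)) s) := by
  have := pullLift_pullSec' (pushLift φ) (le_refl (g ⁻¹ᵁ N)) s
  rw [pullLift_pushLift, secRes_self] at this
  exact this.symm

theorem hom_ext_pushSec {g : Y ⟶ X} {M : X.Modules} {P : Y.Modules}
    {φ ψ : M ⟶ (Scheme.Modules.pushforward g).obj P}
    (h : ∀ N s, pushSec φ N s = pushSec ψ N s) : φ = ψ := by
  ext N s
  exact h N s

/-- The morphism `g_* P ⟶ h_* K` given by `i ≫ g = h` and a morphism `i^* P ⟶ K`. -/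
def pushMap {i : Z ⟶ Y} {g : Y ⟶ X} {h : Z ⟶ X} (w : i ≫ g = h) {P : Y.Modules} {K : Z.Modules}
    (β : pull i P ⟶ K) :
    (Scheme.Modules.pushforward g).obj P ⟶ (Scheme.Modules.pushforward h).obj K :=
  (Scheme.Modules.pushforward g).map (pushLift β) ≫
    (Scheme.Modules.pushforwardComp i g).hom.app K ≫
    (Scheme.Modules.pushforwardCongr w).hom.app K

theorem preimage_le_preimage_of_comp {i : Z ⟶ Y} {g : Y ⟶ X} {h : Z ⟶ X} (w : i ≫ g = h)
    (N : X.Opens) : h ⁻¹ᵁ N ≤ i ⁻¹ᵁ g ⁻¹ᵁ N := by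
  subst w; exact le_rfl

theorem pushMap_app {i : Z ⟶ Y} {g : Y ⟶ X} {h : Z ⟶ X} (w : i ≫ g = h) {P : Y.Modules}
    {K : Z.Modules} (β : pull i P ⟶ K) (N : X.Opens) (t : Γ(P, g ⁻¹ᵁ N)) :
    (show Γ(K, h ⁻¹ᵁ N) from (pushMap w β).app N t) =
      β.app _ (pullSec i P (preimage_le_preimage_of_comp w N) t) := by
  subst w
  have e : (Scheme.Modules.pushforwardCongr (rfl : i ≫ g = i ≫ g)).hom.app K = 𝟙 _ := by
    ext N x
    exact secRes_self K (le_refl ((i ≫ g) ⁻¹ᵁ N)) x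
  rw [pushMap, e, Category.comp_id]
  exact pushSec_pushLift β t

end PushSec

/-! ### Cartesian squares of sheaves of modules -/

section SheafPullback

variable {X : Scheme.{u}} {M P Q K : X.Modules} {a : M ⟶ P} {b : M ⟶ Q} {c : P ⟶ K} {d : Q ⟶ K}

/-- Fibre products of sheaves are computed on sections: passing to presheaves and evaluating at an
open both preserve them. -/
theorem existsUnique_section_of_isPullback (h : IsPullback a b c d) (N : X.Opens) (p : Γ(P, N)) (q : Γ(Q, N))
    (hpq : c.app N p = d.app N q) : ∃! m : Γ(M, N), a.app N m = p ∧ b.app N m = q := by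
  have h1 := (h.map (Scheme.Modules.toPresheaf X)).map
    ((evaluation _ _).obj (Opposite.op N) ⋙ CategoryTheory.forget Ab)
  obtain ⟨_, h2, h3⟩ := (Types.isPullback_iff _ _ _ _).1 h1
  obtain ⟨m, hm1, hm2⟩ := h3 p q hpq
  exact ⟨m, ⟨hm1, hm2⟩, fun m' hm' => h2 _ _ ⟨hm'.1.trans hm1.symm, hm'.2.trans hm2.symm⟩⟩

/-- A commutative square of sheaves of modules is cartesian if it is so on the sections over the
members of a basis of the topology. -/
theorem isPullback_of_basis (w : a ≫ c = b ≫ d) (B : Set X.Opens)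
    (hB : TopologicalSpace.Opens.IsBasis B)
    (h : ∀ N ∈ B, ∀ (p : Γ(P, N)) (q : Γ(Q, N)), c.app N p = d.app N q →
      ∃! m : Γ(M, N), a.app N m = p ∧ b.app N m = q) : IsPullback a b c d := by
  have key : IsIso (pullback.lift a b w) := by
    refine isIso_of_basis _ B hB fun N hN => ?_
    have hl (m : Γ(M, N)) : (pullback.fst c d).app N ((pullback.lift a b w).app N m) =
        a.app N m := by
      have := congr_arg (fun t : M ⟶ P => t.app N) (pullback.lift_fst a b w)
      exact congr($this m)
    have hr (m : Γ(M, N)) : (pullback.snd c d).app N ((pullback.lift a b w).app N m) =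
        b.app N m := by
      have := congr_arg (fun t : M ⟶ Q => t.app N) (pullback.lift_snd a b w)
      exact congr($this m)
    have hc (m : Γ(pullback c d, N)) : c.app N ((pullback.fst c d).app N m) =
        d.app N ((pullback.snd c d).app N m) := by
      have := congr_arg (fun t : pullback c d ⟶ K => t.app N) (pullback.condition (f := c) (g := d))
      exact congr($this m)
    have hL := existsUnique_section_of_isPullback (IsPullback.of_hasPullback c d) N
    constructor
    · intro m m' hm
      have hw : c.app N (a.app N m) = d.app N (b.app N m) := by rw [← hl, ← hr, hc]
      refine (h N hN _ _ hw).unique ⟨rfl, rfl⟩ ⟨?_, ?_⟩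
      · rw [← hl, ← hm, hl]
      · rw [← hr, ← hm, hr]
    · intro x
      obtain ⟨m, ⟨h1, h2⟩, -⟩ := h N hN _ _ (hc x)
      exact ⟨m, (hL _ _ (hc x)).unique ⟨(hl m).trans h1, (hr m).trans h2⟩ ⟨rfl, rfl⟩⟩
  exact IsPullback.of_iso_pullback ⟨w⟩ (asIso (pullback.lift a b w))
    (pullback.lift_fst a b w) (pullback.lift_snd a b w)

end SheafPullback

/-! ### Milnor squares of schemes, and patching of sections -/

/-- A commutative square of schemes along which vector bundles can be patched. -/
structure PatchSquare {U U' V W : Scheme.{u}} (i : U ⟶ U') (g : U ⟶ V) (g' : U' ⟶ W)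
    (i' : V ⟶ W) (h : U ⟶ W) : Prop where
  comm₁ : i ≫ g' = h
  comm₂ : g ≫ i' = h
  isClosedImmersion_i : IsClosedImmersion i
  surjective_i : Surjective i
  isClosedImmersion_i' : IsClosedImmersion i'
  surjective_i' : Surjective i'
  isAffineHom : IsAffineHom g'
  isClosedEmbedding : Topology.IsClosedEmbedding g'
  existsUnique : ∀ N : W.Opens, IsAffineOpen N → ∀ (x : Γ(U', g' ⁻¹ᵁ N)) (y : Γ(V, i' ⁻¹ᵁ N)),
    pullFun i (preimage_le_preimage_of_comp comm₁ N) x =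
      pullFun g (preimage_le_preimage_of_comp comm₂ N) y →
    ∃! z : Γ(W, N), pullFun g' le_rfl z = x ∧ pullFun i' le_rfl z = y

namespace PatchSquare

variable {U U' V W : Scheme.{u}} {i : U ⟶ U'} {g : U ⟶ V} {g' : U' ⟶ W} {i' : V ⟶ W} {h : U ⟶ W}
  {ι : Type u} [Fintype ι]

section

variable (sq : PatchSquare i g g' i' h)
include sq

/-- Affine opens form a basis, so the condition in the definition makes the structure sheaf of `W` a
fibre product of direct images; this then holds over every open. -/
theorem existsUnique_fun (N : W.Opens) (x : Γ(U', g' ⁻¹ᵁ N)) (y : Γ(V, i' ⁻¹ᵁ N))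
    (hxy : pullFun i (preimage_le_preimage_of_comp sq.comm₁ N) x =
      pullFun g (preimage_le_preimage_of_comp sq.comm₂ N) y) :
    ∃! z : Γ(W, N), pullFun g' le_rfl z = x ∧ pullFun i' le_rfl z = y := by
  have e₁ (N : W.Opens) (z : Γ(W, N)) : g'.app N z = pullFun g' (le_refl (g' ⁻¹ᵁ N)) z :=
    (funRes_self _ _).symm
  have e₂ (N : W.Opens) (z : Γ(W, N)) : i'.app N z = pullFun i' (le_refl (i' ⁻¹ᵁ N)) z :=
    (funRes_self _ _).symm
  have c₁ (N : W.Opens) (p : Γ(unitMod U', g' ⁻¹ᵁ N)) :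
      (show Γ(unitMod U, h ⁻¹ᵁ N) from (pushMap sq.comm₁ (pullLift (unitToPush i))).app N p) =
        (show Γ(unitMod U, h ⁻¹ᵁ N) from
          pullFun i (preimage_le_preimage_of_comp sq.comm₁ N) (unitEquiv _ p)) :=
    (pushMap_app sq.comm₁ _ N p).trans (pullLift_pullSec _ _ _)
  have c₂ (N : W.Opens) (q : Γ(unitMod V, i' ⁻¹ᵁ N)) :
      (show Γ(unitMod U, h ⁻¹ᵁ N) from (pushMap sq.comm₂ (pullLift (unitToPush g))).app N q) =
        (show Γ(unitMod U, h ⁻¹ᵁ N) from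
          pullFun g (preimage_le_preimage_of_comp sq.comm₂ N) (unitEquiv _ q)) :=
    (pushMap_app sq.comm₂ _ N q).trans (pullLift_pullSec _ _ _)
  have key := isPullback_of_basis (a := unitToPush g') (b := unitToPush i')
    (c := pushMap sq.comm₁ (pullLift (unitToPush i)))
    (d := pushMap sq.comm₂ (pullLift (unitToPush g))) ?_ W.affineOpens W.isBasis_affineOpens ?_
  · have := existsUnique_section_of_isPullback key N x y ((c₁ N x).trans (hxy.trans (c₂ N y).symm))
    obtain ⟨m, ⟨h1, h2⟩, h3⟩ := this
    exact ⟨m, ⟨(e₁ N m).symm.trans h1, (e₂ N m).symm.trans h2⟩,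
      fun m' hm' => h3 m' ⟨(e₁ N m').trans hm'.1, (e₂ N m').trans hm'.2⟩⟩
  · refine hom_ext_pushSec fun N s => ?_
    refine (c₁ N _).trans (Eq.trans ?_ (c₂ N _).symm)
    change pullFun i _ (g'.app N (unitEquiv N s)) = pullFun g _ (i'.app N (unitEquiv N s))
    rw [e₁, e₂, pullFun_pullFun i g' h sq.comm₁ _ _ le_rfl,
      pullFun_pullFun g i' h sq.comm₂ _ _ le_rfl]
  · intro N hN x y hxy
    obtain ⟨m, ⟨h1, h2⟩, h3⟩ := sq.existsUnique N hN x y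
      ((c₁ N x).symm.trans (hxy.trans (c₂ N y)))
    exact ⟨m, ⟨(e₁ N m).trans h1, (e₂ N m).trans h2⟩,
      fun m' hm' => h3 m' ⟨(e₁ N m').symm.trans hm'.1, (e₂ N m').symm.trans hm'.2⟩⟩

end

/-- A section of `M` over `N` is the same as a compatible pair of sections of `P` and `Q`. -/
def IsPatched (sq : PatchSquare i g g' i' h) {P : U'.Modules} {Q : V.Modules} {K : U.Modules}
    (β : pull i P ⟶ K) (γ : pull g Q ⟶ K) {M : W.Modules}
    (a : M ⟶ (Scheme.Modules.pushforward g').obj P)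
    (b : M ⟶ (Scheme.Modules.pushforward i').obj Q) (N : W.Opens) : Prop :=
  ∀ (p : Γ(P, g' ⁻¹ᵁ N)) (q : Γ(Q, i' ⁻¹ᵁ N)),
    β.app (h ⁻¹ᵁ N) (pullSec i P (preimage_le_preimage_of_comp sq.comm₁ N) p) =
      γ.app (h ⁻¹ᵁ N) (pullSec g Q (preimage_le_preimage_of_comp sq.comm₂ N) q) →
    ∃! m : Γ(M, N), pushSec a N m = p ∧ pushSec b N m = q

variable (sq : PatchSquare i g g' i' h) {P : U'.Modules} {Q : V.Modules} {K : U.Modules}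
  {β : pull i P ⟶ K} {γ : pull g Q ⟶ K} {M : W.Modules}
  {a : M ⟶ (Scheme.Modules.pushforward g').obj P} {b : M ⟶ (Scheme.Modules.pushforward i').obj Q}

theorem comp_eq_comp_iff :
    a ≫ pushMap sq.comm₁ β = b ≫ pushMap sq.comm₂ γ ↔
      ∀ (N : W.Opens) (m : Γ(M, N)),
        β.app (h ⁻¹ᵁ N) (pullSec i P (preimage_le_preimage_of_comp sq.comm₁ N) (pushSec a N m)) =
        γ.app (h ⁻¹ᵁ N) (pullSec g Q (preimage_le_preimage_of_comp sq.comm₂ N) (pushSec b N m)) := by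
  constructor
  · intro w N m
    have := congr_arg (fun t : M ⟶ _ => t.app N) w
    have h2 := congr($this m)
    exact (pushMap_app sq.comm₁ β N (pushSec a N m)).symm.trans
      (h2.trans (pushMap_app sq.comm₂ γ N (pushSec b N m)))
  · intro w
    refine hom_ext_pushSec fun N m => ?_
    exact (pushMap_app sq.comm₁ β N (pushSec a N m)).trans
      ((w N m).trans (pushMap_app sq.comm₂ γ N (pushSec b N m)).symm)

theorem isPatched_of_isPullback
    (hp : IsPullback a b (pushMap sq.comm₁ β) (pushMap sq.comm₂ γ)) (N : W.Opens) :
    sq.IsPatched β γ a b N := fun p q hpq =>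
  existsUnique_section_of_isPullback hp N p q
    ((pushMap_app sq.comm₁ β N p).trans (hpq.trans (pushMap_app sq.comm₂ γ N q).symm))

theorem isPullback_of_isPatched (w : a ≫ pushMap sq.comm₁ β = b ≫ pushMap sq.comm₂ γ)
    (B : Set W.Opens) (hB : TopologicalSpace.Opens.IsBasis B)
    (hN : ∀ N ∈ B, sq.IsPatched β γ a b N) :
    IsPullback a b (pushMap sq.comm₁ β) (pushMap sq.comm₂ γ) :=
  isPullback_of_basis w B hB fun N hNB p q hpq => hN N hNB p q
    ((pushMap_app sq.comm₁ β N p).symm.trans (hpq.trans (pushMap_app sq.comm₂ γ N q)))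

section

variable {N : W.Opens} {s : ι → Γ(M, N)}
  (ha : IsBasisOn P fun j => pushSec a N (s j)) (hb : IsBasisOn Q fun j => pushSec b N (s j))
  (hk : IsBasisOn K fun j => β.app (h ⁻¹ᵁ N)
    (pullSec i P (preimage_le_preimage_of_comp sq.comm₁ N) (pushSec a N (s j))))
  (w : a ≫ pushMap sq.comm₁ β = b ≫ pushMap sq.comm₂ γ)
include ha hb hk w

/-- Since the images of `s` form a basis of `K`, compatibility of `p` and `q` forces their
coefficients to agree over `U`, and each pair of coefficients glues to a function on `N'`. The
family `s` is not assumed to be a basis of `M`, so that this can serve to prove that it is one. -/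
theorem exists_coeff {N' : W.Opens} (hN : N' ≤ N) (p : Γ(P, g' ⁻¹ᵁ N')) (q : Γ(Q, i' ⁻¹ᵁ N'))
    (hpq : β.app (h ⁻¹ᵁ N') (pullSec i P (preimage_le_preimage_of_comp sq.comm₁ N') p) =
      γ.app (h ⁻¹ᵁ N') (pullSec g Q (preimage_le_preimage_of_comp sq.comm₂ N') q)) :
    ∃ c : ι → Γ(W, N'), pushSec a N' (∑ j, c j • secRes M hN (s j)) = p ∧
      pushSec b N' (∑ j, c j • secRes M hN (s j)) = q := by
  obtain ⟨x, rfl⟩ := (ha _ (g'.preimage_mono hN)).2 p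
  obtain ⟨y, rfl⟩ := (hb _ (i'.preimage_mono hN)).2 q
  have hw := (comp_eq_comp_iff sq).1 w
  have hxy : (fun j => pullFun i (preimage_le_preimage_of_comp sq.comm₁ N') (x j)) =
      fun j => pullFun g (preimage_le_preimage_of_comp sq.comm₂ N') (y j) := by
    apply (hk _ (h.preimage_mono hN)).1
    simp only [pullSec_sum_smul, app_sum_smul, pullSec_secRes] at hpq
    refine Eq.trans (Finset.sum_congr rfl fun j _ => ?_)
      (hpq.trans (Finset.sum_congr rfl fun j _ => ?_))
    · rw [← app_secRes, secRes_pullSec]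
    · dsimp only
      rw [hw, ← app_secRes, secRes_pullSec]
  choose c hc _ using fun j => sq.existsUnique_fun N' (x j) (y j) (congrFun hxy j)
  refine ⟨c, ?_, ?_⟩
  · rw [pushSec_sum_smul]
    exact Finset.sum_congr rfl fun j _ => by rw [(hc j).1]
  · rw [pushSec_sum_smul]
    exact Finset.sum_congr rfl fun j _ => by rw [(hc j).2]

include sq in
omit hk w in
theorem coeff_unique {N' : W.Opens} (hN : N' ≤ N) {c d : ι → Γ(W, N')}
    (h₁ : pushSec a N' (∑ j, c j • secRes M hN (s j)) =
      pushSec a N' (∑ j, d j • secRes M hN (s j)))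
    (h₂ : pushSec b N' (∑ j, c j • secRes M hN (s j)) =
      pushSec b N' (∑ j, d j • secRes M hN (s j))) : c = d := by
  rw [pushSec_sum_smul, pushSec_sum_smul] at h₁ h₂
  have e₁ := (ha _ (g'.preimage_mono hN)).1 h₁
  have e₂ := (hb _ (i'.preimage_mono hN)).1 h₂
  ext j
  refine (sq.existsUnique_fun N' (pullFun g' le_rfl (d j)) (pullFun i' le_rfl (d j)) ?_).unique
    ⟨congrFun e₁ j, congrFun e₂ j⟩ ⟨rfl, rfl⟩
  rw [pullFun_pullFun i g' h sq.comm₁ _ _ le_rfl, pullFun_pullFun g i' h sq.comm₂ _ _ le_rfl]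

theorem isPatched_of_isBasisOn (hs : IsBasisOn M s) {N' : W.Opens} (hN : N' ≤ N) :
    sq.IsPatched β γ a b N' := by
  intro p q hpq
  obtain ⟨c, h1, h2⟩ := exists_coeff sq ha hb hk w hN p q hpq
  refine ⟨_, ⟨h1, h2⟩, fun m hm => ?_⟩
  obtain ⟨d, rfl⟩ := (hs N' hN).2 m
  have := coeff_unique sq ha hb hN (c := d) (d := c) (hm.1.trans h1.symm) (hm.2.trans h2.symm)
  rw [this]

/-- This direction serves the fibre product of direct images, which is patched by construction and
whose local freeness is at stake; `isPatched_of_isBasisOn` serves bundles already given on `W`. -/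
theorem isBasisOn_of_isPatched (hp : ∀ N' ≤ N, sq.IsPatched β γ a b N') : IsBasisOn M s := by
  intro N' hN
  refine ⟨fun c d hcd => coeff_unique sq ha hb hN (congrArg _ hcd) (congrArg _ hcd),
    fun m => ?_⟩
  have hw := (comp_eq_comp_iff sq).1 w N' m
  obtain ⟨c, h1, h2⟩ := exists_coeff sq ha hb hk w hN _ _ hw
  exact ⟨c, (hp N' hN _ _ hw).unique ⟨h1, h2⟩ ⟨rfl, rfl⟩⟩

end

end PatchSquare

section

variable {X Y Z : Scheme.{u}} {ι : Type u} [Fintype ι]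

theorem pushLift_map (g : Y ⟶ X) {M M' : X.Modules} (φ : M ⟶ M') :
    pushLift ((Scheme.Modules.pullback g).map φ) = φ ≫ pushLift (𝟙 (pull g M')) := by
  refine hom_ext_pushSec fun N s => ?_
  rw [pushSec_pushLift, map_pullSec]
  exact (pushSec_pushLift (𝟙 (pull g M')) (φ.app N s)).symm

theorem pushSec_pushLift_id (g : Y ⟶ X) (M : X.Modules) {N : X.Opens} (s : Γ(M, N)) :
    pushSec (pushLift (𝟙 (pull g M))) N s = pullSec g M le_rfl s :=
  pushSec_pushLift _ _

theorem pullComp_inv_pullSec (g : Z ⟶ Y) (f : Y ⟶ X) (h : Z ⟶ X) (w : g ≫ f = h) (M : X.Modules)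
    {N : X.Opens} {V : Y.Opens} {V' : Z.Opens} (h₁ : V ≤ f ⁻¹ᵁ N) (h₂ : V' ≤ g ⁻¹ᵁ V)
    (h₃ : V' ≤ h ⁻¹ᵁ N) (s : Γ(M, N)) :
    (pullComp g f h w M).inv.app V' (pullSec h M h₃ s) = pullSec g _ h₂ (pullSec f M h₁ s) := by
  rw [← pullComp_pullSec g f h w M h₁ h₂ h₃]
  have := congr_arg (fun t : pull g (pull f M) ⟶ pull g (pull f M) => t.app V')
    (pullComp g f h w M).hom_inv_id
  exact congr($this _)

end

/-! ### Patching morphisms of bundles -/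

namespace PatchSquare

variable {U U' V W : Scheme.{u}} {i : U ⟶ U'} {g : U ⟶ V} {g' : U' ⟶ W} {i' : V ⟶ W} {h : U ⟶ W}
  {ι : Type u} [Fintype ι] (sq : PatchSquare i g g' i' h)
include sq

/-- Functions on `W` are compatible pairs of functions, and `E` is locally a finite power of the
structure sheaf, so its sections are compatible pairs too. -/
theorem isPullback_of_locallyHasBasis {E : W.Modules} (hE : LocallyHasBasis ι E) :
    IsPullback (pushLift (𝟙 (pull g' E))) (pushLift (𝟙 (pull i' E)))
      (pushMap sq.comm₁ (pullComp i g' h sq.comm₁ E).hom)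
      (pushMap sq.comm₂ (pullComp g i' h sq.comm₂ E).hom) := by
  have e₁ (N : W.Opens) (m : Γ(E, N)) := pullComp_pullSec i g' h sq.comm₁ E
    (le_refl (g' ⁻¹ᵁ N)) (preimage_le_preimage_of_comp sq.comm₁ N) le_rfl m
  have e₂ (N : W.Opens) (m : Γ(E, N)) := pullComp_pullSec g i' h sq.comm₂ E
    (le_refl (i' ⁻¹ᵁ N)) (preimage_le_preimage_of_comp sq.comm₂ N) le_rfl m
  have w : pushLift (𝟙 (pull g' E)) ≫ pushMap sq.comm₁ (pullComp i g' h sq.comm₁ E).hom =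
      pushLift (𝟙 (pull i' E)) ≫ pushMap sq.comm₂ (pullComp g i' h sq.comm₂ E).hom := by
    rw [comp_eq_comp_iff sq]
    intro N m
    rw [pushSec_pushLift_id, pushSec_pushLift_id, e₁, e₂]
  refine isPullback_of_isPatched sq w
    {N' | ∃ (N : W.Opens) (s : ι → Γ(E, N)), N' ≤ N ∧ IsBasisOn E s} ?_ ?_
  · rw [TopologicalSpace.Opens.isBasis_iff_nbhd]
    intro N' x hx
    obtain ⟨N, s, hxN, hs⟩ := hE x
    exact ⟨N' ⊓ N, ⟨N, s, inf_le_right, hs⟩, ⟨hx, hxN⟩, inf_le_left⟩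
  · rintro N' ⟨N, s, hN, hs⟩
    refine isPatched_of_isBasisOn sq (s := s) ?_ ?_ ?_ w hs hN
    · simpa only [pushSec_pushLift_id] using hs.pullSec g' le_rfl
    · simpa only [pushSec_pushLift_id] using hs.pullSec i' le_rfl
    · simpa only [pushSec_pushLift_id, e₁] using hs.pullSec h le_rfl

/-- Morphisms of vector bundles can be patched. -/
theorem existsUnique_hom {E₁ E₂ : W.Modules} (hE : LocallyHasBasis ι E₂)
    (α : pull g' E₁ ⟶ pull g' E₂) (β : pull i' E₁ ⟶ pull i' E₂)
    (hc : (pullComp i g' h sq.comm₁ E₁).inv ≫ (Scheme.Modules.pullback i).map α ≫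
        (pullComp i g' h sq.comm₁ E₂).hom =
      (pullComp g i' h sq.comm₂ E₁).inv ≫ (Scheme.Modules.pullback g).map β ≫
        (pullComp g i' h sq.comm₂ E₂).hom) :
    ∃! φ : E₁ ⟶ E₂, (Scheme.Modules.pullback g').map φ = α ∧
      (Scheme.Modules.pullback i').map φ = β := by
  have hp := sq.isPullback_of_locallyHasBasis hE
  have w : pushLift α ≫ pushMap sq.comm₁ (pullComp i g' h sq.comm₁ E₂).hom =
      pushLift β ≫ pushMap sq.comm₂ (pullComp g i' h sq.comm₂ E₂).hom := by
    rw [comp_eq_comp_iff sq]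
    intro N m
    have h1 := congr_arg (fun t : pull h E₁ ⟶ pull h E₂ => t.app (h ⁻¹ᵁ N)) hc
    have h2 : ((pullComp i g' h sq.comm₁ E₂).hom.app _
        (((Scheme.Modules.pullback i).map α).app _
          ((pullComp i g' h sq.comm₁ E₁).inv.app (h ⁻¹ᵁ N) (pullSec h E₁ le_rfl m)))) =
        ((pullComp g i' h sq.comm₂ E₂).hom.app _
        (((Scheme.Modules.pullback g).map β).app _
          ((pullComp g i' h sq.comm₂ E₁).inv.app (h ⁻¹ᵁ N) (pullSec h E₁ le_rfl m)))) :=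
      congr($h1 (pullSec h E₁ le_rfl m))
    rw [pullComp_inv_pullSec i g' h sq.comm₁ E₁ (le_refl (g' ⁻¹ᵁ N))
      (preimage_le_preimage_of_comp sq.comm₁ N),
      pullComp_inv_pullSec g i' h sq.comm₂ E₁ (le_refl (i' ⁻¹ᵁ N))
      (preimage_le_preimage_of_comp sq.comm₂ N), map_pullSec, map_pullSec] at h2
    rw [pushSec_pushLift, pushSec_pushLift]
    exact h2
  -- After transposition, prescribing the two pullbacks of `φ` amounts to prescribing its composites
  -- with the two projections of the cartesian square.
  have key (φ : E₁ ⟶ E₂) : ((Scheme.Modules.pullback g').map φ = α ∧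
      (Scheme.Modules.pullback i').map φ = β) ↔ (φ ≫ pushLift (𝟙 (pull g' E₂)) = pushLift α ∧
      φ ≫ pushLift (𝟙 (pull i' E₂)) = pushLift β) := by
    rw [← pushLift_map, ← pushLift_map, pushLift_injective.eq_iff, pushLift_injective.eq_iff]
  simp only [key]
  exact ⟨hp.lift _ _ w, ⟨hp.lift_fst _ _ w, hp.lift_snd _ _ w⟩,
    fun φ hφ => hp.hom_ext (hφ.1.trans (hp.lift_fst _ _ w).symm)
      (hφ.2.trans (hp.lift_snd _ _ w).symm)⟩

theorem hom_ext {E₁ E₂ : W.Modules} (hE : LocallyHasBasis ι E₂) {φ ψ : E₁ ⟶ E₂}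
    (h₁ : (Scheme.Modules.pullback g').map φ = (Scheme.Modules.pullback g').map ψ)
    (h₂ : (Scheme.Modules.pullback i').map φ = (Scheme.Modules.pullback i').map ψ) : φ = ψ := by
  refine (sq.isPullback_of_locallyHasBasis hE).hom_ext ?_ ?_
  · rw [← pushLift_map, ← pushLift_map, h₁]
  · rw [← pushLift_map, ← pushLift_map, h₂]

/-- Isomorphisms of vector bundles can be patched. -/
theorem exists_iso {E₁ E₂ : W.Modules} (hE₁ : LocallyHasBasis ι E₁) (hE₂ : LocallyHasBasis ι E₂)
    (α : pull g' E₁ ≅ pull g' E₂) (β : pull i' E₁ ≅ pull i' E₂)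
    (hc : res α i h h sq.comm₁ sq.comm₁ = res β g h h sq.comm₂ sq.comm₂) :
    ∃ φ : E₁ ≅ E₂, (Scheme.Modules.pullback g').mapIso φ = α ∧
      (Scheme.Modules.pullback i').mapIso φ = β := by
  obtain ⟨φ, ⟨h1, h2⟩, -⟩ := sq.existsUnique_hom hE₂ α.hom β.hom (congrArg Iso.hom hc)
  have hc' : res α.symm i h h sq.comm₁ sq.comm₁ = res β.symm g h h sq.comm₂ sq.comm₂ := by
    rw [res_symm, res_symm, hc]
  obtain ⟨ψ, ⟨h3, h4⟩, -⟩ := sq.existsUnique_hom hE₁ α.inv β.inv (congrArg Iso.hom hc')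
  refine ⟨⟨φ, ψ, sq.hom_ext hE₁ ?_ ?_, sq.hom_ext hE₂ ?_ ?_⟩, ?_, ?_⟩
  · simp [h1, h3]
  · simp [h2, h4]
  · simp [h1, h3]
  · simp [h2, h4]
  · ext1; exact h1
  · ext1; exact h2

end PatchSquare

/-! ### Change of basis, and lifting of units -/

section MatrixBasis

variable {X : Scheme.{u}} {ι : Type u} [Fintype ι] {M : X.Modules} {N : X.Opens}

theorem IsBasisOn.exists_coeff {s : ι → Γ(M, N)} (hs : IsBasisOn M s) (x : Γ(M, N)) :
    ∃ c : ι → Γ(X, N), ∑ j, c j • s j = x := by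
  simpa using (hs N le_rfl).2 x

theorem IsBasisOn.coeff_unique {s : ι → Γ(M, N)} (hs : IsBasisOn M s) {c d : ι → Γ(X, N)}
    (h : ∑ j, c j • s j = ∑ j, d j • s j) : c = d := by
  apply (hs N le_rfl).1
  simpa using h

theorem sum_smul_sum_smul {R T : Type*} [CommRing R] [AddCommGroup T] [Module R T]
    (c : ι → R) (A : Matrix ι ι R) (s : ι → T) :
    ∑ j, c j • ∑ l, A j l • s l = ∑ l, (Matrix.vecMul c A) l • s l := by
  simp only [Finset.smul_sum, smul_smul, Matrix.vecMul, dotProduct, Finset.sum_smul]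
  exact Finset.sum_comm

theorem IsBasisOn.matrix [DecidableEq ι] {s : ι → Γ(M, N)} (hs : IsBasisOn M s)
    {A : Matrix ι ι Γ(X, N)} (hA : IsUnit A) : IsBasisOn M fun j => ∑ l, A j l • s l := by
  intro N' h
  have hA' : IsUnit (A.map (funRes X h)) := hA.map (funRes X h).mapMatrix
  obtain ⟨B, hB⟩ := hA'
  have hb : Function.Bijective fun c : ι → Γ(X, N') => Matrix.vecMul c (A.map (funRes X h)) := by
    rw [← hB]
    refine ⟨Function.LeftInverse.injective (g := fun c => Matrix.vecMul c B.inv) fun c => ?_,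
      Function.RightInverse.surjective (g := fun c => Matrix.vecMul c B.inv) fun c => ?_⟩
    · simp
    · simp
  convert (hs N' h).comp hb using 1
  ext c
  rw [Function.comp_apply, ← sum_smul_sum_smul]
  refine Finset.sum_congr rfl fun j _ => ?_
  rw [map_sum]
  simp only [secRes_smul, Matrix.map_apply]

theorem IsBasisOn.exists_matrix [DecidableEq ι] {s t : ι → Γ(M, N)} (hs : IsBasisOn M s)
    (ht : IsBasisOn M t) :
    ∃ A : Matrix ι ι Γ(X, N), IsUnit A ∧ ∀ j, ∑ l, A j l • s l = t j := by
  choose A hA using fun j => hs.exists_coeff (t j)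
  choose B hB using fun j => ht.exists_coeff (s j)
  refine ⟨A, ?_, hA⟩
  -- A one-sided inverse suffices for square matrices over a commutative ring.
  have : (Matrix.of B) * (Matrix.of A) = 1 := by
    ext1 j l
    have h1 : ∑ l, (Matrix.vecMul (B j) (Matrix.of A)) l • s l =
        ∑ l, (1 : Matrix ι ι Γ(X, N)) j l • s l := by
      rw [← sum_smul_sum_smul]
      simp [Matrix.one_apply, hA, hB, ite_smul]
    exact congrFun (hs.coeff_unique h1) l
  exact ⟨⟨Matrix.of A, Matrix.of B, mul_eq_one_comm.1 this, this⟩, rfl⟩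

/-- The ring of functions on the empty set is zero. This covers points of `W` outside the image of
`U'`, where there is nothing to choose for the bundle on `U'`. -/
theorem isBasisOn_of_eq_bot (hN : N = ⊥) (s : ι → Γ(M, N)) : IsBasisOn M s := by
  intro N' h
  obtain rfl : N' = ⊥ := le_bot_iff.1 (h.trans hN.le)
  have : Subsingleton Γ(M, ⊥) := Module.subsingleton Γ(X, ⊥) _
  exact ⟨fun _ _ _ => Subsingleton.elim _ _, fun x => ⟨0, Subsingleton.elim _ _⟩⟩

end MatrixBasis

/-- A function is a unit exactly where its basic open set is everything, and a surjection detects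
this. In particular a lift of a unit along a surjective closed immersion is a unit. -/
theorem isUnit_of_surjective {X Y : Scheme.{u}} (f : X ⟶ Y) [Surjective f] {N : Y.Opens}
    {V : X.Opens} (hV : V = f ⁻¹ᵁ N) (x : Γ(Y, N)) (hx : IsUnit (pullFun f hV.le x)) :
    IsUnit x := by
  subst hV
  have h1 : IsUnit (f.app N x) := by
    have : pullFun f (le_refl (f ⁻¹ᵁ N)) x = f.app N x := funRes_self _ _
    rwa [← this]
  have h2 : Y.basicOpen x = N := by
    refine le_antisymm (Y.basicOpen_le x) fun y hy => ?_
    obtain ⟨z, rfl⟩ := f.surjective y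
    have h3 := X.basicOpen_of_isUnit h1
    rw [← Scheme.preimage_basicOpen] at h3
    have : z ∈ f ⁻¹ᵁ Y.basicOpen x := h3 ▸ hy
    exact this
  have h3 := Y.toRingedSpace.isUnit_res_basicOpen x
  have h4 : IsUnit (funRes Y (Y.basicOpen_le x) x) := h3
  have h5 := h4.map (funRes Y h2.ge)
  simpa using h5

/-! ### Patching bundles -/

namespace PatchSquare

variable {U U' V W : Scheme.{u}} {i : U ⟶ U'} {g : U ⟶ V} {g' : U' ⟶ W} {i' : V ⟶ W} {h : U ⟶ W}
  {ι : Type u} [Fintype ι] (sq : PatchSquare i g g' i' h)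
include sq

theorem preimage_eq (N : W.Opens) : h ⁻¹ᵁ N = i ⁻¹ᵁ g' ⁻¹ᵁ N := by
  rw [← sq.comm₁]; rfl

theorem exists_preimage_le_i' (N : V.Opens) : ∃ N' : W.Opens, i' ⁻¹ᵁ N' = N := by
  have := sq.isClosedImmersion_i'
  obtain ⟨t, ht, h⟩ := i'.isClosedEmbedding.isInducing.isOpen_iff.1 N.isOpen
  exact ⟨⟨t, ht⟩, TopologicalSpace.Opens.ext h⟩

/-- The topology of `U'` is induced from `W`, which requires only the topological closed embedding
and not that `g'` be a closed immersion. -/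
theorem exists_preimage_le_g' (N : U'.Opens) : ∃ N' : W.Opens, g' ⁻¹ᵁ N' = N := by
  obtain ⟨t, ht, h⟩ := sq.isClosedEmbedding.isInducing.isOpen_iff.1 N.isOpen
  exact ⟨⟨t, ht⟩, TopologicalSpace.Opens.ext h⟩

/-- The preimage of `N` in `U'` is affine because `g'` is, and a closed immersion is surjective on
functions over affine opens. -/
theorem pullFun_surjective {N : W.Opens} (hN : IsAffineOpen N) :
    Function.Surjective (pullFun i (preimage_le_preimage_of_comp sq.comm₁ N)) := by
  have := sq.isClosedImmersion_i
  have := sq.isAffineHom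
  intro y
  obtain ⟨x, hx⟩ := i.app_surjective (g' ⁻¹ᵁ N) (hN.preimage g') (funRes U (sq.preimage_eq N).ge y)
  refine ⟨x, ?_⟩
  have h1 : pullFun i (preimage_le_preimage_of_comp sq.comm₁ N) x =
    funRes U (sq.preimage_eq N).le (i.app _ x) := rfl
  rw [h1, hx]
  simp

/-- Locally, bundles with isomorphic restrictions have compatible bases. -/
theorem exists_compatible_bases {P : U'.Modules} {Q : V.Modules} (hP : LocallyHasBasis ι P)
    (hQ : LocallyHasBasis ι Q) (θ : pull i P ≅ pull g Q) (y : W) :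
    ∃ (N : W.Opens) (s' : ι → Γ(P, g' ⁻¹ᵁ N)) (s : ι → Γ(Q, i' ⁻¹ᵁ N)), y ∈ N ∧
      IsBasisOn P s' ∧ IsBasisOn Q s ∧ ∀ j, θ.hom.app (h ⁻¹ᵁ N)
        (pullSec i P (preimage_le_preimage_of_comp sq.comm₁ N) (s' j)) =
        pullSec g Q (preimage_le_preimage_of_comp sq.comm₂ N) (s j) := by
  classical
  have := sq.surjective_i'
  have := sq.surjective_i
  obtain ⟨v, rfl⟩ := i'.surjective y
  obtain ⟨N₀, s, hv, hs⟩ := hQ v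
  obtain ⟨N₁, rfl⟩ := sq.exists_preimage_le_i' N₀
  -- The image of `g'` is closed; a point outside it has a neighbourhood on which only `Q` matters.
  by_cases hx : i' v ∈ Set.range g'
  · obtain ⟨x, hx⟩ := hx
    obtain ⟨N₀, e, hxe, he⟩ := hP x
    obtain ⟨N₂, rfl⟩ := sq.exists_preimage_le_g' N₀
    have h2 : i' v ∈ N₂ := hx ▸ hxe
    obtain ⟨N, hN, hvN, hNN⟩ := TopologicalSpace.Opens.isBasis_iff_nbhd.1 W.isBasis_affineOpens
      (show i' v ∈ N₁ ⊓ N₂ from ⟨hv, h2⟩)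
    have hN₁ : N ≤ N₁ := hNN.trans inf_le_left
    have hN₂ : N ≤ N₂ := hNN.trans inf_le_right
    have he' := he.res (g'.preimage_mono hN₂)
    have hs' := hs.res (i'.preimage_mono hN₁)
    have hk := (isBasisOn_iso_iff θ).2 (he'.pullSec i (preimage_le_preimage_of_comp sq.comm₁ N))
    have ht := hs'.pullSec g (preimage_le_preimage_of_comp sq.comm₂ N)
    -- The basis of `P` is the one to correct: functions lift along the closed immersion `i`, but
    -- need not lift along `g`.
    obtain ⟨A, hA, hAt⟩ := hk.exists_matrix ht
    choose A' hA' using fun j l => sq.pullFun_surjective hN (A j l)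
    have hAA' : (pullFun i (preimage_le_preimage_of_comp sq.comm₁ N)).mapMatrix (Matrix.of A') =
        A := by
      ext1 j l; exact hA' j l
    -- The determinant of the lift restricts to the unit `det A`, and `i` is surjective.
    have hunit : IsUnit (Matrix.of A') := by
      rw [Matrix.isUnit_iff_isUnit_det] at hA ⊢
      refine isUnit_of_surjective i (sq.preimage_eq N) _ ?_
      rw [RingHom.map_det, hAA']
      exact hA
    refine ⟨N, _, _, hvN, he'.matrix hunit, hs', fun j => ?_⟩
    rw [pullSec_sum_smul, app_sum_smul, ← hAt]
    refine Finset.sum_congr rfl fun l _ => ?_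
    congr 1
    exact hA' j l
  · let R : W.Opens := ⟨(Set.range g')ᶜ, sq.isClosedEmbedding.isClosed_range.isOpen_compl⟩
    have hbot : g' ⁻¹ᵁ (N₁ ⊓ R) = ⊥ := by
      refine le_bot_iff.1 fun z hz => ?_
      exact hz.2 ⟨z, rfl⟩
    have hbot' : h ⁻¹ᵁ (N₁ ⊓ R) = ⊥ := by
      rw [sq.preimage_eq, hbot]; rfl
    have : Subsingleton Γ(pull g Q, h ⁻¹ᵁ (N₁ ⊓ R)) := by
      rw [hbot']; exact Module.subsingleton Γ(U, ⊥) _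
    exact ⟨N₁ ⊓ R, 0, _, ⟨hv, hx⟩, isBasisOn_of_eq_bot hbot _,
      hs.res (i'.preimage_mono inf_le_left), fun j => Subsingleton.elim _ _⟩

/-- Vector bundles can be patched. -/
theorem exists_glue {P : U'.Modules} {Q : V.Modules} (hP : LocallyHasBasis ι P)
    (hQ : LocallyHasBasis ι Q) (θ : pull i P ≅ pull g Q) :
    ∃ (E : W.Modules) (_ : LocallyHasBasis ι E) (e' : pull g' E ≅ P) (e : pull i' E ≅ Q),
      (pullComp i g' h sq.comm₁ E).symm ≪≫ (Scheme.Modules.pullback i).mapIso e' ≪≫ θ =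
        (pullComp g i' h sq.comm₂ E).symm ≪≫ (Scheme.Modules.pullback g).mapIso e := by
  -- The glued sheaf is the fibre product of the direct images of `P` and `Q` over the direct image
  -- of `pull g Q`.
  let c := pushMap sq.comm₁ θ.hom
  let d := pushMap sq.comm₂ (𝟙 (pull g Q))
  let a : pullback c d ⟶ _ := pullback.fst c d
  let b : pullback c d ⟶ _ := pullback.snd c d
  have hp : IsPullback a b c d := IsPullback.of_hasPullback _ _
  have hw := (comp_eq_comp_iff sq).1 hp.w
  have hbasis (y : W) : ∃ (N : W.Opens) (m : ι → Γ(pullback c d, N)), y ∈ N ∧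
      IsBasisOn (pullback c d) m ∧ IsBasisOn P (fun j => pushSec a N (m j)) ∧
      IsBasisOn Q (fun j => pushSec b N (m j)) := by
    obtain ⟨N, s', s, hy, hs', hs, hθ⟩ := sq.exists_compatible_bases hP hQ θ y
    choose m hm _ using fun j => isPatched_of_isPullback sq hp N (s' j) (s j) (hθ j)
    have ha : IsBasisOn P (fun j => pushSec a N (m j)) := by
      simpa only [(hm _).1] using hs'
    have hb : IsBasisOn Q (fun j => pushSec b N (m j)) := by
      simpa only [(hm _).2] using hs
    refine ⟨N, m, hy, isBasisOn_of_isPatched sq ha hb ?_ hp.w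
      fun N' _ => isPatched_of_isPullback sq hp N', ha, hb⟩
    simpa only [(hm _).1, hθ] using hs.pullSec g (preimage_le_preimage_of_comp sq.comm₂ N)
  -- The adjoint of a projection carries a local basis of the fibre product, pulled back, to the
  -- basis it was built from.
  have ha : IsIso (pullLift a) := by
    refine isIso_of_isBasisOn (ι := ι) _ fun x => ?_
    obtain ⟨N, m, hy, hm, h1, h2⟩ := hbasis (g' x)
    refine ⟨g' ⁻¹ᵁ N, _, hy, hm.pullSec g' le_rfl, ?_⟩
    simpa only [pullLift_pullSec', secRes_self] using h1
  have hb : IsIso (pullLift b) := by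
    refine isIso_of_isBasisOn (ι := ι) _ fun x => ?_
    obtain ⟨N, m, hy, hm, h1, h2⟩ := hbasis (i' x)
    refine ⟨i' ⁻¹ᵁ N, _, hy, hm.pullSec i' le_rfl, ?_⟩
    simpa only [pullLift_pullSec', secRes_self] using h2
  refine ⟨pullback c d, fun y => ?_, asIso (pullLift a), asIso (pullLift b), ?_⟩
  · obtain ⟨N, m, hy, hm, -⟩ := hbasis y
    exact ⟨N, m, hy, hm⟩
  · ext1
    refine pull_hom_ext fun N m => ?_
    change θ.hom.app (h ⁻¹ᵁ N) (((Scheme.Modules.pullback i).map (pullLift a)).app (h ⁻¹ᵁ N)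
      ((pullComp i g' h sq.comm₁ (pullback c d)).inv.app (h ⁻¹ᵁ N) (pullSec h _ le_rfl m))) =
      ((Scheme.Modules.pullback g).map (pullLift b)).app (h ⁻¹ᵁ N)
      ((pullComp g i' h sq.comm₂ (pullback c d)).inv.app (h ⁻¹ᵁ N) (pullSec h _ le_rfl m))
    rw [pullComp_inv_pullSec i g' h sq.comm₁ _ (le_refl (g' ⁻¹ᵁ N))
      (preimage_le_preimage_of_comp sq.comm₁ N),
      pullComp_inv_pullSec g i' h sq.comm₂ _ (le_refl (i' ⁻¹ᵁ N))
      (preimage_le_preimage_of_comp sq.comm₂ N), map_pullSec, map_pullSec, pullLift_pullSec',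
      pullLift_pullSec', secRes_self, secRes_self]
    exact hw N m

end PatchSquare

/-! ### Flat base change of fibre products of rings -/

section FlatBaseChange

open TensorProduct

/-- Fibre products of rings are preserved by flat base change. -/
theorem existsUnique_of_isPushout {R R₁ R₂ R₃ C D₁ D₂ D₃ : CommRingCat.{u}}
    {a₁ : R ⟶ R₁} {a₂ : R ⟶ R₂} {a₃ : R ⟶ R₃} {f₁ : R₁ ⟶ R₃} {f₂ : R₂ ⟶ R₃}
    (h₁ : a₁ ≫ f₁ = a₃) (h₂ : a₂ ≫ f₂ = a₃)
    (H : ∀ x y, f₁ x = f₂ y → ∃! r, a₁ r = x ∧ a₂ r = y)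
    {s : R ⟶ C} (hs : s.hom.Flat) {c₁ : C ⟶ D₁} {c₂ : C ⟶ D₂} {c₃ : C ⟶ D₃}
    {d₁ : R₁ ⟶ D₁} {d₂ : R₂ ⟶ D₂} {d₃ : R₃ ⟶ D₃} (P₁ : IsPushout s a₁ c₁ d₁)
    (P₂ : IsPushout s a₂ c₂ d₂) (P₃ : IsPushout s a₃ c₃ d₃)
    {φ₁ : D₁ ⟶ D₃} {φ₂ : D₂ ⟶ D₃} (hc₁ : c₁ ≫ φ₁ = c₃) (hc₂ : c₂ ≫ φ₂ = c₃)
    (hd₁ : d₁ ≫ φ₁ = f₁ ≫ d₃) (hd₂ : d₂ ≫ φ₂ = f₂ ≫ d₃) (x : D₁) (y : D₂)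
    (hxy : φ₁ x = φ₂ y) : ∃! z, c₁ z = x ∧ c₂ z = y := by
  algebraize [s.hom, a₁.hom, a₂.hom, a₃.hom, c₁.hom, c₂.hom, c₃.hom, d₁.hom, d₂.hom, d₃.hom,
    f₁.hom, f₂.hom, φ₁.hom, φ₂.hom, c₁.hom.comp s.hom, c₂.hom.comp s.hom, c₃.hom.comp s.hom]
  have t₁ : IsScalarTower R R₁ D₁ := .of_algebraMap_eq fun r => congr($P₁.w r)
  have t₂ : IsScalarTower R R₂ D₂ := .of_algebraMap_eq fun r => congr($P₂.w r)
  have t₃ : IsScalarTower R R₃ D₃ := .of_algebraMap_eq fun r => congr($P₃.w r)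
  have p₁ : Algebra.IsPushout R C R₁ D₁ := CommRingCat.isPushout_iff_isPushout.mp P₁
  have p₂ : Algebra.IsPushout R C R₂ D₂ := CommRingCat.isPushout_iff_isPushout.mp P₂
  have p₃ : Algebra.IsPushout R C R₃ D₃ := CommRingCat.isPushout_iff_isPushout.mp P₃
  let e₁ := Algebra.IsPushout.equiv R C R₁ D₁
  let e₂ := Algebra.IsPushout.equiv R C R₂ D₂
  let e₃ := Algebra.IsPushout.equiv R C R₃ D₃
  let F₁ : R₁ →ₗ[R] R₃ :=
    (⟨f₁.hom, fun r => congr($h₁ r)⟩ : R₁ →ₐ[R] R₃).toLinearMap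
  let F₂ : R₂ →ₗ[R] R₃ :=
    (⟨f₂.hom, fun r => congr($h₂ r)⟩ : R₂ →ₐ[R] R₃).toLinearMap
  -- The fibre product is encoded as the exact sequence `0 → R → R₁ × R₂ → R₃`, which tensoring with
  -- the flat `C` preserves.
  let α : R →ₗ[R] R₁ × R₂ := (Algebra.linearMap R R₁).prod (Algebra.linearMap R R₂)
  let β : R₁ × R₂ →ₗ[R] R₃ := F₁ ∘ₗ LinearMap.fst R R₁ R₂ - F₂ ∘ₗ LinearMap.snd R R₁ R₂
  have hα : Function.Injective α := by
    intro r r' hr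
    have hr₁ : a₁ r = a₁ r' := congrArg Prod.fst hr
    have hr₂ : a₂ r = a₂ r' := congrArg Prod.snd hr
    refine (H (a₁ r') (a₂ r') ?_).unique ⟨hr₁, hr₂⟩ ⟨rfl, rfl⟩
    exact congr($(h₁.trans h₂.symm) r')
  have hαβ : Function.Exact α β := by
    intro z
    constructor
    · intro hz
      obtain ⟨r, ⟨hr₁, hr₂⟩, -⟩ := H z.1 z.2 (sub_eq_zero.1 hz)
      exact ⟨r, Prod.ext hr₁ hr₂⟩
    · rintro ⟨r, rfl⟩
      exact sub_eq_zero.2 congr($(h₁.trans h₂.symm) r)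
  have hα' := Module.Flat.lTensor_preserves_injective_linearMap (M := C) α hα
  have hαβ' := Module.Flat.lTensor_exact C hαβ
  have k₁ (t : C ⊗[R] R₁) : e₃ (F₁.lTensor C t) = φ₁ (e₁ t) := by
    induction t with
    | zero => simp
    | tmul c r =>
      simp only [LinearMap.lTensor_tmul, e₁, e₃, Algebra.IsPushout.equiv_tmul, map_mul]
      congr 1
      · exact congr($hc₁ c).symm
      · exact congr($hd₁ r).symm
    | add t t' h h' => simp [h, h']
  have k₂ (t : C ⊗[R] R₂) : e₃ (F₂.lTensor C t) = φ₂ (e₂ t) := by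
    induction t with
    | zero => simp
    | tmul c r =>
      simp only [LinearMap.lTensor_tmul, e₂, e₃, Algebra.IsPushout.equiv_tmul, map_mul]
      congr 1
      · exact congr($hc₂ c).symm
      · exact congr($hd₂ r).symm
    | add t t' h h' => simp [h, h']
  let q₁ := (LinearMap.fst R R₁ R₂).lTensor C
  let q₂ := (LinearMap.snd R R₁ R₂).lTensor C
  have l₁ (c : C) : e₁ (q₁ (α.lTensor C (c ⊗ₜ 1))) = c₁ c := by
    simp [q₁, α, e₁, Algebra.IsPushout.equiv_tmul]
    rfl
  have l₂ (c : C) : e₂ (q₂ (α.lTensor C (c ⊗ₜ 1))) = c₂ c := by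
    simp [q₂, α, e₂, Algebra.IsPushout.equiv_tmul]
    rfl
  have hq (t t' : C ⊗[R] (R₁ × R₂)) (h : q₁ t = q₁ t') (h' : q₂ t = q₂ t') : t = t' := by
    apply (TensorProduct.prodRight R R C R₁ R₂).injective
    have key (t : C ⊗[R] (R₁ × R₂)) : TensorProduct.prodRight R R C R₁ R₂ t = (q₁ t, q₂ t) := by
      induction t with
      | zero => rw [map_zero, map_zero, map_zero]; rfl
      | tmul c r => simp [q₁, q₂]
      | add t t' h h' => rw [map_add, map_add, map_add, h, h']; rfl
    rw [key, key, h, h']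
  -- This is the pair `(x, y)` under the isomorphism of `C ⊗ (R₁ × R₂)` with the product of the
  -- tensor products.
  let t : C ⊗[R] (R₁ × R₂) := (LinearMap.inl R R₁ R₂).lTensor C (e₁.symm x) +
    (LinearMap.inr R R₁ R₂).lTensor C (e₂.symm y)
  have ht₁ : q₁ t = e₁.symm x := by
    simp only [q₁, t, map_add, ← LinearMap.comp_apply, ← LinearMap.lTensor_comp,
      LinearMap.fst_comp_inl, LinearMap.fst_comp_inr]
    simp
  have ht₂ : q₂ t = e₂.symm y := by
    simp only [q₂, t, map_add, ← LinearMap.comp_apply, ← LinearMap.lTensor_comp,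
      LinearMap.snd_comp_inl, LinearMap.snd_comp_inr]
    simp
  have hβt : β.lTensor C t = 0 := by
    apply e₃.injective
    rw [map_zero]
    simp only [β, LinearMap.lTensor_sub, LinearMap.lTensor_comp, LinearMap.sub_apply,
      LinearMap.comp_apply, map_sub]
    change e₃ (F₁.lTensor C (q₁ t)) - e₃ (F₂.lTensor C (q₂ t)) = 0
    rw [k₁, k₂, ht₁, ht₂]
    simp [hxy]
  obtain ⟨c', hc'⟩ := (hαβ' t).1 hβt
  obtain ⟨c, rfl⟩ : ∃ c : C, c' = c ⊗ₜ 1 :=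
    ⟨TensorProduct.rid R C c', by
      rw [← TensorProduct.rid_symm_apply, LinearEquiv.symm_apply_apply]⟩
  refine ⟨c, ⟨?_, ?_⟩, fun z hz => ?_⟩
  · rw [← l₁, hc', ht₁]; simp
  · rw [← l₂, hc', ht₂]; simp
  · have h1 : α.lTensor C (z ⊗ₜ 1) = α.lTensor C (c ⊗ₜ 1) := by
      apply hq
      · apply e₁.injective
        rw [l₁, l₁, hz.1, ← l₁, hc', ht₁]; simp
      · apply e₂.injective
        rw [l₂, l₂, hz.2, ← l₂, hc', ht₂]; simp
    have h2 := congrArg (TensorProduct.rid R C) (hα' h1)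
    simpa using h2

end FlatBaseChange

/-! ### Nilpotent thickenings, and squares obtained by flat base change -/

section Topology

/-- The image is the zero locus of the kernel, and nilpotent elements lie in every prime. -/
theorem surjective_specMap {R S : CommRingCat.{u}} (φ : R ⟶ S) (hφ : Function.Surjective φ)
    (hn : ∀ x, φ x = 0 → IsNilpotent x) : Surjective (Spec.map φ) := by
  refine ⟨Set.range_eq_univ.1 ?_⟩
  refine (range_comap_of_surjective _ φ.hom hφ).trans ?_
  refine Set.eq_univ_of_forall fun P x hx => ?_
  exact P.isPrime.mem_of_pow_mem _ ((hn x hx).choose_spec ▸ P.asIdeal.zero_mem)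

/-- Points and closed subsets of `Y` are images of their counterparts in `X`, so injectivity and
closedness pass from `s ≫ g` to `g`. -/
theorem isClosedEmbedding_of_comp {X Y Z : Scheme.{u}} (s : X ⟶ Y) (g : Y ⟶ Z) [Surjective s]
    [IsClosedImmersion (s ≫ g)] : Topology.IsClosedEmbedding g := by
  have ht := (s ≫ g).isClosedEmbedding
  refine .of_continuous_injective_isClosedMap g.continuous ?_ fun Z hZ => ?_
  · intro x y hxy
    obtain ⟨x, rfl⟩ := s.surjective x
    obtain ⟨y, rfl⟩ := s.surjective y
    rw [ht.injective (a₁ := x) (a₂ := y) (by simpa using hxy)]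
  · have : g '' Z = (s ≫ g) '' (s ⁻¹' Z) := by
      ext z
      constructor
      · rintro ⟨y, hy, rfl⟩
        obtain ⟨x, rfl⟩ := s.surjective y
        exact ⟨x, hy, by simp⟩
      · rintro ⟨x, hx, rfl⟩
        exact ⟨s x, hx, by simp⟩
    rw [this]
    exact ht.isClosedMap _ (hZ.preimage s.continuous)

end Topology

theorem appLE_comp_appLE_eq {X Y Z Y' : Scheme.{u}} {a : X ⟶ Y} {b : Y ⟶ Z} {a' : X ⟶ Y'}
    {b' : Y' ⟶ Z} (e : a ≫ b = a' ≫ b') {U : Z.Opens} {V : Y.Opens} {V' : Y'.Opens} {W : X.Opens}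
    (h₁ : V ≤ b ⁻¹ᵁ U) (h₂ : W ≤ a ⁻¹ᵁ V) (h₁' : V' ≤ b' ⁻¹ᵁ U) (h₂' : W ≤ a' ⁻¹ᵁ V') :
    b.appLE U V h₁ ≫ a.appLE V W h₂ = b'.appLE U V' h₁' ≫ a'.appLE V' W h₂' := by
  simp only [Scheme.Hom.appLE_comp_appLE, e]

theorem appLE_comp_appLE_of_eq {X Y Z : Scheme.{u}} {a : X ⟶ Y} {b : Y ⟶ Z} {c : X ⟶ Z}
    (e : a ≫ b = c) {U : Z.Opens} {V : Y.Opens} {W : X.Opens} (h₁ : V ≤ b ⁻¹ᵁ U)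
    (h₂ : W ≤ a ⁻¹ᵁ V) (h₃ : W ≤ c ⁻¹ᵁ U) :
    b.appLE U V h₁ ≫ a.appLE V W h₂ = c.appLE U W h₃ := by
  simp only [Scheme.Hom.appLE_comp_appLE, e]

/-- All properties of the square come from the rings by base change along `w`; flatness of `w` is
what carries over the gluing of functions. The auxiliary ring `R₀` controls the topology of `g'`, as
`a₁` itself need not be surjective. -/
theorem PatchSquare.of_isPullback {U U' V W : Scheme.{u}} {i : U ⟶ U'} {g : U ⟶ V} {g' : U' ⟶ W}
    {i' : V ⟶ W} {h : U ⟶ W} {R R₀ R₁ R₂ R₃ : CommRingCat.{u}}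
    {a₁ : R ⟶ R₁} {a₂ : R ⟶ R₂} {a₃ : R ⟶ R₃} {f₁ : R₁ ⟶ R₃} {f₂ : R₂ ⟶ R₃} {e : R₁ ⟶ R₀}
    (h₁ : a₁ ≫ f₁ = a₃) (h₂ : a₂ ≫ f₂ = a₃)
    (H : ∀ x y, f₁ x = f₂ y → ∃! r, a₁ r = x ∧ a₂ r = y)
    (hf₁ : Function.Surjective f₁) (hf₁n : ∀ x, f₁ x = 0 → IsNilpotent x)
    (ha₂ : Function.Surjective a₂) (ha₂n : ∀ x, a₂ x = 0 → IsNilpotent x)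
    (he : Function.Surjective e) (hen : ∀ x, e x = 0 → IsNilpotent x)
    (hae : Function.Surjective (a₁ ≫ e))
    {w : W ⟶ Spec R} [Flat w] {u' : U' ⟶ Spec R₁} {v : V ⟶ Spec R₂} {u : U ⟶ Spec R₃}
    (hg' : IsPullback g' u' w (Spec.map a₁)) (hi' : IsPullback i' v w (Spec.map a₂))
    (hh : IsPullback h u w (Spec.map a₃)) (c₁ : i ≫ g' = h) (c₂ : g ≫ i' = h)
    (d₁ : i ≫ u' = u ≫ Spec.map f₁) (d₂ : g ≫ v = u ≫ Spec.map f₂) :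
    PatchSquare i g g' i' h := by
  have hi : IsPullback i u u' (Spec.map f₁) := by
    refine IsPullback.of_right ?_ d₁ hg'
    rw [c₁, ← Spec.map_comp, h₁]
    exact hh
  have := surjective_specMap f₁ hf₁ hf₁n
  have := surjective_specMap a₂ ha₂ ha₂n
  have := surjective_specMap e he hen
  have : IsClosedImmersion (Spec.map f₁) := IsClosedImmersion.spec_of_surjective _ hf₁
  have : IsClosedImmersion (Spec.map a₂) := IsClosedImmersion.spec_of_surjective _ ha₂
  have : IsClosedImmersion (Spec.map (a₁ ≫ e)) := IsClosedImmersion.spec_of_surjective _ hae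
  refine ⟨c₁, c₂, MorphismProperty.of_isPullback (P := @IsClosedImmersion) hi.flip inferInstance,
    MorphismProperty.of_isPullback (P := @Surjective) hi.flip inferInstance,
    MorphismProperty.of_isPullback (P := @IsClosedImmersion) hi'.flip inferInstance,
    MorphismProperty.of_isPullback (P := @Surjective) hi'.flip inferInstance,
    MorphismProperty.of_isPullback (P := @IsAffineHom) hg'.flip inferInstance, ?_, ?_⟩
  · have h0 : IsPullback (pullback.fst w (Spec.map (a₁ ≫ e))) (pullback.snd w (Spec.map (a₁ ≫ e))) w
        (Spec.map e ≫ Spec.map a₁) := by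
      rw [← Spec.map_comp]
      exact IsPullback.of_hasPullback _ _
    have h0' := IsPullback.of_right' h0 hg'
    set s := hg'.lift _ _ _ with hs
    have : Surjective s := MorphismProperty.of_isPullback (P := @Surjective) h0'.flip inferInstance
    have hsg : s ≫ g' = pullback.fst w (Spec.map (a₁ ≫ e)) := hg'.lift_fst _ _ _
    have : IsClosedImmersion (s ≫ g') := by
      rw [hsg]
      infer_instance
    exact isClosedEmbedding_of_comp s g'
  · intro N hN x y hxy
    have H' (x : Γ(Spec R₁, ⊤)) (y : Γ(Spec R₂, ⊤)) (hxy : (Spec.map f₁).appLE ⊤ ⊤ le_top x =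
        (Spec.map f₂).appLE ⊤ ⊤ le_top y) : ∃! r, (Spec.map a₁).appLE ⊤ ⊤ le_top r = x ∧
        (Spec.map a₂).appLE ⊤ ⊤ le_top r = y := by
      have nat {P Q : CommRingCat.{u}} (c : P ⟶ Q) (z) : (Scheme.ΓSpecIso Q).hom
          ((Spec.map c).appLE ⊤ ⊤ le_top z) = c ((Scheme.ΓSpecIso P).hom z) := by
        have h : (Spec.map c).appLE ⊤ ⊤ le_top = (Spec.map c).appTop :=
          (Spec.map c).appLE_eq_app
        rw [h]
        exact congr($(Scheme.ΓSpecIso_naturality c) z)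
      have inj {P : CommRingCat.{u}} : Function.Injective (Scheme.ΓSpecIso P).hom :=
        ((Scheme.ΓSpecIso P).commRingCatIsoToRingEquiv).injective
      obtain ⟨r, ⟨hr₁, hr₂⟩, hr⟩ := H ((Scheme.ΓSpecIso R₁).hom x) ((Scheme.ΓSpecIso R₂).hom y)
        (by rw [← nat, ← nat, hxy])
      have hr0 : (Scheme.ΓSpecIso R).hom ((Scheme.ΓSpecIso R).inv r) = r := by simp
      refine ⟨(Scheme.ΓSpecIso R).inv r, ⟨inj ?_, inj ?_⟩, fun z hz => inj ?_⟩
      · rw [nat, hr0, hr₁]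
      · rw [nat, hr0, hr₂]
      · rw [hr0]
        exact hr _ ⟨by rw [← nat, hz.1], by rw [← nat, hz.2]⟩
    -- Over an affine open, functions on a base change along affine schemes form a pushout of rings.
    have push {Z : Scheme.{u}} {P : CommRingCat.{u}} {m : Z ⟶ W} {z : Z ⟶ Spec P} {a : R ⟶ P}
        (hm : IsPullback m z w (Spec.map a)) : IsPushout (w.appLE ⊤ N le_top)
          ((Spec.map a).appLE ⊤ ⊤ le_top) (m.appLE N (m ⁻¹ᵁ N) le_rfl)
          (z.appLE ⊤ (m ⁻¹ᵁ N) le_top) :=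
      (isIso_pushoutSection_iff hm le_top le_top (by simp)).1
        (isIso_pushoutSection_of_isAffineOpen hm le_top le_top (by simp)
          (isAffineOpen_top _) (isAffineOpen_top _) hN)
    refine existsUnique_of_isPushout ?_ ?_ H' ?_ (push hg') (push hi') (push hh) ?_ ?_ ?_ ?_ x y hxy
    · exact appLE_comp_appLE_of_eq (by rw [← Spec.map_comp, h₁]) _ _ _
    · exact appLE_comp_appLE_of_eq (by rw [← Spec.map_comp, h₂]) _ _ _
    · exact w.flat_appLE (isAffineOpen_top _) hN le_top
    · exact appLE_comp_appLE_of_eq c₁ _ _ _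
    · exact appLE_comp_appLE_of_eq c₂ _ _ _
    · exact appLE_comp_appLE_eq d₁ _ _ _ _
    · exact appLE_comp_appLE_eq d₂ _ _ _ _

/-! ### The patching squares over the fibre product of rings -/

section Concrete

variable {k : Type u} [Field k] {X : Scheme.{u}} (f : X ⟶ Spec (CommRingCat.of k))

/-- Every morphism to the spectrum of a field is flat, and flatness is stable under base change. -/
theorem flat_proj (T : Over (Spec (CommRingCat.of k))) : Flat (proj f T) := by
  have : Flat f := inferInstance
  infer_instance

theorem isPullback_morphismRestrict_baseMap {X S : Scheme.{u}} (f : X ⟶ S) {T' T : Over S}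
    (α : T' ⟶ T) (W : (XT f T).Opens) :
    IsPullback (baseMap f α ∣_ W) ((baseMap f α ⁻¹ᵁ W).ι ≫ proj f T') (W.ι ≫ proj f T) α.left :=
  (isPullback_morphismRestrict (baseMap f α) W).paste_vert (isPullback_baseMap α)

/-- The restriction of `X_{T₀} ⟶ X_{T₁}` to the preimages of an open subset of `X_T`. -/
def restrictMap {X S : Scheme.{u}} (f : X ⟶ S) {T₀ T₁ T : Over S} {α : T₀ ⟶ T₁} {β : T₁ ⟶ T}
    {γ : T₀ ⟶ T} (h : α ≫ β = γ) (W : (XT f T).Opens) :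
    (baseMap f γ ⁻¹ᵁ W).toScheme ⟶ (baseMap f β ⁻¹ᵁ W).toScheme :=
  (XT f T₀).homOfLE (preimage_le_of_comp_eq (by rw [← h, baseMap_comp]) W) ≫
    baseMap f α ∣_ (baseMap f β ⁻¹ᵁ W)

theorem restrictMap_ι {X S : Scheme.{u}} (f : X ⟶ S) {T₀ T₁ T : Over S} {α : T₀ ⟶ T₁} {β : T₁ ⟶ T}
    {γ : T₀ ⟶ T} (h : α ≫ β = γ) (W : (XT f T).Opens) :
    restrictMap f h W ≫ (baseMap f β ⁻¹ᵁ W).ι = (baseMap f γ ⁻¹ᵁ W).ι ≫ baseMap f α :=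
  homOfLE_morphismRestrict_ι _ _

theorem restrictMap_comp {X S : Scheme.{u}} (f : X ⟶ S) {T₀ T₁ T : Over S} {α : T₀ ⟶ T₁}
    {β : T₁ ⟶ T} {γ : T₀ ⟶ T} (h : α ≫ β = γ) (W : (XT f T).Opens) :
    restrictMap f h W ≫ baseMap f β ∣_ W = baseMap f γ ∣_ W := by
  rw [← cancel_mono W.ι]
  simp [reassoc_of% (restrictMap_ι f h W), ← h, baseMap_comp]

variable {A₀ A A' B : Type u} [CommRing A₀] [Algebra k A₀] [CommRing A] [Algebra k A]
    [CommRing A'] [Algebra k A'] [CommRing B] [Algebra k B]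
    {π : A →ₐ[k] A₀} (hπ : Function.Surjective π)
    {p : A' →ₐ[k] A} (hp : Function.Surjective p) (hp_nil : IsNilpotent (RingHom.ker (π.comp p)))
    {q : B →ₐ[k] A} (hq : Function.Surjective (π.comp q))

theorem isNilpotent_of_mem_ideal {R : Type*} [CommRing R] {I : Ideal R} (hI : IsNilpotent I) {x : R}
    (hx : x ∈ I) : IsNilpotent x := by
  obtain ⟨n, hn⟩ := hI
  refine ⟨n, ?_⟩
  have := Ideal.pow_mem_pow hx n
  rwa [hn] at this

-- The ring-theoretic input is elementary. Elements of `B` and of `A₀` lift to the fibre product by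
-- choosing a preimage under `p` of the element of `A` coming from `B`. The kernel of the projection
-- to `B` consists of pairs `(x, 0)` with `p x = 0`, and such `x` are nilpotent.
include hπ hp hp_nil hq in
theorem patchSquare (W : (XT f (SpecOver k (FiberProduct p q))).Opens) :
    PatchSquare
      (restrictMap f (SpecOver.map_comp (FiberProduct.fst p q) p (FiberProduct.toBase p q) rfl) W)
      (restrictMap f (SpecOver.map_comp (FiberProduct.snd p q) q (FiberProduct.toBase p q)
        (FiberProduct.condition p q).symm) W)
      (baseMap f (SpecOver.map (FiberProduct.fst p q)) ∣_ W)
      (baseMap f (SpecOver.map (FiberProduct.snd p q)) ∣_ W)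
      (baseMap f (SpecOver.map (FiberProduct.toBase p q)) ∣_ W) := by
  have := flat_proj f (SpecOver k (FiberProduct p q))
  have hn (x : A') (hx : p x = 0) : IsNilpotent x :=
    isNilpotent_of_mem_ideal hp_nil (RingHom.mem_ker.2 (by simp [hx]))
  refine PatchSquare.of_isPullback (R := .of (FiberProduct p q)) (R₀ := .of A₀) (R₁ := .of A')
    (R₂ := .of B) (R₃ := .of A) (a₁ := CommRingCat.ofHom (FiberProduct.fst p q).toRingHom)
    (a₂ := CommRingCat.ofHom (FiberProduct.snd p q).toRingHom)
    (a₃ := CommRingCat.ofHom (FiberProduct.toBase p q).toRingHom)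
    (f₁ := CommRingCat.ofHom p.toRingHom) (f₂ := CommRingCat.ofHom q.toRingHom)
    (e := CommRingCat.ofHom (π.comp p).toRingHom) rfl ?_ ?_ hp hn ?_ ?_ (hπ.comp hp) ?_ ?_
    (isPullback_morphismRestrict_baseMap f (SpecOver.map (FiberProduct.fst p q)) W)
    (isPullback_morphismRestrict_baseMap f (SpecOver.map (FiberProduct.snd p q)) W)
    (isPullback_morphismRestrict_baseMap f (SpecOver.map (FiberProduct.toBase p q)) W)
    (restrictMap_comp _ _ _) (restrictMap_comp _ _ _) ?_ ?_
  · ext x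
    exact x.2.symm
  · intro x y hxy
    exact ⟨⟨(x, y), hxy⟩, ⟨rfl, rfl⟩, fun z hz => Subtype.ext (Prod.ext hz.1 hz.2)⟩
  · intro b
    obtain ⟨x, hx⟩ := hp (q b)
    exact ⟨⟨(x, b), hx⟩, rfl⟩
  · rintro ⟨⟨x, y⟩, hxy⟩ (hy : y = 0)
    subst hy
    obtain ⟨n, hn⟩ := hn x (hxy.trans (map_zero q))
    -- A positive exponent is needed for the second coordinate, since `0 ^ 0 = 1`.
    refine ⟨n + 1, Subtype.ext (Prod.ext ?_ ?_)⟩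
    · change x ^ (n + 1) = 0
      rw [pow_succ, hn, zero_mul]
    · change (0 : B) ^ (n + 1) = 0
      simp
  · exact fun x hx => isNilpotent_of_mem_ideal hp_nil hx
  · intro a₀
    obtain ⟨b, hb⟩ := hq a₀
    obtain ⟨x, hx⟩ := hp (q b)
    refine ⟨⟨(x, b), hx⟩, ?_⟩
    change π (p x) = a₀
    rw [hx]
    exact hb
  · rw [← Category.assoc, restrictMap_ι, Category.assoc, Category.assoc]
    congr 1
    exact (isPullback_baseMap _).w
  · rw [← Category.assoc, restrictMap_ι, Category.assoc, Category.assoc]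
    congr 1
    exact (isPullback_baseMap _).w

end Concrete

/-! ### Codimension in fibres, and shrinking open subsets -/

section Codim

variable {X S : Scheme.{u}} {f : X ⟶ S}

/-- Surjectivity on stalks passes to residue fields, and homomorphisms of fields are injective. -/
theorem isIso_residueFieldMap {Y Z : Scheme.{u}} (g : Y ⟶ Z) [IsClosedImmersion g] (y : Y) :
    IsIso (g.residueFieldMap y) := by
  have : Function.Surjective (g.residueFieldMap y) := by
    intro t
    obtain ⟨s, rfl⟩ := Y.residue_surjective y t
    obtain ⟨s, rfl⟩ := g.stalkMap_surjective y s
    refine ⟨Z.residue (g y) s, ?_⟩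
    exact congr($(Scheme.residue_residueFieldMap g y) s)
  rw [ConcreteCategory.isIso_iff_bijective]
  exact ⟨(g.residueFieldMap y).hom.injective, this⟩

theorem coheight_le_of_isIso {Y Z : Scheme.{u}} (m : Y ⟶ Z) [IsIso m] (y : Y) :
    Order.coheight y ≤ Order.coheight (m y) := by
  have key := coheight_le_of_generalizingMap (inv m) (Flat.generalizingMap (inv m)) (m y)
  rwa [← Scheme.Hom.comp_apply, IsIso.hom_inv_id] at key

/-- Codimension in the fibre is preserved by closed immersions of the base. -/
theorem coheight_asFiber_le_of_isClosedImmersion {T' T : Over S} (α : T' ⟶ T)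
    [IsClosedImmersion α.left] (x : XT f T') :
    Order.coheight ((proj f T').asFiber x) ≤
      Order.coheight ((proj f T).asFiber (baseMap f α x)) := by
  have h := isPullback_fiberToSpecResidueField_of_isPullback (isPullback_baseMap (f := f) α)
    (proj f T' x)
  set m := pullback.map (proj f T') (T'.left.fromSpecResidueField (proj f T' x)) (proj f T)
    (T.left.fromSpecResidueField (α.left (proj f T' x))) (baseMap f α)
    (Spec.map (α.left.residueFieldMap (proj f T' x))) α.left
    (isPullback_baseMap (f := f) α).w.symm (by simp) with hm
  have := isIso_residueFieldMap α.left (proj f T' x)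
  -- The map of fibres is a base change of the map of residue fields.
  have : IsIso m := (MorphismProperty.isomorphisms.iff _).1
    (MorphismProperty.of_isPullback (P := .isomorphisms _) h.flip
      ((MorphismProperty.isomorphisms.iff _).2 inferInstance))
  have key := coheight_le_of_isIso m ((proj f T').asFiber x)
  refine key.trans_eq (coheight_asFiber (proj f T) (baseMap f α x) _ _ ?_).symm
  have hc : m ≫ (proj f T).fiberι (α.left (proj f T' x)) =
      (proj f T').fiberι (proj f T' x) ≫ baseMap f α := pullback.lift_fst _ _ _
  have h2 : (m ≫ (proj f T).fiberι (α.left (proj f T' x))) ((proj f T').asFiber x) =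
      ((proj f T').fiberι (proj f T' x) ≫ baseMap f α) ((proj f T').asFiber x) :=
    congrArg (fun t : (proj f T').fiber (proj f T' x) ⟶ XT f T => t ((proj f T').asFiber x)) hc
  refine h2.trans ?_
  rw [Scheme.Hom.comp_apply, Scheme.Hom.fiberι_asFiber]

/-- The complement of `N` is pulled back to $X_{T_0}$ and its image in $X_T$ is removed. The image
is closed, with codimensions unchanged, because $X_{T_0}\to X_T$ is a closed immersion. Since
$X_{T_0}\to X_{T_1}$ is surjective, every point outside `N` has been removed. Thus $T_1\to T$ itself
need not be a closed immersion. -/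
theorem exists_preimage_le {T₀ T₁ T : Over S} (α : T₀ ⟶ T₁) (β : T₁ ⟶ T)
    [Surjective α.left] [IsClosedImmersion (α ≫ β).left] {N : (XT f T₁).Opens}
    (hN : (N : Set (XT f T₁))ᶜ ∈ Phi f T₁) :
    ∃ W : (XT f T).Opens, (W : Set (XT f T))ᶜ ∈ Phi f T ∧ baseMap f β ⁻¹ᵁ W ≤ N := by
  have hs : Surjective (baseMap f α) :=
    MorphismProperty.of_isPullback (P := @Surjective) (isPullback_baseMap α).flip inferInstance
  have hc : IsClosedImmersion (baseMap f (α ≫ β)) :=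
    MorphismProperty.of_isPullback (P := @IsClosedImmersion) (isPullback_baseMap (α ≫ β)).flip
      inferInstance
  let Z : Set (XT f T) := baseMap f (α ≫ β) '' ((baseMap f α ⁻¹ᵁ N : (XT f T₀).Opens) : Set _)ᶜ
  have hZ : IsClosed Z := (baseMap f (α ≫ β)).isClosedEmbedding.isClosedMap _
    (baseMap f α ⁻¹ᵁ N).isOpen.isClosed_compl
  refine ⟨⟨Zᶜ, hZ.isOpen_compl⟩, ?_, fun y hy => ?_⟩
  · refine ⟨by simpa using hZ, fun z hz => ?_⟩
    obtain ⟨x, hx, rfl⟩ : z ∈ Z := by simpa using hz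
    exact ((preimage_compl_mem α hN).2 x hx).trans (coheight_asFiber_le_of_isClosedImmersion _ x)
  · by_contra hyN
    obtain ⟨x, rfl⟩ := (baseMap f α).surjective y
    refine hy ⟨x, hyN, ?_⟩
    rw [baseMap_comp]
    simp

end Codim

section Affine

variable {k : Type u} [Field k] {X : Scheme.{u}} {f : X ⟶ Spec (CommRingCat.of k)}

theorem exists_preimage_map_le {R R₁ R₀ : Type u} [CommRing R] [Algebra k R] [CommRing R₁]
    [Algebra k R₁] [CommRing R₀] [Algebra k R₀] (φ : R →ₐ[k] R₁) (ψ : R₁ →ₐ[k] R₀)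
    (hψ : Function.Surjective ψ) (hψn : ∀ x, ψ x = 0 → IsNilpotent x)
    (h : Function.Surjective (ψ.comp φ)) {N : (XT f (SpecOver k R₁)).Opens}
    (hN : (N : Set (XT f (SpecOver k R₁)))ᶜ ∈ Phi f (SpecOver k R₁)) :
    ∃ W : (XT f (SpecOver k R)).Opens, (W : Set (XT f (SpecOver k R)))ᶜ ∈ Phi f (SpecOver k R) ∧
      baseMap f (SpecOver.map φ) ⁻¹ᵁ W ≤ N := by
  have : Surjective (SpecOver.map ψ).left :=
    surjective_specMap (CommRingCat.ofHom ψ.toRingHom) hψ hψn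
  have : IsClosedImmersion (SpecOver.map ψ ≫ SpecOver.map φ).left := by
    rw [SpecOver.map_comp φ ψ _ rfl]
    exact IsClosedImmersion.spec_of_surjective (CommRingCat.ofHom (ψ.comp φ).toRingHom) h
  exact exists_preimage_le (SpecOver.map ψ) (SpecOver.map φ) hN

variable {A₀ A A' B : Type u} [CommRing A₀] [Algebra k A₀] [CommRing A] [Algebra k A]
    [CommRing A'] [Algebra k A'] [CommRing B] [Algebra k B]
    {π : A →ₐ[k] A₀} (hπ : Function.Surjective π) (hπ_nil : IsNilpotent (RingHom.ker π))
    {p : A' →ₐ[k] A} (hp : Function.Surjective p) (hp_nil : IsNilpotent (RingHom.ker (π.comp p)))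
    {q : B →ₐ[k] A} (hq : Function.Surjective (π.comp q))

-- Over `A'` and `A` the auxiliary closed subscheme is the one defined by `A₀`; `Phi` is stable
-- under finite unions, so the three solutions can be intersected.
include hπ hπ_nil hp hp_nil hq in
theorem exists_preimages_le {N₁ : (XT f (SpecOver k A')).Opens} {N₂ : (XT f (SpecOver k B)).Opens}
    {N₃ : (XT f (SpecOver k A)).Opens} (h₁ : (N₁ : Set (XT f (SpecOver k A')))ᶜ ∈ Phi f _)
    (h₂ : (N₂ : Set (XT f (SpecOver k B)))ᶜ ∈ Phi f _)
    (h₃ : (N₃ : Set (XT f (SpecOver k A)))ᶜ ∈ Phi f _) :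
    ∃ W : (XT f (SpecOver k (FiberProduct p q))).Opens,
      (W : Set (XT f (SpecOver k (FiberProduct p q))))ᶜ ∈ Phi f _ ∧
      baseMap f (SpecOver.map (FiberProduct.fst p q)) ⁻¹ᵁ W ≤ N₁ ∧
      baseMap f (SpecOver.map (FiberProduct.snd p q)) ⁻¹ᵁ W ≤ N₂ ∧
      baseMap f (SpecOver.map (FiberProduct.toBase p q)) ⁻¹ᵁ W ≤ N₃ := by
  have key : Function.Surjective (π.comp (FiberProduct.toBase p q)) := by
    intro a₀
    obtain ⟨b, hb⟩ := hq a₀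
    obtain ⟨x, hx⟩ := hp (q b)
    refine ⟨⟨(x, b), hx⟩, ?_⟩
    change π (p x) = a₀
    rw [hx]
    exact hb
  obtain ⟨W₁, hW₁, hW₁'⟩ := exists_preimage_map_le (FiberProduct.fst p q) (π.comp p) (hπ.comp hp)
    (fun x hx => isNilpotent_of_mem_ideal hp_nil hx) key h₁
  -- The projection to `B` is already surjective, so `B` is its own auxiliary ring.
  obtain ⟨W₂, hW₂, hW₂'⟩ := exists_preimage_map_le (FiberProduct.snd p q) (AlgHom.id k B)
    Function.surjective_id (fun x (hx : x = 0) => hx ▸ .zero) (fun b => by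
      obtain ⟨x, hx⟩ := hp (q b)
      exact ⟨⟨(x, b), hx⟩, rfl⟩) h₂
  obtain ⟨W₃, hW₃, hW₃'⟩ := exists_preimage_map_le (FiberProduct.toBase p q) π hπ
    (fun x hx => isNilpotent_of_mem_ideal hπ_nil hx) key h₃
  refine ⟨W₁ ⊓ (W₂ ⊓ W₃), inf_compl_mem hW₁ (inf_compl_mem hW₂ hW₃), ?_, ?_, ?_⟩
  · exact le_trans (Scheme.Hom.preimage_mono _ inf_le_left) hW₁'
  · exact le_trans (Scheme.Hom.preimage_mono _ (inf_le_right.trans inf_le_left)) hW₂'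
  · exact le_trans (Scheme.Hom.preimage_mono _ (inf_le_right.trans inf_le_right)) hW₃'

end Affine

/-! ### Iterated versus composite pullbacks of isomorphisms -/

section Expand

variable {W W' U₁ U₂ U₁' U₂' : Scheme.{u}} {t₁ : W ⟶ U₁} {t₂ : W ⟶ U₂}
  {E₁ : U₁.Modules} {E₂ : U₂.Modules}

/-- An isomorphism `t₁^* E₁ ≅ t₂^* E₂` seen as an isomorphism `v₁^* (g₁^* E₁) ≅ v₂^* (g₂^* E₂)`,
where `v₁ ≫ g₁ = t₁` and `v₂ ≫ g₂ = t₂`. -/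
def expand (ψ : pull t₁ E₁ ≅ pull t₂ E₂) (g₁ : U₁' ⟶ U₁) (g₂ : U₂' ⟶ U₂) (v₁ : W ⟶ U₁')
    (v₂ : W ⟶ U₂') (h₁ : v₁ ≫ g₁ = t₁) (h₂ : v₂ ≫ g₂ = t₂) :
    pull v₁ (pull g₁ E₁) ≅ pull v₂ (pull g₂ E₂) :=
  pullComp v₁ g₁ t₁ h₁ E₁ ≪≫ ψ ≪≫ (pullComp v₂ g₂ t₂ h₂ E₂).symm

variable {g₁ : U₁' ⟶ U₁} {g₂ : U₂' ⟶ U₂} {v₁ : W ⟶ U₁'} {v₂ : W ⟶ U₂'} (h₁ : v₁ ≫ g₁ = t₁)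
  (h₂ : v₂ ≫ g₂ = t₂)

theorem exists_expand_eq (φ : pull v₁ (pull g₁ E₁) ≅ pull v₂ (pull g₂ E₂)) :
    ∃ ψ : pull t₁ E₁ ≅ pull t₂ E₂, expand ψ g₁ g₂ v₁ v₂ h₁ h₂ = φ :=
  ⟨(pullComp v₁ g₁ t₁ h₁ E₁).symm ≪≫ φ ≪≫ pullComp v₂ g₂ t₂ h₂ E₂, by ext1; simp [expand]⟩

theorem expand_injective {ψ ψ' : pull t₁ E₁ ≅ pull t₂ E₂}
    (h : expand ψ g₁ g₂ v₁ v₂ h₁ h₂ = expand ψ' g₁ g₂ v₁ v₂ h₁ h₂) : ψ = ψ' := by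
  have := congr_arg Iso.hom h
  ext1
  simpa [expand] using this

/-- Expansion is base change along the identity, so its compatibilities follow from those of
`baseChangeIso`. -/
theorem expand_eq_baseChangeIso (ψ : pull t₁ E₁ ≅ pull t₂ E₂) (h₁' : v₁ ≫ g₁ = 𝟙 W ≫ t₁)
    (h₂' : v₂ ≫ g₂ = 𝟙 W ≫ t₂) :
    expand ψ g₁ g₂ v₁ v₂ h₁ h₂ = baseChangeIso ψ (𝟙 W) g₁ g₂ v₁ v₂ h₁' h₂' := by
  rw [baseChangeIso_eq ψ (𝟙 W) g₁ g₂ v₁ v₂ h₁' h₂' t₁ t₂ (Category.id_comp _)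
    (Category.id_comp _), res_id]
  rfl

theorem baseChangeIso_eq_expand {g₁ : U₁' ⟶ U₁} {g₂ : U₂' ⟶ U₂} {v₁ : W' ⟶ U₁'} {v₂ : W' ⟶ U₂'}
    (φ : pull t₁ E₁ ≅ pull t₂ E₂) (k : W' ⟶ W)
    (h₁ : v₁ ≫ g₁ = k ≫ t₁) (h₂ : v₂ ≫ g₂ = k ≫ t₂) {s₁ : W' ⟶ U₁} {s₂ : W' ⟶ U₂}
    (e₁ : k ≫ t₁ = s₁) (e₂ : k ≫ t₂ = s₂) :
    baseChangeIso φ k g₁ g₂ v₁ v₂ h₁ h₂ =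
      expand (res φ k s₁ s₂ e₁ e₂) g₁ g₂ v₁ v₂ (h₁.trans e₁) (h₂.trans e₂) :=
  baseChangeIso_eq φ k g₁ g₂ v₁ v₂ h₁ h₂ s₁ s₂ e₁ e₂

theorem mapIso_eq_expand (φ : pull t₁ E₁ ≅ pull t₂ E₂) (k : W' ⟶ W) {s₁ : W' ⟶ U₁} {s₂ : W' ⟶ U₂}
    (e₁ : k ≫ t₁ = s₁) (e₂ : k ≫ t₂ = s₂) :
    (Scheme.Modules.pullback k).mapIso φ = expand (res φ k s₁ s₂ e₁ e₂) t₁ t₂ k k e₁ e₂ := by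
  ext1
  simp [expand, res]

theorem res_expand (ψ : pull t₁ E₁ ≅ pull t₂ E₂) (l : W' ⟶ W) {w₁ : W' ⟶ U₁'} {w₂ : W' ⟶ U₂'}
    (e₁ : l ≫ v₁ = w₁) (e₂ : l ≫ v₂ = w₂) {s₁ : W' ⟶ U₁} {s₂ : W' ⟶ U₂} (l₁ : l ≫ t₁ = s₁)
    (l₂ : l ≫ t₂ = s₂) (k₁ : w₁ ≫ g₁ = s₁) (k₂ : w₂ ≫ g₂ = s₂) :
    res (expand ψ g₁ g₂ v₁ v₂ h₁ h₂) l w₁ w₂ e₁ e₂ =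
      expand (res ψ l s₁ s₂ l₁ l₂) g₁ g₂ w₁ w₂ k₁ k₂ := by
  rw [expand_eq_baseChangeIso h₁ h₂ ψ (h₁.trans (Category.id_comp _).symm)
    (h₂.trans (Category.id_comp _).symm), res_baseChangeIso ψ (𝟙 W) g₁ g₂ v₁ v₂ _ _ l w₁ w₂ e₁ e₂ l
      (Category.comp_id _) (k₁.trans l₁.symm) (k₂.trans l₂.symm)]
  exact baseChangeIso_eq_expand ψ l _ _ l₁ l₂

theorem baseChangeIso_expand_compareIso {U₁'' U₂'' V₁ V₂ : Scheme.{u}}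
    (ψ : pull t₁ E₁ ≅ pull t₂ E₂) (l : W' ⟶ W) (g₁' : U₁'' ⟶ U₁') (g₂' : U₂'' ⟶ U₂')
    (w₁ : W' ⟶ U₁'') (w₂ : W' ⟶ U₂'') (a₁ : w₁ ≫ g₁' = l ≫ v₁) (a₂ : w₂ ≫ g₂' = l ≫ v₂)
    (c₁ : V₁ ⟶ U₁) (c₂ : V₂ ⟶ U₂) (x₁ : W' ⟶ V₁) (x₂ : W' ⟶ V₂)
    (e₁ : (w₁ ≫ g₁') ≫ g₁ = x₁ ≫ c₁) (e₂ : (w₂ ≫ g₂') ≫ g₂ = x₂ ≫ c₂)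
    {s₁ : W' ⟶ U₁} {s₂ : W' ⟶ U₂} (l₁ : l ≫ t₁ = s₁)
    (l₂ : l ≫ t₂ = s₂) (k₁ : x₁ ≫ c₁ = s₁) (k₂ : x₂ ≫ c₂ = s₂) :
    baseChangeIso (expand ψ g₁ g₂ v₁ v₂ h₁ h₂) l g₁' g₂' w₁ w₂ a₁ a₂ ≪≫
        compareIso E₂ g₂ g₂' w₂ c₂ x₂ e₂ =
      compareIso E₁ g₁ g₁' w₁ c₁ x₁ e₁ ≪≫ expand (res ψ l s₁ s₂ l₁ l₂) c₁ c₂ x₁ x₂ k₁ k₂ := by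
  rw [expand_eq_baseChangeIso h₁ h₂ ψ (h₁.trans (Category.id_comp _).symm)
    (h₂.trans (Category.id_comp _).symm)]
  rw [baseChangeIso_compareIso ψ (𝟙 W) g₁ g₂ v₁ v₂ _ _ l g₁' g₂' w₁ w₂ a₁ a₂ c₁ c₂ x₁ x₂ l
    (Category.comp_id _) e₁ e₂ (k₁.trans l₁.symm) (k₂.trans l₂.symm)]
  rw [baseChangeIso_eq_expand ψ l _ _ l₁ l₂]

theorem res_pullComp {X Y : Scheme.{u}} (v : W ⟶ X) (g : X ⟶ Y) (t : W ⟶ Y) (h : v ≫ g = t)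
    (E : Y.Modules) (l : W' ⟶ W) (y : W' ⟶ X) (s : W' ⟶ Y) (hy : l ≫ v = y) (hs : l ≫ t = s)
    (hys : y ≫ g = s) : res (pullComp v g t h E) l y s hy hs = pullComp y g s hys E :=
  res_eq_of _ _ _ _ _ _ _ (pullComp_assoc l v g y t s hy h hs hys E).symm

theorem baseChangeIso_pullComp {X X' Y V : Scheme.{u}} (v : W ⟶ X) (g : X ⟶ Y) (t : W ⟶ Y)
    (h : v ≫ g = t) (E : Y.Modules) (l : W' ⟶ W) (g' : X' ⟶ X) (c : V ⟶ Y) (w : W' ⟶ X')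
    (x : W' ⟶ V) (a : w ≫ g' = l ≫ v) (b : x ≫ c = l ≫ t) (e : (w ≫ g') ≫ g = x ≫ c) :
    baseChangeIso (pullComp v g t h E) l g' c w x a b = compareIso E g g' w c x e := by
  have hys : (l ≫ v) ≫ g = l ≫ t := by rw [Category.assoc, h]
  rw [compareIso_eq E g g' w c x e (l ≫ v) (l ≫ t) a hys b,
    baseChangeIso_eq (pullComp v g t h E) l g' c w x a b (l ≫ v) (l ≫ t) rfl rfl,
    res_pullComp v g t h E l (l ≫ v) (l ≫ t) rfl rfl hys]

end Expand

/-! ### Patching isomorphisms between composite pullbacks -/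

namespace PatchSquare

variable {U U' V W : Scheme.{u}} {i : U ⟶ U'} {g : U ⟶ V} {g' : U' ⟶ W} {i' : V ⟶ W} {h : U ⟶ W}
  {ι : Type u} [Fintype ι] (sq : PatchSquare i g g' i' h) {U₁ U₂ : Scheme.{u}} {u₁ : W ⟶ U₁}
  {u₂ : W ⟶ U₂} {E₁ : U₁.Modules} {E₂ : U₂.Modules} {t₁' : U' ⟶ U₁} {t₂' : U' ⟶ U₂} {t₁ : V ⟶ U₁}
  {t₂ : V ⟶ U₂} {τ₁ : U ⟶ U₁} {τ₂ : U ⟶ U₂} (a₁' : g' ≫ u₁ = t₁') (a₂' : g' ≫ u₂ = t₂')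
  (a₁ : i' ≫ u₁ = t₁) (a₂ : i' ≫ u₂ = t₂)

include sq

/-- The bundles come from larger schemes `U₁` and `U₂`, so their restrictions appear as composite
pullbacks; `expand` converts these to the iterated pullbacks that `exists_iso` expects. -/
theorem exists_res_eq (hE₁ : LocallyHasBasis ι (pull u₁ E₁)) (hE₂ : LocallyHasBasis ι (pull u₂ E₂))
    (ψ' : pull t₁' E₁ ≅ pull t₂' E₂) (ψ : pull t₁ E₁ ≅ pull t₂ E₂)
    (b₁' : i ≫ t₁' = τ₁) (b₂' : i ≫ t₂' = τ₂) (b₁ : g ≫ t₁ = τ₁) (b₂ : g ≫ t₂ = τ₂)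
    (hψ : res ψ' i τ₁ τ₂ b₁' b₂' = res ψ g τ₁ τ₂ b₁ b₂) :
    ∃ φ : pull u₁ E₁ ≅ pull u₂ E₂, res φ g' t₁' t₂' a₁' a₂' = ψ' ∧ res φ i' t₁ t₂ a₁ a₂ = ψ := by
  have c₁ : h ≫ u₁ = τ₁ := by rw [← sq.comm₁, Category.assoc, a₁', b₁']
  have c₂ : h ≫ u₂ = τ₂ := by rw [← sq.comm₁, Category.assoc, a₂', b₂']
  obtain ⟨φ, h1, h2⟩ := sq.exists_iso hE₁ hE₂ (expand ψ' u₁ u₂ g' g' a₁' a₂')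
    (expand ψ u₁ u₂ i' i' a₁ a₂) (by
      rw [res_expand a₁' a₂' ψ' i sq.comm₁ sq.comm₁ b₁' b₂' c₁ c₂,
        res_expand a₁ a₂ ψ g sq.comm₂ sq.comm₂ b₁ b₂ c₁ c₂, hψ])
  rw [mapIso_eq_expand φ g' a₁' a₂'] at h1
  rw [mapIso_eq_expand φ i' a₁ a₂] at h2
  exact ⟨φ, expand_injective _ _ h1, expand_injective _ _ h2⟩

theorem res_ext (hE₂ : LocallyHasBasis ι (pull u₂ E₂)) {φ ψ : pull u₁ E₁ ≅ pull u₂ E₂}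
    (h₁ : res φ g' t₁' t₂' a₁' a₂' = res ψ g' t₁' t₂' a₁' a₂')
    (h₂ : res φ i' t₁ t₂ a₁ a₂ = res ψ i' t₁ t₂ a₁ a₂) : φ = ψ := by
  ext1
  have k₁ : (Scheme.Modules.pullback g').mapIso φ = (Scheme.Modules.pullback g').mapIso ψ := by
    rw [mapIso_eq_expand φ g' a₁' a₂', mapIso_eq_expand ψ g' a₁' a₂', h₁]
  have k₂ : (Scheme.Modules.pullback i').mapIso φ = (Scheme.Modules.pullback i').mapIso ψ := by
    rw [mapIso_eq_expand φ i' a₁ a₂, mapIso_eq_expand ψ i' a₁ a₂, h₂]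
  exact sq.hom_ext hE₂ congr(($k₁).hom) congr(($k₂).hom)

end PatchSquare

namespace Bun

section

variable {X S : Scheme.{u}} {f : X ⟶ S} {r : ℕ}

open PartialIso

theorem PartialIso.pullback_restr_of_le {T' T : Over S} (α : T' ⟶ T) {P Q : Bun f r T}
    (φ : PartialIso P Q) {V₀ : (XT f T).Opens} (h₀ : V₀ ≤ φ.W) (V : (XT f T').Opens)
    (h : V ≤ (φ.pullback α).W) (hV : V ≤ baseMap f α ⁻¹ᵁ V₀) :
    (φ.pullback α).restr V h =
      baseChangeIso (φ.restr V₀ h₀) ((XT f T').homOfLE hV ≫ baseMap f α ∣_ V₀)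
        (baseMap f α ∣_ P.U) (baseMap f α ∣_ Q.U)
        ((XT f T').homOfLE (hV.trans ((baseMap f α).preimage_mono (h₀.trans φ.le₁))))
        ((XT f T').homOfLE (hV.trans ((baseMap f α).preimage_mono (h₀.trans φ.le₂))))
        (homOfLE_morphismRestrict_comp _ _ _ _) (homOfLE_morphismRestrict_comp _ _ _ _) := by
  have h' : V ≤ baseMap f α ⁻¹ᵁ φ.W := hV.trans ((baseMap f α).preimage_mono h₀)
  refine (pullback_restr' α φ V h h').trans ?_
  exact (baseChangeIso_res φ.iso ((XT f T).homOfLE h₀) _ _ (Scheme.homOfLE_homOfLE _ _ _)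
    (Scheme.homOfLE_homOfLE _ _ _) ((XT f T').homOfLE hV ≫ baseMap f α ∣_ V₀)
    (baseMap f α ∣_ P.U) (baseMap f α ∣_ Q.U) _ _ _ _ _
    (homOfLE_morphismRestrict_comp _ _ _ _).symm _ _).symm

variable {T₀ T₁ T : Over S} {α : T₀ ⟶ T₁} {β : T₁ ⟶ T} {γ : T₀ ⟶ T} (h : α ≫ β = γ)
  {P Q : Bun f r T}

/-- The partial isomorphism `γ^* P ≅ γ^* Q` induced by a partial isomorphism `β^* P ≅ β^* Q`. -/
def PartialIso.descend (φ : PartialIso (pullObj β P) (pullObj β Q)) :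
    PartialIso (pullObj γ P) (pullObj γ Q) :=
  (comp α β γ h P).symm.trans ((φ.pullback α).trans (comp α β γ h Q))

theorem restrictMap_comp_homOfLE {W U : (XT f T).Opens} (hU : W ≤ U) :
    restrictMap f h W ≫ baseMap f β ∣_ W ≫ (XT f T).homOfLE hU =
      baseMap f γ ∣_ W ≫ (XT f T).homOfLE hU := by
  rw [← Category.assoc, restrictMap_comp]

theorem le_descend_W (φ : PartialIso (pullObj β P) (pullObj β Q)) {W : (XT f T).Opens}
    (hP : W ≤ P.U) (hQ : W ≤ Q.U) (hW : baseMap f β ⁻¹ᵁ W ≤ φ.W) :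
    baseMap f γ ⁻¹ᵁ W ≤ (φ.descend h).W := by
  refine le_trans_W _ _ ((baseMap f γ).preimage_mono hP) (le_trans_W _ _ ?_
    ((baseMap f γ).preimage_mono hQ))
  exact (preimage_le_of_comp_eq (by rw [← h, baseMap_comp]) W).trans
    ((baseMap f α).preimage_mono hW)

/-- The comparison isomorphisms at the two ends cancel, so over the preimage of `W` descending is
plain restriction along `restrictMap`. This turns agreement of germs over `T₀` into an equality of
sheaf isomorphisms. -/
theorem descend_restr (φ : PartialIso (pullObj β P) (pullObj β Q)) {W : (XT f T).Opens}
    (hP : W ≤ P.U) (hQ : W ≤ Q.U) (hW : baseMap f β ⁻¹ᵁ W ≤ φ.W)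
    (ψ : pull (baseMap f β ∣_ W ≫ (XT f T).homOfLE hP) P.E ≅
      pull (baseMap f β ∣_ W ≫ (XT f T).homOfLE hQ) Q.E)
    (hψ : φ.restr (baseMap f β ⁻¹ᵁ W) hW = expand ψ (baseMap f β ∣_ P.U) (baseMap f β ∣_ Q.U)
      ((XT f T₁).homOfLE ((baseMap f β).preimage_mono hP))
      ((XT f T₁).homOfLE ((baseMap f β).preimage_mono hQ))
      (morphismRestrict_homOfLE _ _ _ _).symm (morphismRestrict_homOfLE _ _ _ _).symm) :
    (φ.descend h).restr (baseMap f γ ⁻¹ᵁ W) (le_descend_W h φ hP hQ hW) =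
      expand (res ψ (restrictMap f h W) (baseMap f γ ∣_ W ≫ (XT f T).homOfLE hP)
        (baseMap f γ ∣_ W ≫ (XT f T).homOfLE hQ) (restrictMap_comp_homOfLE h hP)
        (restrictMap_comp_homOfLE h hQ)) (baseMap f γ ∣_ P.U) (baseMap f γ ∣_ Q.U)
      ((XT f T₀).homOfLE ((baseMap f γ).preimage_mono hP))
      ((XT f T₀).homOfLE ((baseMap f γ).preimage_mono hQ))
      (morphismRestrict_homOfLE _ _ _ _).symm (morphismRestrict_homOfLE _ _ _ _).symm := by
  have l₁ : baseMap f γ ⁻¹ᵁ W ≤ (comp α β γ h P).W := (baseMap f γ).preimage_mono hP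
  have l₃ : baseMap f γ ⁻¹ᵁ W ≤ (comp α β γ h Q).W := (baseMap f γ).preimage_mono hQ
  have l : baseMap f γ ⁻¹ᵁ W ≤ baseMap f α ⁻¹ᵁ baseMap f β ⁻¹ᵁ W :=
    preimage_le_of_comp_eq (by rw [← h, baseMap_comp]) W
  have l₂ : baseMap f γ ⁻¹ᵁ W ≤ (φ.pullback α).W := l.trans ((baseMap f α).preimage_mono hW)
  have e₁ := (symm_restr (comp α β γ h P) (baseMap f γ ⁻¹ᵁ W) l₁ l₁).trans
    (congrArg Iso.symm (comp_restr α β γ h P _ l₁))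
  have e₂ := pullback_restr_of_le α φ hW _ l₂ l
  rw [hψ] at e₂
  have e₃ := baseChangeIso_expand_compareIso
    (morphismRestrict_homOfLE (baseMap f β) W P.U hP).symm
    (morphismRestrict_homOfLE (baseMap f β) W Q.U hQ).symm ψ (restrictMap f h W)
    (baseMap f α ∣_ (pullObj β P).U) (baseMap f α ∣_ (pullObj β Q).U)
    ((XT f T₀).homOfLE (l.trans ((baseMap f α).preimage_mono (hW.trans φ.le₁))))
    ((XT f T₀).homOfLE (l.trans ((baseMap f α).preimage_mono (hW.trans φ.le₂))))
    (homOfLE_morphismRestrict_comp _ _ _ _) (homOfLE_morphismRestrict_comp _ _ _ _)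
    (baseMap f γ ∣_ P.U) (baseMap f γ ∣_ Q.U)
    ((XT f T₀).homOfLE ((baseMap f γ).preimage_mono hP))
    ((XT f T₀).homOfLE ((baseMap f γ).preimage_mono hQ))
    (homOfLE_morphismRestrict_of_comp_eq (by rw [← h, baseMap_comp]) P.U _ _)
    (homOfLE_morphismRestrict_of_comp_eq (by rw [← h, baseMap_comp]) Q.U _ _)
    (restrictMap_comp_homOfLE h hP)
    (restrictMap_comp_homOfLE h hQ) (morphismRestrict_homOfLE _ _ _ _).symm
    (morphismRestrict_homOfLE _ _ _ _).symm
  have e₄ := (trans_restr (φ.pullback α) (comp α β γ h Q) _ (le_trans_W _ _ l₂ l₃) l₂ l₃).trans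
    ((congrArg₂ Iso.trans e₂ (comp_restr α β γ h Q _ l₃)).trans e₃)
  refine (trans_restr (comp α β γ h P).symm ((φ.pullback α).trans (comp α β γ h Q)) _ _ l₁
    (le_trans_W _ _ l₂ l₃)).trans ((congrArg₂ Iso.trans e₁ e₄).trans ?_)
  exact Iso.symm_self_id_assoc _ _

theorem pullback_restr_eq_expand (n : PartialIso P Q) {W : (XT f T).Opens} (hW : W ≤ n.W)
    (hW' : baseMap f β ⁻¹ᵁ W ≤ (n.pullback β).W) :
    (n.pullback β).restr (baseMap f β ⁻¹ᵁ W) hW' =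
      expand (res (n.restr W hW) (baseMap f β ∣_ W) _ _ rfl rfl) (baseMap f β ∣_ P.U)
        (baseMap f β ∣_ Q.U)
        ((XT f T₁).homOfLE ((baseMap f β).preimage_mono (hW.trans n.le₁)))
        ((XT f T₁).homOfLE ((baseMap f β).preimage_mono (hW.trans n.le₂)))
        (morphismRestrict_homOfLE _ _ _ _).symm (morphismRestrict_homOfLE _ _ _ _).symm :=
  pullback_restr β n W hW hW'

end

end Bun

theorem res_of_eq_id {W U₁ U₂ : Scheme.{u}} {u₁ : W ⟶ U₁} {u₂ : W ⟶ U₂} {E₁ : U₁.Modules}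
    {E₂ : U₂.Modules} (φ : pull u₁ E₁ ≅ pull u₂ E₂) (k : W ⟶ W) (hk : k = 𝟙 W)
    (h₁ : k ≫ u₁ = u₁) (h₂ : k ≫ u₂ = u₂) : res φ k u₁ u₂ h₁ h₂ = φ := by
  subst hk
  exact res_id φ h₁ h₂

/-! ### Patching partial isomorphisms -/

namespace Bun

variable {X S : Scheme.{u}} {f : X ⟶ S} {r : ℕ}

open PartialIso

/-- A commutative square over `S` such that the square of the `X_T` allows patching vector bundles
outside closed subsets in `Phi`. -/
structure PatchBase (f : X ⟶ S) {T₀ T' T'' T : Over S} (p : T₀ ⟶ T') (q : T₀ ⟶ T'')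
    (α : T' ⟶ T) (β : T'' ⟶ T) (γ : T₀ ⟶ T) : Prop where
  comm₁ : p ≫ α = γ
  comm₂ : q ≫ β = γ
  patchSquare : ∀ W : (XT f T).Opens, PatchSquare (restrictMap f comm₁ W) (restrictMap f comm₂ W)
    (baseMap f α ∣_ W) (baseMap f β ∣_ W) (baseMap f γ ∣_ W)
  exists_preimages_le : ∀ {N₁ : (XT f T').Opens} {N₂ : (XT f T'').Opens} {N₃ : (XT f T₀).Opens},
    (N₁ : Set (XT f T'))ᶜ ∈ Phi f _ → (N₂ : Set (XT f T''))ᶜ ∈ Phi f _ →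
    (N₃ : Set (XT f T₀))ᶜ ∈ Phi f _ → ∃ W : (XT f T).Opens, (W : Set (XT f T))ᶜ ∈ Phi f _ ∧
      baseMap f α ⁻¹ᵁ W ≤ N₁ ∧ baseMap f β ⁻¹ᵁ W ≤ N₂ ∧ baseMap f γ ⁻¹ᵁ W ≤ N₃

variable {T₀ T' T'' T : Over S} {p : T₀ ⟶ T'} {q : T₀ ⟶ T''} {α : T' ⟶ T} {β : T'' ⟶ T}
  {γ : T₀ ⟶ T} (hb : PatchBase f p q α β γ)

theorem locallyHasBasis (P : Bun f r T) : LocallyHasBasis (ULift.{u} (Fin r)) P.E :=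
  (isLocallyFreeOfRank_iff _ _).1 P.locallyFree

include hb

/-- One `W` is chosen over which both partial isomorphisms are defined and agree over `T₀`; patching
over `W` then applies. This gives fullness. -/
theorem PatchBase.exists_pullback_rel {P Q : Bun f r T}
    (φ : PartialIso (pullObj α P) (pullObj α Q)) (ψ : PartialIso (pullObj β P) (pullObj β Q))
    (hc : Rel (φ.descend hb.comm₁) (ψ.descend hb.comm₂)) :
    ∃ n : PartialIso P Q, Rel (n.pullback α) φ ∧ Rel (n.pullback β) ψ := by
  obtain ⟨V, hV, hV₁, hV₂, e⟩ := hc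
  obtain ⟨W₀, hW₀, hφ₀, hψ₀, hV₀⟩ := hb.exists_preimages_le φ.compl_mem ψ.compl_mem hV
  let W := W₀ ⊓ (P.U ⊓ Q.U)
  have hW : (W : Set (XT f T))ᶜ ∈ Phi f T :=
    inf_compl_mem hW₀ (inf_compl_mem P.compl_mem Q.compl_mem)
  have hP : W ≤ P.U := inf_le_right.trans inf_le_left
  have hQ : W ≤ Q.U := inf_le_right.trans inf_le_right
  have hφ : baseMap f α ⁻¹ᵁ W ≤ φ.W := ((baseMap f α).preimage_mono inf_le_left).trans hφ₀
  have hψ : baseMap f β ⁻¹ᵁ W ≤ ψ.W := ((baseMap f β).preimage_mono inf_le_left).trans hψ₀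
  have hWV : baseMap f γ ⁻¹ᵁ W ≤ V := ((baseMap f γ).preimage_mono inf_le_left).trans hV₀
  obtain ⟨φ', hφ'⟩ := exists_expand_eq (morphismRestrict_homOfLE (baseMap f α) W P.U hP).symm
    (morphismRestrict_homOfLE (baseMap f α) W Q.U hQ).symm (φ.restr _ hφ)
  obtain ⟨ψ', hψ'⟩ := exists_expand_eq (morphismRestrict_homOfLE (baseMap f β) W P.U hP).symm
    (morphismRestrict_homOfLE (baseMap f β) W Q.U hQ).symm (ψ.restr _ hψ)
  have d₁ := descend_restr hb.comm₁ φ hP hQ hφ φ' hφ'.symm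
  have d₂ := descend_restr hb.comm₂ ψ hP hQ hψ ψ' hψ'.symm
  have key := expand_injective _ _ (d₁.symm.trans ((restr_eq_of_le hV₁ hV₂ e hWV).trans d₂))
  obtain ⟨n, hn₁, hn₂⟩ := (hb.patchSquare W).exists_res_eq rfl rfl rfl rfl
    (P.locallyHasBasis.pull _) (Q.locallyHasBasis.pull _) φ' ψ' _ _ _ _ key
  let N : PartialIso P Q := ⟨W, hW, hP, hQ, n⟩
  have hN : N.restr W le_rfl = n :=
    res_of_eq_id n _ (Scheme.homOfLE_rfl _ _) _ _
  refine ⟨N, ⟨_, preimage_compl_mem α hW, le_rfl, hφ, ?_⟩,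
    ⟨_, preimage_compl_mem β hW, le_rfl, hψ, ?_⟩⟩
  · refine (pullback_restr_eq_expand N le_rfl le_rfl).trans (Eq.trans ?_ hφ')
    rw [hN, ← hn₁]
  · refine (pullback_restr_eq_expand N le_rfl le_rfl).trans (Eq.trans ?_ hψ')
    rw [hN, ← hn₂]

/-- After shrinking to a `W` over which both pulled-back relations are equalities, uniqueness in
patching applies. This gives faithfulness. -/
theorem PatchBase.rel_of_pullback_rel {P Q : Bun f r T} {m n : PartialIso P Q}
    (h₁ : Rel (m.pullback α) (n.pullback α)) (h₂ : Rel (m.pullback β) (n.pullback β)) :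
    Rel m n := by
  obtain ⟨V₁, hV₁, hm₁, hn₁, e₁⟩ := h₁
  obtain ⟨V₂, hV₂, hm₂, hn₂, e₂⟩ := h₂
  -- Nothing is required over `T₀`, so the whole space is prescribed there.
  obtain ⟨W₀, hW₀, l₁, l₂, -⟩ := hb.exists_preimages_le hV₁ hV₂ (univ_compl_mem T₀)
  let W := W₀ ⊓ (m.W ⊓ n.W)
  have hm : W ≤ m.W := inf_le_right.trans inf_le_left
  have hn : W ≤ n.W := inf_le_right.trans inf_le_right
  refine ⟨W, inf_compl_mem hW₀ (inf_compl_mem m.compl_mem n.compl_mem), hm, hn, ?_⟩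
  have k₁ := restr_eq_of_le hm₁ hn₁ e₁ (((baseMap f α).preimage_mono inf_le_left).trans l₁ :
    baseMap f α ⁻¹ᵁ W ≤ V₁)
  have k₂ := restr_eq_of_le hm₂ hn₂ e₂ (((baseMap f β).preimage_mono inf_le_left).trans l₂ :
    baseMap f β ⁻¹ᵁ W ≤ V₂)
  rw [pullback_restr_eq_expand m hm, pullback_restr_eq_expand n hn] at k₁ k₂
  exact (hb.patchSquare W).res_ext rfl rfl rfl rfl (Q.locallyHasBasis.pull _)
    (expand_injective _ _ k₁) (expand_injective _ _ k₂)

end Bun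

theorem expand_trans {W U₁ U₂ U₃ U₁' U₂' U₃' : Scheme.{u}} {t₁ : W ⟶ U₁} {t₂ : W ⟶ U₂}
    {t₃ : W ⟶ U₃} {E₁ : U₁.Modules} {E₂ : U₂.Modules} {E₃ : U₃.Modules}
    (φ : pull t₁ E₁ ≅ pull t₂ E₂) (ψ : pull t₂ E₂ ≅ pull t₃ E₃) (g₁ : U₁' ⟶ U₁) (g₂ : U₂' ⟶ U₂)
    (g₃ : U₃' ⟶ U₃) (v₁ : W ⟶ U₁') (v₂ : W ⟶ U₂') (v₃ : W ⟶ U₃') (h₁ : v₁ ≫ g₁ = t₁)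
    (h₂ : v₂ ≫ g₂ = t₂) (h₃ : v₃ ≫ g₃ = t₃) :
    expand φ g₁ g₂ v₁ v₂ h₁ h₂ ≪≫ expand ψ g₂ g₃ v₂ v₃ h₂ h₃ =
      expand (φ ≪≫ ψ) g₁ g₃ v₁ v₃ h₁ h₃ := by
  ext1
  simp [expand]

theorem PatchSquare.exists_glue_res {U U' V W U₁ U₂ : Scheme.{u}} {i : U ⟶ U'} {g : U ⟶ V}
    {g' : U' ⟶ W} {i' : V ⟶ W} {h : U ⟶ W} {ι : Type u} [Fintype ι]
    (sq : PatchSquare i g g' i' h) (v : U' ⟶ U₁) (w : V ⟶ U₂) {P : U₁.Modules} {Q : U₂.Modules}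
    (hP : LocallyHasBasis ι (pull v P)) (hQ : LocallyHasBasis ι (pull w Q))
    (ψ : pull (i ≫ v) P ≅ pull (g ≫ w) Q) :
    ∃ (E : W.Modules) (_ : LocallyHasBasis ι E) (e' : pull g' E ≅ pull v P)
      (e : pull i' E ≅ pull w Q), res e' i h (i ≫ v) sq.comm₁ rfl ≪≫ ψ =
        res e g h (g ≫ w) sq.comm₂ rfl := by
  obtain ⟨E, hE, e', e, hee⟩ := sq.exists_glue hP hQ (expand ψ v w i g rfl rfl)
  refine ⟨E, hE, e', e, ?_⟩
  have := congr_arg Iso.hom hee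
  ext1
  simp only [expand, Iso.trans_hom, Iso.symm_hom, Functor.mapIso_hom, res, Category.assoc] at this ⊢
  rw [← cancel_mono (pullComp g w (g ≫ w) rfl Q).inv]
  simpa using this

theorem homOfLE_rfl_comp {X Y : Scheme.{u}} {U : X.Opens} (g : U.toScheme ⟶ Y) :
    X.homOfLE (le_refl U) ≫ g = g := by
  rw [Scheme.homOfLE_rfl, Category.id_comp]

/-! ### Gluing objects -/

namespace Bun

variable {X S : Scheme.{u}} {f : X ⟶ S} {r : ℕ}

open PartialIso

section

variable {T₀ T₁ T : Over S} {α : T₀ ⟶ T₁} {β : T₁ ⟶ T} {γ : T₀ ⟶ T} (h : α ≫ β = γ)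
  (P : Bun f r T) (Q : Bun f r T₁) (hQ : baseMap f β ⁻¹ᵁ P.U ≤ Q.U)
  (e : pull (baseMap f β ∣_ P.U) P.E ≅ pull ((XT f T₁).homOfLE hQ) Q.E)

/-- The partial isomorphism given by an isomorphism over the whole domain of `β^* P`. -/
def PartialIso.ofIso : PartialIso (pullObj β P) Q where
  W := baseMap f β ⁻¹ᵁ P.U
  compl_mem := (pullObj β P).compl_mem
  le₁ := le_rfl
  le₂ := hQ
  iso := pullComp _ (baseMap f β ∣_ P.U) (baseMap f β ∣_ P.U) (homOfLE_rfl_comp _) P.E ≪≫ e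

theorem le_ofIso_W : baseMap f γ ⁻¹ᵁ P.U ≤
    ((comp α β γ h P).symm.trans ((ofIso P Q hQ e).pullback α)).W :=
  le_trans_W _ _ le_rfl (preimage_le_of_comp_eq (by rw [← h, baseMap_comp]) P.U)

/-- The comparison isomorphism inside `comp` cancels the one built into `ofIso`, leaving the
restriction of `e`. -/
theorem ofIso_restr : ((comp α β γ h P).symm.trans ((ofIso P Q hQ e).pullback α)).restr
      (baseMap f γ ⁻¹ᵁ P.U) (le_ofIso_W h P Q hQ e) =
    expand (res e (restrictMap f h P.U) (baseMap f γ ∣_ P.U)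
      (restrictMap f h P.U ≫ (XT f T₁).homOfLE hQ) (restrictMap_comp f h P.U) rfl)
      (baseMap f γ ∣_ P.U) (baseMap f α ∣_ Q.U) ((XT f T₀).homOfLE le_rfl)
      ((XT f T₀).homOfLE ((preimage_le_of_comp_eq (by rw [← h, baseMap_comp]) P.U).trans
        ((baseMap f α).preimage_mono hQ))) (homOfLE_rfl_comp _)
      (homOfLE_morphismRestrict_comp _ _ _ _) := by
  have l : baseMap f γ ⁻¹ᵁ P.U ≤ baseMap f α ⁻¹ᵁ baseMap f β ⁻¹ᵁ P.U :=
    preimage_le_of_comp_eq (by rw [← h, baseMap_comp]) P.U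
  have l₁ : baseMap f γ ⁻¹ᵁ P.U ≤ (comp α β γ h P).W := le_rfl
  have l₂ : baseMap f γ ⁻¹ᵁ P.U ≤ ((ofIso P Q hQ e).pullback α).W := l
  have e₁ := (symm_restr (comp α β γ h P) (baseMap f γ ⁻¹ᵁ P.U) l₁ l₁).trans
    (congrArg Iso.symm (comp_restr α β γ h P _ l₁))
  have hx : (XT f T₀).homOfLE le_rfl ≫ baseMap f γ ∣_ P.U =
      restrictMap f h P.U ≫ baseMap f β ∣_ P.U := by
    rw [restrictMap_comp]; simp
  have e₂ := pullback_restr' α (ofIso P Q hQ e) _ l₂ l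
  have e₃ := baseChangeIso_trans
    (pullComp ((XT f T₁).homOfLE le_rfl) (baseMap f β ∣_ P.U) (baseMap f β ∣_ P.U) (homOfLE_rfl_comp _) P.E) e
    (restrictMap f h P.U) (baseMap f α ∣_ (pullObj β P).U) (baseMap f γ ∣_ P.U) (baseMap f α ∣_ Q.U)
    ((XT f T₀).homOfLE l) ((XT f T₀).homOfLE le_rfl)
    ((XT f T₀).homOfLE (l.trans ((baseMap f α).preimage_mono hQ)))
    (homOfLE_morphismRestrict_comp _ _ _ _) hx
    (homOfLE_morphismRestrict_comp _ _ _ _)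
  have e₄ := baseChangeIso_pullComp ((XT f T₁).homOfLE le_rfl) (baseMap f β ∣_ P.U)
    (baseMap f β ∣_ P.U) (homOfLE_rfl_comp _) P.E (restrictMap f h P.U)
    (baseMap f α ∣_ (pullObj β P).U) (baseMap f γ ∣_ P.U) ((XT f T₀).homOfLE l)
    ((XT f T₀).homOfLE le_rfl) (homOfLE_morphismRestrict_comp _ _ _ _) hx
    (homOfLE_morphismRestrict_of_comp_eq (by rw [← h, baseMap_comp]) P.U _ _)
  have e₅ := baseChangeIso_eq_expand e (restrictMap f h P.U) hx
    (homOfLE_morphismRestrict_comp (baseMap f α) hQ l (l.trans ((baseMap f α).preimage_mono hQ)))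
    (restrictMap_comp f h P.U) rfl
  refine (trans_restr (comp α β γ h P).symm ((ofIso P Q hQ e).pullback α) _ _ l₁ l₂).trans
    ((congrArg₂ Iso.trans e₁ (e₂.trans (e₃.trans (congrArg₂ Iso.trans e₄ e₅)))).trans ?_)
  exact Iso.symm_self_id_assoc _ _

end

variable {T₀ T' T'' T : Over S} {p : T₀ ⟶ T'} {q : T₀ ⟶ T''} {α : T' ⟶ T} {β : T'' ⟶ T}
  {γ : T₀ ⟶ T} (hb : PatchBase f p q α β γ)

include hb

/-- A common `W` is chosen inside the domains of `P`, `Q` and `θ`, and the sheaves are glued there.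
With `W` as the domain of `R`, the partial isomorphisms to `P` and `Q` exist over its full
preimages. -/
theorem PatchBase.exists_glue (P : Bun f r T') (Q : Bun f r T'')
    (θ : PartialIso (pullObj p P) (pullObj q Q)) :
    ∃ (R : Bun f r T) (m : PartialIso (pullObj α R) P) (n : PartialIso (pullObj β R) Q),
      Rel (((comp p α γ hb.comm₁ R).symm.trans (m.pullback p)).trans θ)
        ((comp q β γ hb.comm₂ R).symm.trans (n.pullback q)) := by
  obtain ⟨W, hW, hP, hQ, hθ⟩ := hb.exists_preimages_le P.compl_mem Q.compl_mem θ.compl_mem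
  have sq := hb.patchSquare W
  have l₁ : baseMap f γ ⁻¹ᵁ W ≤ baseMap f p ⁻¹ᵁ baseMap f α ⁻¹ᵁ W :=
    preimage_le_of_comp_eq (by rw [← hb.comm₁, baseMap_comp]) W
  have l₂ : baseMap f γ ⁻¹ᵁ W ≤ baseMap f q ⁻¹ᵁ baseMap f β ⁻¹ᵁ W :=
    preimage_le_of_comp_eq (by rw [← hb.comm₂, baseMap_comp]) W
  obtain ⟨ψ, hψ⟩ := exists_expand_eq
    (homOfLE_morphismRestrict_comp (baseMap f p) hP l₁ (l₁.trans ((baseMap f p).preimage_mono hP)))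
    (homOfLE_morphismRestrict_comp (baseMap f q) hQ l₂ (l₂.trans ((baseMap f q).preimage_mono hQ)))
    (θ.restr _ hθ)
  obtain ⟨E, hE, e', e, hee⟩ := sq.exists_glue_res ((XT f T').homOfLE hP) ((XT f T'').homOfLE hQ)
    (P.locallyHasBasis.pull _) (Q.locallyHasBasis.pull _) ψ
  let R : Bun f r T := ⟨W, hW, E, (isLocallyFreeOfRank_iff _ _).2 hE⟩
  let m : PartialIso (pullObj α R) P := ofIso R P hP e'
  let n : PartialIso (pullObj β R) Q := ofIso R Q hQ e
  have k₁ := le_ofIso_W hb.comm₁ R P hP e'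
  have k₂ := le_ofIso_W hb.comm₂ R Q hQ e
  refine ⟨R, m, n, baseMap f γ ⁻¹ᵁ W, preimage_compl_mem γ hW, le_trans_W _ _ k₁ hθ, k₂, ?_⟩
  refine (trans_restr _ θ _ _ k₁ hθ).trans ?_
  refine (congrArg₂ Iso.trans (ofIso_restr hb.comm₁ R P hP e') hψ.symm).trans ?_
  refine Eq.trans ?_ (ofIso_restr hb.comm₂ R Q hQ e).symm
  refine (expand_trans _ _ _ _ _ _ _ _ _ _ _).trans ?_
  exact congrArg (fun t => expand t _ _ _ _ _ _) hee

end Bun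

/-! ### Extension groupoids -/

namespace Bun

variable {X S : Scheme.{u}} {f : X ⟶ S} {r : ℕ}

open PartialIso

section

variable {T₀ T₁ T : Over S} {α : T₀ ⟶ T₁} {β : T₁ ⟶ T} {γ : T₀ ⟶ T} (h : α ≫ β = γ)

theorem Extension.restrict_obj_hom {a : Bun f r T₀} (x : Extension γ a) :
    ((Extension.restrict α β γ h a).obj x).hom =
      (pullbackFunctorComp f r α β γ h).hom.app x.left ≫ x.hom := by
  simp [Extension.restrict, CostructuredArrow.mapNatIso]

/-- The right-hand side does not involve the intermediate base, so morphisms of the two restricted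
extensions automatically agree over `T₀`. -/
theorem Extension.restrict_hom_conj {a : Bun f r T₀} {x y : Extension γ a}
    (φ : (Extension.restrict α β γ h a).obj x ⟶ (Extension.restrict α β γ h a).obj y) :
    (pullbackFunctorComp f r α β γ h).inv.app x.left ≫ (pullbackFunctor f r α).map φ.left ≫
      (pullbackFunctorComp f r α β γ h).hom.app y.left = x.hom ≫ inv y.hom := by
  have := CostructuredArrow.w φ
  rw [Extension.restrict_obj_hom, Extension.restrict_obj_hom] at this
  rw [IsIso.eq_comp_inv, Category.assoc]
  refine (congrArg (_ ≫ ·) ((Category.assoc _ _ _).trans this)).trans ?_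
  exact Iso.inv_hom_id_app_assoc _ _ _

/-- The isomorphism of extensions given by a compatible morphism. -/
def Extension.restrictIso {a : Bun f r T₀} {R : Bun f r T} (s : (pullbackFunctor f r γ).obj R ⟶ a)
    (x : Extension α a) (m : (pullbackFunctor f r β).obj R ⟶ x.left)
    (w : (pullbackFunctor f r α).map m ≫ x.hom =
      (pullbackFunctorComp f r α β γ h).hom.app R ≫ s) :
    (Extension.restrict α β γ h a).obj (CostructuredArrow.mk s) ≅ x :=
  CostructuredArrow.isoMk ((Groupoid.isoEquivHom _ _).symm m)
    (w.trans (Extension.restrict_obj_hom h (CostructuredArrow.mk s)).symm)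

end

variable {T₀ T' T'' T : Over S} {p : T₀ ⟶ T'} {q : T₀ ⟶ T''} {α : T' ⟶ T} {β : T'' ⟶ T}
  {γ : T₀ ⟶ T} (hb : PatchBase f p q α β γ)

include hb

theorem PatchBase.hom_ext {P Q : Bun f r T} {m n : P ⟶ Q}
    (h₁ : (pullbackFunctor f r α).map m = (pullbackFunctor f r α).map n)
    (h₂ : (pullbackFunctor f r β).map m = (pullbackFunctor f r β).map n) : m = n := by
  induction m using Quotient.inductionOn with | _ m
  induction n using Quotient.inductionOn with | _ n
  exact germ_eq (hb.rel_of_pullback_rel (Quotient.exact h₁) (Quotient.exact h₂))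

theorem PatchBase.exists_map_eq {P Q : Bun f r T}
    (φ : (pullbackFunctor f r α).obj P ⟶ (pullbackFunctor f r α).obj Q)
    (ψ : (pullbackFunctor f r β).obj P ⟶ (pullbackFunctor f r β).obj Q)
    (h : (pullbackFunctorComp f r p α γ hb.comm₁).inv.app P ≫ (pullbackFunctor f r p).map φ ≫
        (pullbackFunctorComp f r p α γ hb.comm₁).hom.app Q =
      (pullbackFunctorComp f r q β γ hb.comm₂).inv.app P ≫ (pullbackFunctor f r q).map ψ ≫
        (pullbackFunctorComp f r q β γ hb.comm₂).hom.app Q) :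
    ∃ n : P ⟶ Q, (pullbackFunctor f r α).map n = φ ∧ (pullbackFunctor f r β).map n = ψ := by
  induction φ using Quotient.inductionOn with | _ φ
  induction ψ using Quotient.inductionOn with | _ ψ
  obtain ⟨n, h₁, h₂⟩ := hb.exists_pullback_rel φ ψ (Quotient.exact h)
  exact ⟨germ n, germ_eq h₁, germ_eq h₂⟩

theorem PatchBase.exists_obj (P : Bun f r T') (Q : Bun f r T'')
    (θ : (pullbackFunctor f r p).obj P ⟶ (pullbackFunctor f r q).obj Q) :
    ∃ (R : Bun f r T) (m : (pullbackFunctor f r α).obj R ⟶ P)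
      (n : (pullbackFunctor f r β).obj R ⟶ Q),
      (pullbackFunctorComp f r p α γ hb.comm₁).inv.app R ≫ (pullbackFunctor f r p).map m ≫ θ =
        (pullbackFunctorComp f r q β γ hb.comm₂).inv.app R ≫ (pullbackFunctor f r q).map n := by
  induction θ using Quotient.inductionOn with | _ θ
  obtain ⟨R, m, n, h⟩ := hb.exists_glue P Q θ
  exact ⟨R, germ m, germ n, (Category.assoc _ _ _).symm.trans (germ_eq h)⟩

/-- Extensions over `T` are the same as pairs of extensions over `T'` and `T''`. -/
theorem PatchBase.isEquivalence (a : Bun f r T₀) :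
    (Functor.prod' (Extension.restrict p α γ hb.comm₁ a)
      (Extension.restrict q β γ hb.comm₂ a)).IsEquivalence where
  faithful.map_injective {x y m n} hmn := by
    ext1
    exact hb.hom_ext congr(($hmn).1.left) congr(($hmn).2.left)
  full.map_surjective {x y} := by
    rintro ⟨φ, ψ⟩
    obtain ⟨n, h₁, h₂⟩ := hb.exists_map_eq φ.left ψ.left
      ((Extension.restrict_hom_conj _ φ).trans (Extension.restrict_hom_conj _ ψ).symm)
    refine ⟨CostructuredArrow.homMk n ?_, ?_⟩
    · have h₃ := Extension.restrict_hom_conj _ φ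
      rw [← h₁] at h₃
      have h₄ := ((pullbackFunctorComp f r p α γ hb.comm₁).hom.naturality n)
      refine (IsIso.eq_comp_inv _).1 (Eq.trans ?_ h₃)
      refine Eq.trans ?_ (congrArg (_ ≫ ·) h₄).symm
      exact (Iso.inv_hom_id_app_assoc _ _ _).symm
    · refine Prod.ext ?_ ?_
      · ext1
        exact h₁
      · ext1
        exact h₂
  essSurj.mem_essImage := by
    rintro ⟨x, y⟩
    -- Both restrictions are identified with `a`, and the composite of these identifications is the
    -- gluing isomorphism.
    obtain ⟨R, m, n, h⟩ := hb.exists_obj x.left y.left (x.hom ≫ inv y.hom)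
    let s : (pullbackFunctor f r γ).obj R ⟶ a :=
      (pullbackFunctorComp f r p α γ hb.comm₁).inv.app R ≫ (pullbackFunctor f r p).map m ≫ x.hom
    have hs : s = (pullbackFunctorComp f r q β γ hb.comm₂).inv.app R ≫
        (pullbackFunctor f r q).map n ≫ y.hom := by
      have := congrArg (· ≫ y.hom) h
      simpa [s] using this
    have w₁ : (pullbackFunctor f r p).map m ≫ x.hom =
        (pullbackFunctorComp f r p α γ hb.comm₁).hom.app R ≫ s :=
      (Iso.hom_inv_id_app_assoc (pullbackFunctorComp f r p α γ hb.comm₁) R _).symm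
    have w₂ : (pullbackFunctor f r q).map n ≫ y.hom =
        (pullbackFunctorComp f r q β γ hb.comm₂).hom.app R ≫ s := by
      rw [hs]
      exact (Iso.hom_inv_id_app_assoc (pullbackFunctorComp f r q β γ hb.comm₂) R _).symm
    exact ⟨CostructuredArrow.mk s, ⟨Iso.prod (Extension.restrictIso _ s x m w₁)
      (Extension.restrictIso _ s y n w₂)⟩⟩

end Bun

/-! ### The case of a fibre product of rings -/

section FiberProductPatching

variable {k : Type u} [Field k] {X : Scheme.{u}} (f : X ⟶ Spec (CommRingCat.of k))
    {A₀ A A' B : Type u} [CommRing A₀] [Algebra k A₀] [CommRing A] [Algebra k A]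
    [CommRing A'] [Algebra k A'] [CommRing B] [Algebra k B]
    {π : A →ₐ[k] A₀} (hπ : Function.Surjective π) (hπ_nil : IsNilpotent (RingHom.ker π))
    {p : A' →ₐ[k] A} (hp : Function.Surjective p) (hp_nil : IsNilpotent (RingHom.ker (π.comp p)))
    {q : B →ₐ[k] A} (hq : Function.Surjective (π.comp q))

include hπ hπ_nil hp hp_nil hq in
theorem patchBase_fiberProduct : Bun.PatchBase f (SpecOver.map p) (SpecOver.map q)
    (SpecOver.map (FiberProduct.fst p q)) (SpecOver.map (FiberProduct.snd p q))
    (SpecOver.map (FiberProduct.toBase p q)) where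
  comm₁ := SpecOver.map_comp _ _ _ rfl
  comm₂ := SpecOver.map_comp _ _ _ (FiberProduct.condition p q).symm
  patchSquare W := patchSquare f hπ hp hp_nil hq W
  exists_preimages_le h₁ h₂ h₃ := exists_preimages_le hπ hπ_nil hp hp_nil hq h₁ h₂ h₃

end FiberProductPatching

end RelBundle

end

theorem mainTheorem8 {k : Type u} [Field k] (X : Scheme.{u}) (f : X ⟶ Spec (CommRingCat.of k))
    [IsProper f] [IrreducibleSpace X] (hX : RelBundle.SerreCondition X 2) (r : ℕ)
    {A₀ A A' B : Type u} [CommRing A₀] [Algebra k A₀] [CommRing A] [Algebra k A]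
    [CommRing A'] [Algebra k A'] [CommRing B] [Algebra k B]
    [IsNoetherianRing A₀] [IsNoetherianRing A] [IsNoetherianRing B]
    (π : A →ₐ[k] A₀) (hπ : Function.Surjective π) (hπ_nil : IsNilpotent (RingHom.ker π))
    (p : A' →ₐ[k] A) (hp : Function.Surjective p) (hp_nil : IsNilpotent (RingHom.ker (π.comp p)))
    (hM : RingHom.ker (π.comp p) * RingHom.ker p = ⊥) (hM_fg : (RingHom.ker p).FG)
    (q : B →ₐ[k] A) (hq : Function.Surjective (π.comp q))
    (a : RelBundle.Bun f r (RelBundle.SpecOver k A)) :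
    (RelBundle.gluingFunctor p q f r a).IsEquivalence :=
  (RelBundle.patchBase_fiberProduct f hπ hπ_nil hp hp_nil hq).isEquivalence a
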